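/- **Theorem (Mildly ill-posed problems).** *Model.* Let $\mathcal X,\mathcal Y$ be real Hilbert spaces and $T:\mathcal X\to\mathcal Y$ a bounded linear operator such that $T^*T$ has an orthonormal basis $(e_k)_{k\ge1}$ of $\mathcal X$ of eigenvectors, $T^*Te_k=\lambda_ke_k$, with $e^{-1}\ge\lambda_1\ge\lambda_2\ge\dots>0$ and $$c_{\min}k^{-a}\le\lambda_k\le c_{\max}k^{-a}\qquad(k\ge 1)$$ for some $a>1$ and $0<c_{\min}\le c_{\max}$ (so $T$ is injective and Hilbert–Schmidt). One observes $Y=Tf+\sigma\xi$, $\sigma>0$, in the weak sense, i.e. the real random variables $\langle Y,y\rangle=\langle Tf,y\rangle+\sigma\xi(y)$, $y\in\mathcal Y$, where $\xi$ is Gaussian white noise: a centred Gaussian process indexed by $\mathcal Y$ with $\mathbb E[\xi(y)\xi(z)]=\langle y,z\rangle$. *Ordered filter.* Let $\mathcal A\subset(0,\infty)$ have $0$ as an accumulation point and let $q_\alpha:[0,\|T^*T\|]\to[0,\infty)$, $\alpha\in\mathcal A$, satisfy $\alpha q_\alpha(x)\le C_q'$ and $xq_\alpha(x)\le1$ for all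 $\alpha\in\mathcal A$ and all $x$, and $q_\alpha\le q_{\tilde\alpha}$ whenever $\alpha\ge\tilde\alpha$. Put $\hat f_\alpha=q_\alpha(T^*T)T^*Y=\sum_kq_\alpha(\lambda_k)\langle Y,Te_k\rangle e_k$ and $V(\alpha)=\sum_k\lambda_kq_\alpha(\lambda_k)^2$. *Candidates.* Let $\theta_1>1$, $\theta_2<\infty$, and let $\alpha_0>\alpha_1>\cdots$ in $\mathcal A$ satisfy $\theta_1\le V(\alpha_m)/V(\alpha_{m-1})\le\theta_2$ for all $m\ge1$. Put $v_m=\sigma^2V(\alpha_m)$ and $m_{\max}=\min\{m\ge1: v_m\ge1\}$. *Variance lower bound.* Put $\Sigma(x)=\#\{k:\lambda_k\ge x\}$. Assume that there are $c_{\rm v}>0$ and a continuous function $S:(0,\lambda_1]\to[0,\infty)$ such that $V(\alpha_m)\ge c_{\rm v}S(\alpha_m)/\alpha_m$ for all $m$ with $\alpha_m\le\lambda_1$; $\liminf S(\alpha)/\Sigma(\alpha)>0$ and $\lim \alpha S(\alpha)=0$ as $\alpha\to0$ within $\mathcal A$; and $\frac1\alpha\int_0^\alpha\Sigma(t)\,dt\le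 C_SS(\alpha)$ for all $\alpha\in\mathcal A$, $\alpha\le\lambda_1$, with a constant $C_S$. (For $S(x)=x^{-1/a}$, which has the last three properties, this reads $V(\alpha_m)\ge c\,\alpha_m^{-1-1/a}$.) *SOLIT.* Let $\beta,\gamma>0$. For $0\le m_1<m_2\le m_{\max}$ put $$v_{m_1,m_2}=\sigma^2\sum_k\lambda_k\bigl(q_{\alpha_{m_1}}(\lambda_k)-q_{\alpha_{m_2}}(\lambda_k)\bigr)^2,\qquad N_{m_1,m_2}=\Bigl\|\sum_k\bigl(q_{\alpha_{m_1}}(\lambda_k)-q_{\alpha_{m_2}}(\lambda_k)\bigr)\xi(Te_k)e_k\Bigr\|,$$ let $z_{m_1,m_2}(x)$ be the quantile with $\mathbb P(N_{m_1,m_2}>z_{m_1,m_2}(x))=e^{-x}$ (that is, the smallest $z\ge0$ with $\mathbb P(N_{m_1,m_2}>z)\le e^{-x}$), $x_m=2(1+\gamma)\log(v_{m+1}/v_0)$, and $$\hat m=\min\Bigl\{0\le m_1\le m_{\max}:\ \|\hat f_{\alpha_{m_1}}-\hat f_{\alpha_{m_2}}\|\le\sigma z_{m_1,m_2}(x_{m_1})+\beta\sqrt{v_{m_1,m_2}}\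 \text{ for all } m_1<m_2\le m_{\max}\Bigr\}.$$ *Claim.* For every $\sigma>0$, the estimator $\hat f_{\alpha_{\hat m}}$ is a measurable function of the data (an element of $\mathbb R^{\mathcal Y}$ with the product $\sigma$-algebra); its construction does not involve the smoothness parameters $\nu,\tau,\rho$ below. Let $\rho>0$ and let either $\nu>0$, $\tau\in\mathbb R$, or $\nu=0$, $\tau>0$. Put $\varphi(x)=x^\nu(-\log x)^{-\tau}$ for $0<x\le e^{-1}$ and $\varphi(0)=0$, and $\mathcal W_\varphi(\rho)=\{\varphi(T^*T)g:\|g\|\le\rho\}$, and assume that $\varphi$ is a qualification of the filter: for some constant $C_\varphi$, $\sup_{x\in[0,\|T^*T\|]}\varphi(x)(1-xq_\alpha(x))\le C_\varphi\varphi(\alpha)$ for all $\alpha\in\mathcal A$ with $\alpha\le e^{-1}$. Then there are constants $c,C>0$, not depending on $\sigma$, such that for all sufficiently small $\sigma>0$ $$\sup_{f\in\mathcal W_\varphi(\rho)}\mathbb E\bigl\|\hat f_{\alpha_{\hat m}}-f\bigr\|^2\le C\,(\sigma^2)^{\frac{2\nu}{2\nu+1+1/a}}(-\log\sigma^2)^{-\frac{2\tau(1+1/a)}{2\nu+1+1/a}},$$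 and this rate is minimax: over all measurable functions $\hat f$ of the data, $$\inf_{\hat f}\ \sup_{f\in\mathcal W_\varphi(\rho)}\mathbb E\bigl\|\hat f-f\bigr\|^2\ \ge\ c\,(\sigma^2)^{\frac{2\nu}{2\nu+1+1/a}}(-\log\sigma^2)^{-\frac{2\tau(1+1/a)}{2\nu+1+1/a}}.$$ -/

import Mathlib

open MeasureTheory ProbabilityTheory Set Filter Topology
open scoped ENNReal InnerProductSpace

noncomputable section

namespace SOLIT

section Model

variable {X Y Ω : Type*}
  [NormedAddCommGroup X] [InnerProductSpace ℝ X] [CompleteSpace X]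
  [NormedAddCommGroup Y] [InnerProductSpace ℝ Y] [CompleteSpace Y]
  [MeasurableSpace Ω]

/-- Standard Gaussian Hilbert space process (Gaussian white noise) on `Y`: a centred Gaussian
process indexed by `Y` whose covariance is the inner product. -/
structure IsWhiteNoise (P : Measure Ω) (ξ : Y → Ω → ℝ) : Prop where
  measurable : ∀ y, Measurable (ξ y)
  gaussian : IsGaussianProcess ξ P
  mean : ∀ y, ∫ ω, ξ y ω ∂P = 0
  cov : ∀ y z, ∫ ω, ξ y ω * ξ z ω ∂P = ⟪y, z⟫_ℝ

/-- The operator `T* T`. -/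
def normalOp (T : X →L[ℝ] Y) : X →L[ℝ] X := (ContinuousLinearMap.adjoint T) ∘L T

/-- `lam 0 ≥ lam 1 ≥ ⋯ > 0` are the eigenvalues of `T* T`, repeated according to multiplicity,
with the orthonormal eigenbasis `e 0, e 1, …`. -/
structure IsEigensystem (T : X →L[ℝ] Y) (e : HilbertBasis ℕ ℝ X) (lam : ℕ → ℝ) : Prop where
  eig : ∀ k, normalOp T (e k) = lam k • e k
  anti : Antitone lam
  pos : ∀ k, 0 < lam k

/-- The data `⟨D, y⟩ = ⟨T f, y⟩ + σ ξ(y)`, `y ∈ Y`, of the white noise model `D = T f + σ ξ`. -/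
def obs (T : X →L[ℝ] Y) (ξ : Y → Ω → ℝ) (σ : ℝ) (f : X) (ω : Ω) : Y → ℝ :=
  fun y => ⟪T f, y⟫_ℝ + σ * ξ y ω

/-- The functional calculus `ψ(T* T) g = ∑ₖ ψ(λₖ) ⟨eₖ, g⟩ eₖ`. -/
def specApply (e : HilbertBasis ℕ ℝ X) (lam : ℕ → ℝ) (ψ : ℝ → ℝ) (g : X) : X :=
  ∑' k, (ψ (lam k) * ⟪e k, g⟫_ℝ) • e k

/-- The source set `{ φ(T* T) g : ‖g‖ ≤ ρ }`. -/
def sourceSet (e : HilbertBasis ℕ ℝ X) (lam : ℕ → ℝ) (φ : ℝ → ℝ) (ρ : ℝ) : Set X :=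
  {f | ∃ g : X, ‖g‖ ≤ ρ ∧ f = specApply e lam φ g}

/-- `q_α(T* T) T* D = ∑ₖ q_α(λₖ) ⟨D, T eₖ⟩ eₖ` for weakly given data `D : Y → ℝ`. -/
def filterEst (T : X →L[ℝ] Y) (e : HilbertBasis ℕ ℝ X) (lam : ℕ → ℝ) (q : ℝ → ℝ → ℝ)
    (α : ℝ) (D : Y → ℝ) : X :=
  ∑' k, (q α (lam k) * D (T (e k))) • e k

/-- Mean squared error of an estimator `est`, a function of the data, at the truth `f`. -/
def mse (P : Measure Ω) (T : X →L[ℝ] Y) (ξ : Y → Ω → ℝ) (σ : ℝ) (est : (Y → ℝ) → X)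
    (f : X) : ℝ≥0∞ :=
  ∫⁻ ω, ‖est (obs T ξ σ f ω) - f‖ₑ ^ 2 ∂P

/-- Worst-case mean squared error over a set `W`. -/
def worstMse (P : Measure Ω) (T : X →L[ℝ] Y) (ξ : Y → Ω → ℝ) (σ : ℝ) (est : (Y → ℝ) → X)
    (W : Set X) : ℝ≥0∞ :=
  ⨆ f ∈ W, mse P T ξ σ est f

/-- Minimax risk over `W`; estimators are the measurable functions of the data, where `Y → ℝ`
carries the product `σ`-algebra. -/
def minimaxRisk [MeasurableSpace X] (P : Measure Ω) (T : X →L[ℝ] Y) (ξ : Y → Ω → ℝ) (σ : ℝ)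
    (W : Set X) : ℝ≥0∞ :=
  ⨅ (est : (Y → ℝ) → X) (_ : Measurable est), worstMse P T ξ σ est W

end Model

/-- `φ_{ν,τ}(x) = x ^ ν (- log x) ^ (-τ)`; used for `0 ≤ x ≤ exp (-1)` only. -/
def indexFn (ν τ x : ℝ) : ℝ := x ^ ν * (-Real.log x) ^ (-τ)

theorem indexFn_zero {ν τ : ℝ} (h : 0 < ν ∨ (ν = 0 ∧ 0 < τ)) : indexFn ν τ 0 = 0 := by
  rcases h with h | ⟨_, h⟩
  · simp [indexFn, Real.zero_rpow h.ne']
  · have h' : -τ ≠ 0 := by linarith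
    simp [indexFn, Real.zero_rpow h']

/-- Ordered filter `q_α(x)`, `α ∈ A`, `x ∈ [0, M]`. -/
structure IsOrderedFilter (A : Set ℝ) (M : ℝ) (q : ℝ → ℝ → ℝ) : Prop where
  pos : ∀ α ∈ A, 0 < α
  acc : AccPt (0 : ℝ) (𝓟 A)
  nonneg : ∀ α ∈ A, ∀ x ∈ Icc 0 M, 0 ≤ q α x
  bound : ∃ C : ℝ, ∀ α ∈ A, ∀ x ∈ Icc 0 M, α * q α x ≤ C
  nonexp : ∀ α ∈ A, ∀ x ∈ Icc 0 M, x * q α x ≤ 1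
  ordered : ∀ α ∈ A, ∀ α' ∈ A, α' ≤ α → ∀ x ∈ Icc 0 M, q α x ≤ q α' x

/-- `φ` is a qualification of the filter. Only parameters `α ≤ exp (-1)` are tested, as the index
functions used here make sense on `[0, exp (-1)]`. -/
def IsQualification (A : Set ℝ) (M : ℝ) (q : ℝ → ℝ → ℝ) (φ : ℝ → ℝ) : Prop :=
  ∃ C : ℝ, ∀ α ∈ A, α ≤ Real.exp (-1) → ∀ x ∈ Icc 0 M, φ x * (1 - x * q α x) ≤ C * φ α

/-- The counting function `Σ(x) = #{k : λₖ ≥ x}` for `x > 0`. -/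
def countFn (lam : ℕ → ℝ) (x : ℝ) : ℝ := (Set.ncard {k | x ≤ lam k} : ℝ)

/-- `S : (0, λ₁] → [0, ∞)` is a smooth surrogate of the counting function. Limits `α → 0` are
taken along `A`; `liminf S / Σ > 0` is spelled out as an eventual bound `S ≥ c Σ`, `c > 0`. -/
structure IsSmoothSurrogate (A : Set ℝ) (lam : ℕ → ℝ) (S : ℝ → ℝ) : Prop where
  nonneg : ∀ x ∈ Ioc 0 (lam 0), 0 ≤ S x
  cont : ContinuousOn S (Ioc 0 (lam 0))
  lower : ∃ c > 0, ∀ᶠ α in 𝓝[A] (0 : ℝ), c * countFn lam α ≤ S α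
  lim : Tendsto (fun α => α * S α) (𝓝[A] 0) (𝓝 0)
  integral : ∃ C > 0, ∀ α ∈ A, α ≤ lam 0 → 1 / α * (∫ t in (0 : ℝ)..α, countFn lam t) ≤ C * S α

/-- `V(α) = ∑ₖ λₖ q_α(λₖ)²`, the trace of the covariance of the estimator divided by `σ²`. -/
def varFn (lam : ℕ → ℝ) (q : ℝ → ℝ → ℝ) (α : ℝ) : ℝ := ∑' k, lam k * q α (lam k) ^ 2

/-- Candidate sequence: decreasing in `A`, with variances growing geometrically. -/
structure IsCandidateSeq (A : Set ℝ) (lam : ℕ → ℝ) (q : ℝ → ℝ → ℝ) (θ₁ θ₂ : ℝ)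
    (α : ℕ → ℝ) : Prop where
  mem : ∀ m, α m ∈ A
  anti : StrictAnti α
  ratio_lower : ∀ m, θ₁ ≤ varFn lam q (α (m + 1)) / varFn lam q (α m)
  ratio_upper : ∀ m, varFn lam q (α (m + 1)) / varFn lam q (α m) ≤ θ₂

/-- Lower bound on the variance along the candidates: `σ² V(α_m) ≥ c σ² S(α_m) / α_m` for some
smooth surrogate `S`. As `S` lives on `(0, λ₁]`, only `α_m ≤ λ₁` is considered. -/
def VarianceLowerBound (A : Set ℝ) (lam : ℕ → ℝ) (q : ℝ → ℝ → ℝ) (α : ℕ → ℝ) : Prop :=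
  ∃ S : ℝ → ℝ, IsSmoothSurrogate A lam S ∧
    ∃ c > 0, ∀ m, α m ≤ lam 0 → c * (S (α m) / α m) ≤ varFn lam q (α m)

/-- The variance `v_m = σ² V(α_m)`. -/
def candVar (lam : ℕ → ℝ) (q : ℝ → ℝ → ℝ) (α : ℕ → ℝ) (σ : ℝ) (m : ℕ) : ℝ :=
  σ ^ 2 * varFn lam q (α m)

/-- The variance `v_{m₁,m₂} = σ² ∑ₖ λₖ (q_{α_{m₁}}(λₖ) - q_{α_{m₂}}(λₖ))²`. -/
def pairVar (lam : ℕ → ℝ) (q : ℝ → ℝ → ℝ) (α : ℕ → ℝ) (σ : ℝ) (m₁ m₂ : ℕ) : ℝ :=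
  σ ^ 2 * ∑' k, lam k * (q (α m₁) (lam k) - q (α m₂) (lam k)) ^ 2

/-- `m_max`, the first `m ≥ 1` with `v_m ≥ 1`. -/
def maxIndex (lam : ℕ → ℝ) (q : ℝ → ℝ → ℝ) (α : ℕ → ℝ) (σ : ℝ) : ℕ :=
  sInf {m | 1 ≤ m ∧ 1 ≤ candVar lam q α σ m}

section Rule

variable {X Y Ω : Type*}
  [NormedAddCommGroup X] [InnerProductSpace ℝ X] [CompleteSpace X]
  [NormedAddCommGroup Y] [InnerProductSpace ℝ Y] [CompleteSpace Y]
  [MeasurableSpace Ω]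

/-- `N_{m₁,m₂} = ‖ξ_{α_{m₁}} - ξ_{α_{m₂}}‖` with `ξ_α = q_α(T* T) T* ξ`. -/
def noiseNorm (T : X →L[ℝ] Y) (e : HilbertBasis ℕ ℝ X) (lam : ℕ → ℝ) (q : ℝ → ℝ → ℝ)
    (α : ℕ → ℝ) (ξ : Y → Ω → ℝ) (m₁ m₂ : ℕ) (ω : Ω) : ℝ :=
  ‖filterEst T e lam q (α m₁) (fun y => ξ y ω) - filterEst T e lam q (α m₂) (fun y => ξ y ω)‖

/-- The critical value `z_{m₁,m₂}(x)` with `P(N_{m₁,m₂} > z) = exp (-x)`, built as the quantile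
`inf {z ≥ 0 : P(N_{m₁,m₂} > z) ≤ exp (-x)}` (the law of `N_{m₁,m₂}` is continuous, so that
equality holds there for `x > 0`). -/
def critValue (P : Measure Ω) (T : X →L[ℝ] Y) (e : HilbertBasis ℕ ℝ X) (lam : ℕ → ℝ)
    (q : ℝ → ℝ → ℝ) (α : ℕ → ℝ) (ξ : Y → Ω → ℝ) (m₁ m₂ : ℕ) (x : ℝ) : ℝ :=
  sInf {z : ℝ | 0 ≤ z ∧ P.real {ω | z < noiseNorm T e lam q α ξ m₁ m₂ ω} ≤ Real.exp (-x)}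

/-- `x_m = 2 (1 + γ) log (v_{m+1} / v_0)`. -/
def levelParam (lam : ℕ → ℝ) (q : ℝ → ℝ → ℝ) (α : ℕ → ℝ) (γ σ : ℝ) (m : ℕ) : ℝ :=
  2 * (1 + γ) * Real.log (candVar lam q α σ (m + 1) / candVar lam q α σ 0)

/-- The threshold `σ z_{m₁,m₂}(x_{m₁}) + β √v_{m₁,m₂}`. -/
def threshold (P : Measure Ω) (T : X →L[ℝ] Y) (e : HilbertBasis ℕ ℝ X) (lam : ℕ → ℝ)
    (q : ℝ → ℝ → ℝ) (α : ℕ → ℝ) (ξ : Y → Ω → ℝ) (β γ σ : ℝ) (m₁ m₂ : ℕ) : ℝ :=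
  σ * critValue P T e lam q α ξ m₁ m₂ (levelParam lam q α γ σ m₁)
    + β * Real.sqrt (pairVar lam q α σ m₁ m₂)

/-- The index `m̂` selected from the data `D`. -/
def solitIndex (P : Measure Ω) (T : X →L[ℝ] Y) (e : HilbertBasis ℕ ℝ X) (lam : ℕ → ℝ)
    (q : ℝ → ℝ → ℝ) (α : ℕ → ℝ) (ξ : Y → Ω → ℝ) (β γ σ : ℝ) (D : Y → ℝ) : ℕ :=
  sInf {m₁ | m₁ ≤ maxIndex lam q α σ ∧ ∀ m₂, m₁ < m₂ → m₂ ≤ maxIndex lam q α σ →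
    ‖filterEst T e lam q (α m₁) D - filterEst T e lam q (α m₂) D‖
      - threshold P T e lam q α ξ β γ σ m₁ m₂ ≤ 0}

/-- The filter estimator with the parameter `α_{m̂}`, as a function of the data `D`. -/
def solitEst (P : Measure Ω) (T : X →L[ℝ] Y) (e : HilbertBasis ℕ ℝ X) (lam : ℕ → ℝ)
    (q : ℝ → ℝ → ℝ) (α : ℕ → ℝ) (ξ : Y → Ω → ℝ) (β γ σ : ℝ) (D : Y → ℝ) : X :=
  filterEst T e lam q (α (solitIndex P T e lam q α ξ β γ σ D)) D

end Rule

/-- `(σ²)^{2ν/(2ν+1+1/a)} (-log σ²)^{-2τ(1+1/a)/(2ν+1+1/a)}`. -/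
def mildRate (a ν τ σ : ℝ) : ℝ :=
  (σ ^ 2) ^ (2 * ν / (2 * ν + 1 + 1 / a)) *
    (-Real.log (σ ^ 2)) ^ (-(2 * τ * (1 + 1 / a) / (2 * ν + 1 + 1 / a)))

end SOLIT

end

/-! Put `s = 2ν + 1 + 1/a` and `x = (σ²)^{1/s} (-log σ²)^{2τ/s}` (`idealPar`). Polynomial decay and
the variance lower bound give `V(α) ≍ α^{-(1+1/a)}` along small candidates, and the qualification
bounds the squared bias over the source set by a multiple of `φ(α)²`. At `α ≍ x` both `σ² V(α)` and
`φ(α)²` have the order of `mildRate`, so the claim is that the selection rule behaves as if it knew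
`x`, and that no estimator does better.

Upper bound. Fix a candidate `M` with `α M ≍ x` whose bias is small against its standard deviation.
If `m̂ ≤ M`, the acceptance test has compared `m̂` with `M`, so the two estimators differ by at most
a threshold. Its square is of order `σ² V(α M)`: Gaussian concentration (`critValue_le`) leaves the
logarithmic level `x_m` multiplied only by the largest single variance, of order `1/α`, and `log V /
α ≲ V` (`exists_log_mul_le`). If `m̂ = j + 1 > M`, then `j` was rejected although its bias lies
below the `β` part of the threshold. The noise must therefore exceed its critical value, an event of
probability at most `(V(α_0)/V(α_{j+1}))²`; this is rare enough to compensate the noise at `j + 1`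
(`lintegral_failure_le`). Each pair of indices costs a multiple of `σ² V(α_0)`, and there are
`O(log² σ²)` pairs, which is negligible because `2ν/s < 1`. The result is the oracle inequality
`mse_solitEst_le`, evaluated at `M` in `worstMse_solitEst_le_mildRate`.

Lower bound. `minimaxRisk_ge_mildRate` uses Assouad's cube: about `x^{-1/a}` coordinates with `λ_k ≍
x` carry signs of amplitude `b` with `b² ≍ σ²/x`. Each sign is invisible at noise level `σ`
(`IsWhiteNoise.two_point`), so it costs a multiple of `b²`, and the source condition holds because
the rate balances `φ(x)²`. -/

namespace SOLIT

/-! ### Series in an orthonormal basis and their measurability. -/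

section HilbertBasis

variable {X : Type*} [NormedAddCommGroup X] [InnerProductSpace ℝ X] [CompleteSpace X]

theorem summable_smul_basis_iff (e : HilbertBasis ℕ ℝ X) (c : ℕ → ℝ) :
    (Summable fun k => c k • e k) ↔ Summable fun k => c k ^ 2 := by
  have := e.orthonormal.orthogonalFamily.summable_iff_norm_sq_summable c
  simpa [LinearIsometry.toSpanSingleton_apply] using this

theorem inner_tsum_smul_basis (e : HilbertBasis ℕ ℝ X) {c : ℕ → ℝ}
    (hc : Summable fun k => c k ^ 2) (k : ℕ) : ⟪e k, ∑' j, c j • e j⟫_ℝ = c k := by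
  have h := ((summable_smul_basis_iff e c).2 hc).hasSum.mapL (innerSL ℝ (e k))
  rw [innerSL_apply_apply] at h
  refine h.unique ?_
  have h2 : HasSum (fun j => if j = k then c k else 0) (c k) := hasSum_ite_eq k (c k)
  refine h2.congr_fun fun j => ?_
  rw [innerSL_apply_apply, inner_smul_right, orthonormal_iff_ite.1 e.orthonormal]
  by_cases hjk : k = j
  · subst hjk; simp
  · simp [hjk, Ne.symm hjk]

omit [CompleteSpace X] in
theorem hasSum_inner_sq (e : HilbertBasis ℕ ℝ X) (f : X) :
    HasSum (fun k => ⟪e k, f⟫_ℝ ^ 2) (‖f‖ ^ 2) := by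
  have := e.hasSum_inner_mul_inner f f
  rw [real_inner_self_eq_norm_sq] at this
  refine this.congr_fun fun k => ?_
  rw [real_inner_comm f (e k), sq]

omit [CompleteSpace X] in
theorem tsum_inner_smul_basis (e : HilbertBasis ℕ ℝ X) (f : X) :
    ∑' k, ⟪e k, f⟫_ℝ • e k = f := by
  have := (e.hasSum_repr f).tsum_eq
  simpa only [e.repr_apply_apply] using this

theorem norm_sq_tsum_smul_basis (e : HilbertBasis ℕ ℝ X) {c : ℕ → ℝ}
    (hc : Summable fun k => c k ^ 2) : ‖∑' j, c j • e j‖ ^ 2 = ∑' k, c k ^ 2 := by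
  rw [← (hasSum_inner_sq e _).tsum_eq]
  simp_rw [inner_tsum_smul_basis e hc]

omit [CompleteSpace X] in
theorem secondCountableTopology_of_hilbertBasis (e : HilbertBasis ℕ ℝ X) :
    SecondCountableTopology X := by
  have h : TopologicalSpace.IsSeparable
      (closure (Submodule.span ℝ (Set.range e) : Set X)) :=
    ((Set.countable_range e).isSeparable.span (R := ℝ)).closure
  have h2 : closure (Submodule.span ℝ (Set.range e) : Set X) = Set.univ := by
    rw [← Submodule.topologicalClosure_coe, e.dense_span, Submodule.top_coe]
  rw [h2, TopologicalSpace.isSeparable_univ_iff] at h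
  exact UniformSpace.secondCountable_of_separable X

/-- A divergent series has `tsum` equal to `0`, so the sum need not be the pointwise limit of its
partial sums. Cutting the coefficients off outside the measurable set of square summability restores
this. -/
theorem measurable_tsum_smul_basis [MeasurableSpace X] [BorelSpace X] {D : Type*}
    [MeasurableSpace D] (e : HilbertBasis ℕ ℝ X) {c : ℕ → D → ℝ} (hc : ∀ k, Measurable (c k)) :
    Measurable fun d => ∑' k, c k d • e k := by
  have := secondCountableTopology_of_hilbertBasis e
  have hset : {d | Summable fun k => c k d ^ 2}
      = {d | ∑' k, ENNReal.ofReal (c k d ^ 2) ≠ ∞} := by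
    ext d
    refine ⟨fun h => h.tsum_ofReal_ne_top, fun h => ?_⟩
    have := ENNReal.summable_toReal h
    simpa [ENNReal.toReal_ofReal, sq_nonneg] using this
  have hmeas : MeasurableSet {d | Summable fun k => c k d ^ 2} := by
    rw [hset]
    have : Measurable fun d => ∑' k, ENNReal.ofReal (c k d ^ 2) :=
      Measurable.tsum fun k => ((hc k).pow_const 2).ennreal_ofReal
    exact (this (measurableSet_singleton ∞)).compl
  have hlim : ∀ d, Tendsto (fun n => ∑ k ∈ Finset.range n,
      ({d | Summable fun k => c k d ^ 2}.indicator (c k) d) • e k) atTop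
      (𝓝 (∑' k, c k d • e k)) := by
    intro d
    by_cases h : Summable fun k => c k d ^ 2
    · have := ((summable_smul_basis_iff e _).2 h).hasSum.tendsto_sum_nat
      simpa [Set.indicator, h] using this
    · have h' : ¬ Summable fun k => c k d • e k := fun h' => h ((summable_smul_basis_iff e _).1 h')
      rw [tsum_eq_zero_of_not_summable h']
      simp [Set.indicator, h]
  refine measurable_of_tendsto_metrizable (fun n => ?_) (tendsto_pi_nhds.2 hlim)
  exact Finset.measurable_sum _ fun k _ => ((hc k).indicator hmeas).smul_const (e k)

end HilbertBasis

/-! ### Measurability of the selected estimator. -/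

section Measurability

variable {X Y Ω : Type*}
  [NormedAddCommGroup X] [InnerProductSpace ℝ X] [CompleteSpace X]
  [NormedAddCommGroup Y] [InnerProductSpace ℝ Y] [CompleteSpace Y]
  [MeasurableSpace Ω] [MeasurableSpace X] [BorelSpace X]

omit [CompleteSpace Y] in
theorem measurable_filterEst (T : X →L[ℝ] Y) (e : HilbertBasis ℕ ℝ X) (lam : ℕ → ℝ)
    (q : ℝ → ℝ → ℝ) (a : ℝ) : Measurable (filterEst T e lam q a) :=
  measurable_tsum_smul_basis e fun k => (measurable_pi_apply (T (e k))).const_mul _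

theorem measurable_natFun_sInf {D : Type*} [MeasurableSpace D] {S : D → Set ℕ}
    (hne : ∀ d, (S d).Nonempty) (hS : ∀ m, MeasurableSet {d | m ∈ S d}) :
    Measurable fun d => sInf (S d) := by
  classical
  have : (fun d => sInf (S d)) = fun d => Nat.find (hne d) := by
    ext d; exact Nat.sInf_def (hne d)
  rw [this]
  exact measurable_find hne hS

omit [CompleteSpace Y] in
theorem measurable_solitEst (P : Measure Ω) (T : X →L[ℝ] Y) (ξ : Y → Ω → ℝ)
    (e : HilbertBasis ℕ ℝ X) (lam : ℕ → ℝ) (q : ℝ → ℝ → ℝ) (α : ℕ → ℝ) (β γ σ : ℝ) :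
    Measurable (solitEst P T e lam q α ξ β γ σ) := by
  have := secondCountableTopology_of_hilbertBasis e
  have hidx : Measurable (solitIndex P T e lam q α ξ β γ σ) := by
    -- The last index is always admissible, its test being vacuous, so the infimum never takes its
    -- default value.
    refine measurable_natFun_sInf (fun D => ⟨maxIndex lam q α σ, le_rfl, fun m₂ h h' => ?_⟩)
      fun m => ?_
    · exact absurd h' (not_le.2 h)
    · simp only [mem_ofPred_eq, measurableSet_setOfPred]
      refine Measurable.and measurable_const (Measurable.forall fun m₂ => ?_)
      refine Measurable.imp measurable_const (Measurable.imp measurable_const ?_)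
      refine measurableSet_setOfPred.1 (measurableSet_le ?_ measurable_const)
      exact (((measurable_filterEst T e lam q _).sub (measurable_filterEst T e lam q _)).norm).sub
        measurable_const
  have h2 : Measurable fun p : ℕ × (Y → ℝ) => filterEst T e lam q (α p.1) p.2 :=
    measurable_from_prod_countable_right fun m => measurable_filterEst T e lam q (α m)
  exact h2.comp (hidx.prodMk measurable_id)

end Measurability

/-! ### Exponential moments and tails of norms of Gaussian series. -/

section Gaussian

open scoped NNReal

/-- The integral is `(1 - 2y)^{-1/2}` with `y = s v`. It is at most `e^{2y}` because `(1 - 2y)(1 +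
4y) ≥ 1` exactly on `0 ≤ y ≤ 1/4`. -/
theorem lintegral_exp_mul_sq_gaussianReal_le (v : ℝ≥0) {s : ℝ} (hsv : s * v ≤ 1 / 4)
    (hs : 0 ≤ s) :
    ∫⁻ x, ENNReal.ofReal (Real.exp (s * x ^ 2)) ∂(gaussianReal 0 v)
      ≤ ENNReal.ofReal (Real.exp (2 * (s * v))) := by
  rcases eq_or_ne v 0 with rfl | hv
  · simp
  have hv' : (0 : ℝ) < v := NNReal.coe_pos.2 (pos_iff_ne_zero.2 hv)
  have hb : 0 < 1 / (2 * v) - s := by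
    rw [sub_pos, lt_div_iff₀ (by positivity)]; linarith
  have hden : ∀ x : ℝ, gaussianPDF 0 v x * ENNReal.ofReal (Real.exp (s * x ^ 2))
      = ENNReal.ofReal ((√(2 * Real.pi * v))⁻¹ * Real.exp (-(1 / (2 * v) - s) * x ^ 2)) := by
    intro x
    rw [gaussianPDF, ← ENNReal.ofReal_mul (gaussianPDFReal_nonneg _ _ _), gaussianPDFReal,
      mul_assoc, ← Real.exp_add]
    congr 3
    field_simp
    ring
  rw [gaussianReal_of_var_ne_zero _ hv, lintegral_withDensity_eq_lintegral_mul _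
    (measurable_gaussianPDF 0 v) (by fun_prop)]
  simp only [Pi.mul_apply, hden]
  rw [← ofReal_integral_eq_lintegral_ofReal ((integrable_exp_neg_mul_sq hb).const_mul _)
    (ae_of_all _ fun x => by positivity), integral_const_mul, integral_gaussian]
  refine ENNReal.ofReal_le_ofReal ?_
  rw [← Real.sqrt_inv, ← Real.sqrt_mul (by positivity), Real.sqrt_le_left (by positivity),
    ← Real.exp_nat_mul]
  have h1 : (2 * Real.pi * v)⁻¹ * (Real.pi / (1 / (2 * v) - s)) = (1 - 2 * (s * v))⁻¹ := by
    have : (1 - 2 * (s * (v : ℝ))) ≠ 0 := by linarith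
    have h3 : (1 / (2 * (v : ℝ)) - s) = (1 - 2 * (s * v)) / (2 * v) := by field_simp
    rw [h3]
    field_simp
  rw [h1]
  have hy : 0 ≤ s * v := by positivity
  refine inv_le_of_inv_le₀ (Real.exp_pos _) ?_
  rw [← Real.exp_neg]
  have h2 : 1 + 4 * (s * v) ≤ Real.exp (4 * (s * v)) := by
    linarith [Real.add_one_le_exp (4 * (s * v))]
  have h4 : Real.exp (-(((2 : ℕ) : ℝ) * (2 * (s * v)))) * Real.exp (4 * (s * v)) = 1 := by
    rw [← Real.exp_add]; norm_num; ring
  have h5 : 1 ≤ (1 - 2 * (s * v)) * Real.exp (4 * (s * v)) := by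
    nlinarith
  nlinarith [Real.exp_pos (4 * (s * v))]

variable {X Ω : Type*} [NormedAddCommGroup X] [InnerProductSpace ℝ X] [CompleteSpace X]
  [MeasurableSpace Ω] {P : Measure Ω} {x : ℕ → Ω → ℝ} {v : ℕ → ℝ≥0}

/-- A sequence of independent centred Gaussian variables with variances `v k`. -/
structure IsGaussianSeq (P : Measure Ω) (x : ℕ → Ω → ℝ) (v : ℕ → ℝ≥0) : Prop where
  measurable : ∀ k, Measurable (x k)
  indep : iIndepFun x P
  law : ∀ k, P.map (x k) = gaussianReal 0 (v k)

theorem IsGaussianSeq.lintegral_exp_sum_le (hx : IsGaussianSeq P x v) (c : ℕ → ℝ) {t : ℝ}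
    (ht : 0 ≤ t) (hc : ∀ k, t * (c k ^ 2 * v k) ≤ 1 / 4) (s : Finset ℕ) :
    ∫⁻ ω, ENNReal.ofReal (Real.exp (t * ∑ k ∈ s, (c k * x k ω) ^ 2)) ∂P
      ≤ ENNReal.ofReal (Real.exp (2 * t * ∑ k ∈ s, c k ^ 2 * v k)) := by
  have hm : ∀ k, Measurable fun y : ℝ => ENNReal.ofReal (Real.exp (t * c k ^ 2 * y ^ 2)) :=
    fun k => by fun_prop
  have hprod := lintegral_prod_eq_prod_lintegral_of_indepFun s
    (fun k ω => ENNReal.ofReal (Real.exp (t * c k ^ 2 * x k ω ^ 2)))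
    (hx.indep.comp _ hm) fun k => (hm k).comp (hx.measurable k)
  have hl : ∀ ω, ENNReal.ofReal (Real.exp (t * ∑ k ∈ s, (c k * x k ω) ^ 2))
      = ∏ k ∈ s, ENNReal.ofReal (Real.exp (t * c k ^ 2 * x k ω ^ 2)) := by
    intro ω
    rw [← ENNReal.ofReal_prod_of_nonneg fun k _ => (Real.exp_pos _).le, ← Real.exp_sum,
      Finset.mul_sum]
    simp only [mul_pow, mul_assoc]
  simp_rw [hl]
  rw [hprod, Finset.mul_sum, Real.exp_sum, ENNReal.ofReal_prod_of_nonneg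
    fun k _ => (Real.exp_pos _).le]
  refine Finset.prod_le_prod' fun k _ => ?_
  have h1 := lintegral_map (μ := P) (hm k) (hx.measurable k)
  rw [← h1, hx.law k]
  have h2 := lintegral_exp_mul_sq_gaussianReal_le (v k) (s := t * c k ^ 2)
    (by rw [mul_assoc]; exact hc k) (by positivity)
  refine h2.trans_eq ?_
  ring_nf

theorem IsGaussianSeq.measurable_norm (hx : IsGaussianSeq P x v) (e : HilbertBasis ℕ ℝ X)
    (c : ℕ → ℝ) : Measurable fun ω => ‖∑' k, (c k * x k ω) • e k‖ := by
  let _ : MeasurableSpace X := borel X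
  have : BorelSpace X := ⟨rfl⟩
  exact (measurable_tsum_smul_basis e fun k => (hx.measurable k).const_mul _).norm

/-- Fatou's lemma along partial sums. Outcomes with a divergent series do no harm: there the norm is
`0` by default, below every partial sum. -/
theorem IsGaussianSeq.lintegral_exp_le (hx : IsGaussianSeq P x v) [IsProbabilityMeasure P]
    (e : HilbertBasis ℕ ℝ X) (c : ℕ → ℝ) {t : ℝ} (ht : 0 ≤ t)
    (hc : ∀ k, t * (c k ^ 2 * v k) ≤ 1 / 4) (hsum : Summable fun k => c k ^ 2 * v k) :
    ∫⁻ ω, ENNReal.ofReal (Real.exp (t * ‖∑' k, (c k * x k ω) • e k‖ ^ 2)) ∂P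
      ≤ ENNReal.ofReal (Real.exp (2 * t * ∑' k, c k ^ 2 * v k)) := by
  have hxm := hx.measurable
  have hpt : ∀ ω, ENNReal.ofReal (Real.exp (t * ‖∑' k, (c k * x k ω) • e k‖ ^ 2))
      ≤ liminf (fun n => ENNReal.ofReal
        (Real.exp (t * ∑ k ∈ Finset.range n, (c k * x k ω) ^ 2))) atTop := by
    intro ω
    by_cases h : Summable fun k => (c k * x k ω) ^ 2
    · rw [norm_sq_tsum_smul_basis e h]
      refine (Tendsto.liminf_eq ?_).ge
      refine ENNReal.tendsto_ofReal ((Real.continuous_exp.tendsto _).comp ?_)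
      exact h.hasSum.tendsto_sum_nat.const_mul t
    · rw [tsum_eq_zero_of_not_summable fun h' => h ((summable_smul_basis_iff e _).1 h')]
      refine le_liminf_of_le (by isBoundedDefault) (Eventually.of_forall fun n => ?_)
      refine ENNReal.ofReal_le_ofReal (Real.exp_le_exp.2 ?_)
      simpa using mul_nonneg ht (Finset.sum_nonneg fun k _ => sq_nonneg _)
  refine (lintegral_mono hpt).trans ((lintegral_liminf_le fun n => by fun_prop).trans ?_)
  refine liminf_le_of_le (by isBoundedDefault) fun b hb => ?_
  obtain ⟨n, hn⟩ := hb.exists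
  refine hn.trans ((hx.lintegral_exp_sum_le c ht hc _).trans ?_)
  refine ENNReal.ofReal_le_ofReal (Real.exp_le_exp.2 ?_)
  have := hsum.sum_le_tsum (Finset.range n) fun k _ => by positivity
  gcongr

theorem IsGaussianSeq.lintegral_exp_div_le (hx : IsGaussianSeq P x v) [IsProbabilityMeasure P]
    (e : HilbertBasis ℕ ℝ X) (c : ℕ → ℝ) (hsum : Summable fun k => c k ^ 2 * v k)
    (hV : 0 < ∑' k, c k ^ 2 * v k) :
    ∫⁻ ω, ENNReal.ofReal (Real.exp (1 / (4 * ∑' k, c k ^ 2 * v k)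
      * ‖∑' k, (c k * x k ω) • e k‖ ^ 2)) ∂P ≤ ENNReal.ofReal 2 := by
  refine (hx.lintegral_exp_le e c (by positivity) (fun k => ?_) hsum).trans ?_
  · have := hsum.le_tsum k fun j _ => by positivity
    rw [div_mul_eq_mul_div, one_mul, div_le_div_iff₀ (by positivity) (by norm_num)]
    linarith
  · refine ENNReal.ofReal_le_ofReal ?_
    have h1 : 2 * (1 / (4 * ∑' k, c k ^ 2 * (v k : ℝ))) * ∑' k, c k ^ 2 * (v k : ℝ) = 1 / 2 := by
      field_simp; norm_num
    rw [h1]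
    -- `√e ≤ 2` because `e ≤ 4`.
    have h2 : Real.exp (1 / 2) ^ 2 = Real.exp 1 := by
      rw [← Real.exp_nat_mul]; norm_num
    nlinarith [Real.exp_pos (1 / 2), Real.exp_one_lt_d9]

/-- With `u = ‖·‖² / (4V)`, use `u ≤ e^u` and `E e^u ≤ 2`. The fourth moment below comes from `u² ≤
2 e^u` in the same way. Sharp constants are not needed. -/
theorem IsGaussianSeq.lintegral_norm_sq_le (hx : IsGaussianSeq P x v) [IsProbabilityMeasure P]
    (e : HilbertBasis ℕ ℝ X) (c : ℕ → ℝ) (hsum : Summable fun k => c k ^ 2 * v k)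
    (hV : 0 < ∑' k, c k ^ 2 * v k) :
    ∫⁻ ω, ENNReal.ofReal (‖∑' k, (c k * x k ω) • e k‖ ^ 2) ∂P
      ≤ ENNReal.ofReal (8 * ∑' k, c k ^ 2 * v k) := by
  have hpt : ∀ ω, ENNReal.ofReal (‖∑' k, (c k * x k ω) • e k‖ ^ 2)
      ≤ ENNReal.ofReal (4 * ∑' k, c k ^ 2 * v k) * ENNReal.ofReal
        (Real.exp (1 / (4 * ∑' k, c k ^ 2 * v k) * ‖∑' k, (c k * x k ω) • e k‖ ^ 2)) := by
    intro ω
    rw [← ENNReal.ofReal_mul (by positivity)]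
    refine ENNReal.ofReal_le_ofReal ?_
    have := Real.add_one_le_exp
      (1 / (4 * ∑' k, c k ^ 2 * (v k : ℝ)) * ‖∑' k, (c k * x k ω) • e k‖ ^ 2)
    calc _ = (4 * ∑' k, c k ^ 2 * (v k : ℝ)) *
          (1 / (4 * ∑' k, c k ^ 2 * (v k : ℝ)) * ‖∑' k, (c k * x k ω) • e k‖ ^ 2) := by
          field_simp
      _ ≤ _ := by gcongr; linarith
  refine (lintegral_mono hpt).trans ?_
  rw [lintegral_const_mul' _ _ ENNReal.ofReal_ne_top]
  refine (mul_le_mul_right (hx.lintegral_exp_div_le e c hsum hV) _).trans_eq ?_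
  rw [← ENNReal.ofReal_mul (by positivity)]
  ring_nf

theorem IsGaussianSeq.lintegral_norm_pow_four_le (hx : IsGaussianSeq P x v)
    [IsProbabilityMeasure P]
    (e : HilbertBasis ℕ ℝ X) (c : ℕ → ℝ) (hsum : Summable fun k => c k ^ 2 * v k)
    (hV : 0 < ∑' k, c k ^ 2 * v k) :
    ∫⁻ ω, ENNReal.ofReal (‖∑' k, (c k * x k ω) • e k‖ ^ 4) ∂P
      ≤ ENNReal.ofReal (64 * (∑' k, c k ^ 2 * v k) ^ 2) := by
  have hpt : ∀ ω, ENNReal.ofReal (‖∑' k, (c k * x k ω) • e k‖ ^ 4)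
      ≤ ENNReal.ofReal (32 * (∑' k, c k ^ 2 * v k) ^ 2) * ENNReal.ofReal
        (Real.exp (1 / (4 * ∑' k, c k ^ 2 * v k) * ‖∑' k, (c k * x k ω) • e k‖ ^ 2)) := by
    intro ω
    rw [← ENNReal.ofReal_mul (by positivity)]
    refine ENNReal.ofReal_le_ofReal ?_
    have := Real.quadratic_le_exp_of_nonneg
      (x := 1 / (4 * ∑' k, c k ^ 2 * (v k : ℝ)) * ‖∑' k, (c k * x k ω) • e k‖ ^ 2)
      (by positivity)
    calc _ = (32 * (∑' k, c k ^ 2 * (v k : ℝ)) ^ 2) *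
          ((1 / (4 * ∑' k, c k ^ 2 * (v k : ℝ)) * ‖∑' k, (c k * x k ω) • e k‖ ^ 2) ^ 2 / 2) := by
          field_simp; ring
      _ ≤ _ := by
          gcongr
          have : 0 ≤ 1 / (4 * ∑' k, c k ^ 2 * (v k : ℝ)) * ‖∑' k, (c k * x k ω) • e k‖ ^ 2 := by
            positivity
          linarith
  refine (lintegral_mono hpt).trans ?_
  rw [lintegral_const_mul' _ _ ENNReal.ofReal_ne_top]
  refine (mul_le_mul_right (hx.lintegral_exp_div_le e c hsum hV) _).trans_eq ?_
  rw [← ENNReal.ofReal_mul (by positivity)]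
  ring_nf

/-- Chernoff's bound at `t = 1/(4M)`, a value for which every coordinate has the required
exponential moment. The deviation `y` is multiplied by the bound `M` on the single variances and not
by their sum; this is what later prevents a logarithmic loss. -/
theorem IsGaussianSeq.measure_norm_sq_gt_le (hx : IsGaussianSeq P x v) [IsProbabilityMeasure P]
    (e : HilbertBasis ℕ ℝ X) (c : ℕ → ℝ) (hsum : Summable fun k => c k ^ 2 * v k)
    {M : ℝ} (hM : 0 < M) (hc : ∀ k, c k ^ 2 * v k ≤ M) (y : ℝ) :
    P.real {ω | 2 * ∑' k, c k ^ 2 * v k + 4 * M * y < ‖∑' k, (c k * x k ω) • e k‖ ^ 2}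
      ≤ Real.exp (-y) := by
  have h1 := hx.lintegral_exp_le e c (t := 1 / (4 * M)) (by positivity) (fun k => by
    rw [div_mul_eq_mul_div, one_mul, div_le_div_iff₀ (by positivity) (by norm_num)]
    linarith [hc k]) hsum
  set V := ∑' k, c k ^ 2 * (v k : ℝ) with hVdef
  have h2 : ENNReal.ofReal (Real.exp (1 / (4 * M) * (2 * V + 4 * M * y))) *
      P {ω | 2 * V + 4 * M * y < ‖∑' k, (c k * x k ω) • e k‖ ^ 2}
      ≤ ENNReal.ofReal (Real.exp (2 * (1 / (4 * M)) * V)) := by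
    refine le_trans ?_ h1
    refine le_trans ?_ (mul_meas_ge_le_lintegral₀ (hx.measurable_norm e c |>.pow_const 2
      |>.const_mul _ |>.exp.ennreal_ofReal.aemeasurable)
      (ENNReal.ofReal (Real.exp (1 / (4 * M) * (2 * V + 4 * M * y)))))
    refine mul_le_mul_right (measure_mono fun ω hω => ?_) _
    refine ENNReal.ofReal_le_ofReal (Real.exp_le_exp.2 ?_)
    exact mul_le_mul_of_nonneg_left (le_of_lt hω) (by positivity)
  rw [← ofReal_measureReal, ← ENNReal.ofReal_mul (Real.exp_pos _).le,
    ENNReal.ofReal_le_ofReal_iff (Real.exp_pos _).le] at h2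
  rw [← mul_le_mul_iff_right₀ (Real.exp_pos (1 / (4 * M) * (2 * V + 4 * M * y)))]
  refine h2.trans_eq ?_
  rw [← Real.exp_add]
  congr 1
  field_simp
  ring

end Gaussian

/-! ### White noise in the singular coordinates of the operator. -/

section WhiteNoise

variable {X Y Ω : Type*}
  [NormedAddCommGroup X] [InnerProductSpace ℝ X] [CompleteSpace X]
  [NormedAddCommGroup Y] [InnerProductSpace ℝ Y] [CompleteSpace Y]
  [MeasurableSpace Ω] {P : Measure Ω} {ξ : Y → Ω → ℝ}

omit [CompleteSpace Y] in
theorem IsWhiteNoise.memLp (hξ : IsWhiteNoise P ξ) (y : Y) : MemLp (ξ y) 2 P :=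
  (hξ.gaussian.hasGaussianLaw_eval y).memLp_two

omit [CompleteSpace Y] in
theorem IsWhiteNoise.covariance_eq [IsProbabilityMeasure P] (hξ : IsWhiteNoise P ξ) (y z : Y) :
    cov[ξ y, ξ z; P] = ⟪y, z⟫_ℝ := by
  rw [covariance_eq_sub (hξ.memLp y) (hξ.memLp z), hξ.mean y, zero_mul, sub_zero]
  exact hξ.cov y z

omit [CompleteSpace Y] in
theorem IsWhiteNoise.map_eq [IsProbabilityMeasure P] (hξ : IsWhiteNoise P ξ) (y : Y) :
    P.map (ξ y) = gaussianReal 0 (⟪y, y⟫_ℝ).toNNReal := by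
  rw [(hξ.gaussian.hasGaussianLaw_eval y).map_eq_gaussianReal, hξ.mean y,
    ← covariance_self (hξ.measurable y).aemeasurable, hξ.covariance_eq]

variable {T : X →L[ℝ] Y} {e : HilbertBasis ℕ ℝ X} {lam : ℕ → ℝ}

theorem IsEigensystem.inner_map_map (he : IsEigensystem T e lam) (i j : ℕ) :
    ⟪T (e i), T (e j)⟫_ℝ = if i = j then lam i else 0 := by
  rw [← ContinuousLinearMap.adjoint_inner_left]
  change ⟪normalOp T (e i), e j⟫_ℝ = _
  rw [he.eig, real_inner_smul_left, orthonormal_iff_ite.1 e.orthonormal]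
  simp

theorem IsEigensystem.inner_map_basis (he : IsEigensystem T e lam) (f : X) (k : ℕ) :
    ⟪T f, T (e k)⟫_ℝ = lam k * ⟪e k, f⟫_ℝ := by
  rw [real_inner_comm, ← ContinuousLinearMap.adjoint_inner_left]
  change ⟪normalOp T (e k), f⟫_ℝ = _
  rw [he.eig, real_inner_smul_left]

theorem IsEigensystem.le_norm (he : IsEigensystem T e lam) (k : ℕ) : lam k ≤ ‖normalOp T‖ := by
  have := (normalOp T).le_opNorm (e k)
  rw [he.eig, norm_smul, e.orthonormal.1 k, mul_one, mul_one] at this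
  exact (le_abs_self _).trans this

theorem IsEigensystem.isGaussianSeq [IsProbabilityMeasure P] (hξ : IsWhiteNoise P ξ)
    (he : IsEigensystem T e lam) :
    IsGaussianSeq P (fun k => ξ (T (e k))) (fun k => (lam k).toNNReal) where
  measurable k := hξ.measurable _
  law k := by rw [hξ.map_eq, he.inner_map_map, if_pos rfl]
  indep := by
    -- The images `T e_k` are orthogonal, so the coordinates are uncorrelated and, being jointly
    -- Gaussian, independent. Each is treated as a process indexed by `Unit` to fit the criterion
    -- for families of processes.
    have hg : IsGaussianProcess (fun (p : (_ : ℕ) × Unit) ω => ξ (T (e p.1)) ω) P :=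
      hξ.gaussian.comp_right fun p : (_ : ℕ) × Unit => T (e p.1)
    have h := hg.iIndepFun_of_covariance_eq_zero (X := fun k _ ω => ξ (T (e k)) ω)
      (fun k _ => (hξ.measurable _).aemeasurable) fun i j hij _ _ => by
        rw [hξ.covariance_eq, he.inner_map_map, if_neg hij]
    exact h.comp (fun _ z => z ()) fun _ => measurable_pi_apply ()

/-- The expected sum of squares is the trace `∑ λ_k`, which is finite. -/
theorem IsEigensystem.ae_summable_sq [IsProbabilityMeasure P] (hξ : IsWhiteNoise P ξ)
    (he : IsEigensystem T e lam) (hs : Summable lam) :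
    ∀ᵐ ω ∂P, Summable fun k => ξ (T (e k)) ω ^ 2 := by
  have hm : ∀ k, Measurable fun ω => ENNReal.ofReal (ξ (T (e k)) ω ^ 2) :=
    fun k => ((hξ.measurable _).pow_const 2).ennreal_ofReal
  have hk : ∀ k, ∫⁻ ω, ENNReal.ofReal (ξ (T (e k)) ω ^ 2) ∂P = ENNReal.ofReal (lam k) := by
    intro k
    rw [← ofReal_integral_eq_lintegral_ofReal (hξ.memLp _).integrable_sq
      (ae_of_all _ fun ω => sq_nonneg _)]
    simp_rw [sq]
    rw [hξ.cov, he.inner_map_map, if_pos rfl]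
  have hint : ∫⁻ ω, ∑' k, ENNReal.ofReal (ξ (T (e k)) ω ^ 2) ∂P ≠ ∞ := by
    rw [lintegral_tsum fun k => (hm k).aemeasurable]
    simp_rw [hk]
    exact hs.tsum_ofReal_ne_top
  filter_upwards [ae_lt_top (Measurable.tsum hm) hint] with ω hω
  have := ENNReal.summable_toReal hω.ne
  simpa [ENNReal.toReal_ofReal, sq_nonneg] using this

end WhiteNoise

/-! ### Testing between two shifts of white noise along one direction. -/

section TwoPoint

/-- Lower bound of the standard Gaussian density on `[-2, 2]`. -/
noncomputable def gaussianFloor : ℝ := (√(2 * Real.pi))⁻¹ * Real.exp (-2)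

theorem gaussianFloor_pos : 0 < gaussianFloor := by
  unfold gaussianFloor; positivity

/-- On `[-1, 1]` all normal densities with mean at most `1` in modulus exceed the same constant,
since the distance to the mean is at most `2`. This common part replaces a total variation estimate.
-/
theorem lintegral_gaussianReal_add_ge {s : ℝ} (hs : |s| ≤ 1) {g : ℝ → ℝ≥0∞} (hg : Measurable g) :
    ENNReal.ofReal gaussianFloor * ∫⁻ x in Icc (-1) 1, g x
      ≤ ∫⁻ x, g (x + s) ∂(gaussianReal 0 1) := by
  have h1 := lintegral_map (μ := gaussianReal 0 1) hg (measurable_add_const s)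
  rw [← h1, gaussianReal_map_add_const, zero_add, gaussianReal_of_var_ne_zero _ one_ne_zero,
    lintegral_withDensity_eq_lintegral_mul _ (measurable_gaussianPDF s 1) hg,
    ← lintegral_const_mul _ hg]
  refine le_trans ?_ (setLIntegral_le_lintegral (Icc (-1) 1) _)
  refine setLIntegral_mono ((measurable_gaussianPDF s 1).mul hg) fun x hx => ?_
  simp only [Pi.mul_apply]
  refine mul_le_mul_left (ENNReal.ofReal_le_ofReal ?_) _
  rw [gaussianPDFReal, gaussianFloor]
  simp only [NNReal.coe_one, mul_one]
  refine mul_le_mul_of_nonneg_left (Real.exp_le_exp.2 ?_) (by positivity)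
  have := abs_le.1 hs
  have h2 : -2 ≤ x - s := by linarith [hx.1]
  have h3 : x - s ≤ 2 := by linarith [hx.2]
  nlinarith

theorem two_point_gaussianReal {s b : ℝ} (hs : |s| ≤ 1) {u : ℝ → ℝ} (hu : Measurable u) :
    ENNReal.ofReal (4 * gaussianFloor * b ^ 2)
      ≤ ∫⁻ x, (ENNReal.ofReal ((u (x + s) - b) ^ 2) + ENNReal.ofReal ((u (x - s) + b) ^ 2))
        ∂(gaussianReal 0 1) := by
  have hm1 : Measurable fun x => ENNReal.ofReal ((u x - b) ^ 2) := by fun_prop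
  have hm2 : Measurable fun x => ENNReal.ofReal ((u x + b) ^ 2) := by fun_prop
  have hc1 : Measurable fun x => ENNReal.ofReal ((u (x + s) - b) ^ 2) := by fun_prop
  rw [lintegral_add_left hc1]
  have h1 := lintegral_gaussianReal_add_ge hs hm1
  have h2 := lintegral_gaussianReal_add_ge (s := -s) (by rwa [abs_neg]) hm2
  simp_rw [← sub_eq_add_neg] at h2
  refine le_trans ?_ (add_le_add h1 h2)
  rw [← mul_add, ← lintegral_add_left hm1]
  -- Pointwise `(u - b)² + (u + b)² ≥ 2b²`, integrated over an interval of length `2`.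
  have h3 : ENNReal.ofReal (2 * b ^ 2) * 2 ≤ ∫⁻ x in Icc (-1 : ℝ) 1,
      (ENNReal.ofReal ((u x - b) ^ 2) + ENNReal.ofReal ((u x + b) ^ 2)) := by
    have hv : volume (Icc (-1 : ℝ) 1) = 2 := by
      rw [Real.volume_Icc]; norm_num
    rw [← hv, ← setLIntegral_const]
    refine setLIntegral_mono (hm1.add hm2) fun x _ => ?_
    rw [← ENNReal.ofReal_add (sq_nonneg _) (sq_nonneg _)]
    exact ENNReal.ofReal_le_ofReal (by nlinarith [sq_nonneg (u x)])
  refine le_trans ?_ (mul_le_mul_right h3 _)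
  rw [show (2 : ℝ≥0∞) = ENNReal.ofReal 2 by simp, ← ENNReal.ofReal_mul (by positivity),
    ← ENNReal.ofReal_mul gaussianFloor_pos.le]
  exact ENNReal.ofReal_le_ofReal (by linarith)

variable {Y Ω : Type*} [NormedAddCommGroup Y] [InnerProductSpace ℝ Y]
  [MeasurableSpace Ω] {P : Measure Ω} {ξ : Y → Ω → ℝ}

/-- The component of white noise orthogonal to the direction `h` is independent of the
noise in direction `h`. -/
theorem IsWhiteNoise.indepFun_orthogonal [IsProbabilityMeasure P] (hξ : IsWhiteNoise P ξ) {h : Y}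
    {l : ℝ} (hl : ⟪h, h⟫_ℝ = l) (hl0 : 0 < l) :
    IndepFun (fun ω y => ξ y ω - ⟪y, h⟫_ℝ / l * ξ h ω) (fun ω => (√l)⁻¹ * ξ h ω) P := by
  classical
  have hg : IsGaussianProcess (Sum.elim (fun (y : Y) ω => ξ y ω - ⟪y, h⟫_ℝ / l * ξ h ω)
      (fun (_ : Unit) ω => (√l)⁻¹ * ξ h ω)) P := by
    refine hξ.gaussian.of_isGaussianProcess fun s => ?_
    rcases s with y | _
    · refine ⟨{y, h}, ContinuousLinearMap.proj ⟨y, by simp⟩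
        - (⟪y, h⟫_ℝ / l) • ContinuousLinearMap.proj ⟨h, by simp⟩, fun ω => ?_⟩
      simp
    · refine ⟨{h}, (√l)⁻¹ • ContinuousLinearMap.proj ⟨h, by simp⟩, fun ω => ?_⟩
      simp
  have hi := hg.indepFun_of_covariance_eq_zero
    (fun y => ((hξ.measurable y).sub ((hξ.measurable h).const_mul _)).aemeasurable)
    (fun _ => ((hξ.measurable h).const_mul _).aemeasurable) fun y _ => by
      rw [covariance_fun_sub_left (hξ.memLp y) ((hξ.memLp h).const_mul _)
        ((hξ.memLp h).const_mul _), covariance_const_mul_right, covariance_const_mul_right,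
        covariance_const_mul_left, hξ.covariance_eq, hξ.covariance_eq, hl]
      field_simp
      ring
  exact hi.comp measurable_id (measurable_pi_apply ())

/-- Conditionally on `W`, which carries no information on the sign, the problem is one-dimensional;
Fubini integrates the bound over `W`. -/
theorem two_point_of_indepFun [IsProbabilityMeasure P] {B : Type*} [MeasurableSpace B] {s b : ℝ}
    (hs : |s| ≤ 1) {u : B × ℝ → ℝ} (hu : Measurable u) {W : Ω → B} {Z : Ω → ℝ}
    (hW : Measurable W) (hZ : Measurable Z) (hi : IndepFun W Z P)
    (hlaw : P.map Z = gaussianReal 0 1) :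
    ENNReal.ofReal (4 * gaussianFloor * b ^ 2)
      ≤ ∫⁻ ω, ENNReal.ofReal ((u (W ω, Z ω + s) - b) ^ 2) ∂P
        + ∫⁻ ω, ENNReal.ofReal ((u (W ω, Z ω - s) + b) ^ 2) ∂P := by
  have hprob : IsProbabilityMeasure (P.map W) := Measure.isProbabilityMeasure_map hW.aemeasurable
  have hc1 : Measurable fun p : B × ℝ => ENNReal.ofReal ((u (p.1, p.2 + s) - b) ^ 2) := by
    fun_prop
  have hc2 : Measurable fun p : B × ℝ => ENNReal.ofReal ((u (p.1, p.2 - s) + b) ^ 2) := by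
    fun_prop
  have hWZ : Measurable fun ω => (W ω, Z ω) := hW.prodMk hZ
  have hc3 : Measurable fun ω => ENNReal.ofReal ((u (W ω, Z ω + s) - b) ^ 2) := by fun_prop
  rw [← lintegral_add_left hc3]
  have h1 := lintegral_map (μ := P) (hc1.add hc2) hWZ
  refine le_trans ?_ h1.le
  rw [(indepFun_iff_map_prod_eq_prod_map_map hW.aemeasurable hZ.aemeasurable).1 hi,
    lintegral_prod _ (hc1.add hc2).aemeasurable, hlaw]
  calc ENNReal.ofReal (4 * gaussianFloor * b ^ 2)
      = ∫⁻ _, ENNReal.ofReal (4 * gaussianFloor * b ^ 2) ∂(P.map W) := by simp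
    _ ≤ _ := lintegral_mono fun w => two_point_gaussianReal (u := fun x => u (w, x)) hs
        (hu.comp measurable_prodMk_left)

/-- The amplitude `b` enters the data only as a shift of the normalized noise along `h`, by the
signal-to-noise ratio `b√l/σ`. -/
theorem obs_eq_decomposition {h : Y} {l σ : ℝ} (hl0 : 0 < l) (hσ : 0 < σ) (z : Y) (b w r : ℝ)
    (y : Y) : ⟪z + b • h, y⟫_ℝ + σ * w = ⟪z, y⟫_ℝ + σ * (w - ⟪y, h⟫_ℝ / l * r)
      + σ * ⟪y, h⟫_ℝ / √l * ((√l)⁻¹ * r + b * √l / σ) := by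
  have hsl : 0 < √l := Real.sqrt_pos.2 hl0
  rw [inner_add_left, real_inner_smul_left, real_inner_comm y h]
  have h1 : ⟪y, h⟫_ℝ / l = ⟪y, h⟫_ℝ / (√l * √l) := by rw [Real.mul_self_sqrt hl0.le]
  rw [h1]
  field_simp
  ring

theorem IsWhiteNoise.two_point [IsProbabilityMeasure P] (hξ : IsWhiteNoise P ξ) {h : Y}
    {l σ b : ℝ} (hl : ⟪h, h⟫_ℝ = l) (hl0 : 0 < l) (hσ : 0 < σ) (hb : b ^ 2 * l ≤ σ ^ 2) (z : Y)
    {u : (Y → ℝ) → ℝ} (hu : Measurable u) :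
    ENNReal.ofReal (4 * gaussianFloor * b ^ 2)
      ≤ ∫⁻ ω, ENNReal.ofReal ((u (fun y => ⟪z + b • h, y⟫_ℝ + σ * ξ y ω) - b) ^ 2) ∂P
        + ∫⁻ ω, ENNReal.ofReal ((u (fun y => ⟪z - b • h, y⟫_ℝ + σ * ξ y ω) + b) ^ 2) ∂P := by
  set W : Ω → Y → ℝ := fun ω y => ξ y ω - ⟪y, h⟫_ℝ / l * ξ h ω with hW
  set Z : Ω → ℝ := fun ω => (√l)⁻¹ * ξ h ω with hZ
  have hsl : 0 < √l := Real.sqrt_pos.2 hl0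
  have hll : √l * √l = l := Real.mul_self_sqrt hl0.le
  set s : ℝ := b * √l / σ with hs
  have hs1 : |s| ≤ 1 := by
    rw [← sq_le_one_iff_abs_le_one, hs, div_pow, mul_pow, Real.sq_sqrt hl0.le,
      div_le_one (by positivity)]
    exact hb
  set G : (Y → ℝ) × ℝ → Y → ℝ :=
    fun p y => ⟪z, y⟫_ℝ + σ * p.1 y + σ * ⟪y, h⟫_ℝ / √l * p.2 with hG
  have hGm : Measurable G := by
    refine measurable_pi_lambda _ fun y => ?_
    have : Measurable fun p : (Y → ℝ) × ℝ => p.1 y := (measurable_pi_apply y).comp measurable_fst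
    exact ((this.const_mul _).const_add _).add (measurable_snd.const_mul _)
  have hWm : Measurable W := measurable_pi_lambda _ fun y =>
    (hξ.measurable y).sub ((hξ.measurable h).const_mul _)
  have hZm : Measurable Z := (hξ.measurable h).const_mul _
  have hplus : ∀ ω, (fun y => ⟪z + b • h, y⟫_ℝ + σ * ξ y ω) = G (W ω, Z ω + s) := fun ω =>
    funext fun y => obs_eq_decomposition hl0 hσ z b _ _ y
  have hminus : ∀ ω, (fun y => ⟪z - b • h, y⟫_ℝ + σ * ξ y ω) = G (W ω, Z ω - s) := fun ω =>
    funext fun y => by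
      have := obs_eq_decomposition (h := h) hl0 hσ z (-b) (ξ y ω) (ξ h ω) y
      rw [neg_smul, ← sub_eq_add_neg, neg_mul, neg_div, ← sub_eq_add_neg] at this
      exact this
  have hZlaw : P.map Z = gaussianReal 0 1 := by
    have h1 : P.map Z = (P.map (ξ h)).map fun x => (√l)⁻¹ * x :=
      (Measure.map_map (measurable_const_mul _) (hξ.measurable h)).symm
    rw [h1, hξ.map_eq, gaussianReal_map_const_mul, mul_zero, hl]
    congr 1
    ext
    push_cast
    rw [Real.coe_toNNReal _ hl0.le, inv_pow, Real.sq_sqrt hl0.le]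
    field_simp
  have key := two_point_of_indepFun hs1 (hu.comp hGm) hWm hZm
    (hξ.indepFun_orthogonal hl hl0) hZlaw (b := b)
  simp only [hplus, hminus]
  exact key

end TwoPoint

/-! ### Assouad's lower bound over a cube of signals. -/

section Assouad

variable {X Y Ω : Type*}
  [NormedAddCommGroup X] [InnerProductSpace ℝ X] [CompleteSpace X]
  [NormedAddCommGroup Y] [InnerProductSpace ℝ Y] [CompleteSpace Y]
  [MeasurableSpace Ω] [MeasurableSpace X] [BorelSpace X] {P : Measure Ω} {ξ : Y → Ω → ℝ}
  {T : X →L[ℝ] Y} {e : HilbertBasis ℕ ℝ X} {lam : ℕ → ℝ}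

/-- The vertex of the cube `∑ ± b eₖ`, `k ∈ F`, with positive signs on `S`. -/
noncomputable def cubeVertex (e : HilbertBasis ℕ ℝ X) (b : ℝ) (F S : Finset ℕ) : X :=
  ∑ k ∈ F, (if k ∈ S then b else -b) • e k

/-- The worst vertex is at least as bad as the average one. By Bessel the risk dominates the sum of
coordinate risks `R k S`. For fixed `k`, pairing each `S` with `insert k S` leaves all other signs
unchanged, and the two-point bound applies to each pair. -/
theorem minimaxRisk_ge_of_cube [IsProbabilityMeasure P] (hξ : IsWhiteNoise P ξ)
    (he : IsEigensystem T e lam) {σ b : ℝ} (hσ : 0 < σ) (F : Finset ℕ)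
    (hb : ∀ k ∈ F, b ^ 2 * lam k ≤ σ ^ 2) {W : Set X}
    (hW : ∀ S ⊆ F, cubeVertex e b F S ∈ W) :
    ENNReal.ofReal (F.card * (2 * gaussianFloor * b ^ 2)) ≤ minimaxRisk P T ξ σ W := by
  classical
  refine le_iInf₂ fun est hest => ?_
  set R : ℕ → Finset ℕ → ℝ≥0∞ := fun k S => ∫⁻ ω, ENNReal.ofReal
    ((⟪e k, est (obs T ξ σ (cubeVertex e b F S) ω)⟫_ℝ - if k ∈ S then b else -b) ^ 2) ∂P with hR
  have hobs : ∀ f, Measurable (obs T ξ σ f) := fun f => measurable_pi_lambda _ fun y =>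
    ((hξ.measurable y).const_mul σ).const_add _
  have := secondCountableTopology_of_hilbertBasis e
  have hinner : ∀ k, Measurable fun D => ⟪e k, est D⟫_ℝ := fun k => hest.const_inner
  have hcoord : ∀ S, ∀ k ∈ F, ⟪e k, cubeVertex e b F S⟫_ℝ = if k ∈ S then b else -b := by
    intro S k hk
    rw [cubeVertex, inner_sum]
    simp_rw [inner_smul_right, orthonormal_iff_ite.1 e.orthonormal]
    simp [hk]
  have hmse : ∀ S ⊆ F, ∑ k ∈ F, R k S ≤ worstMse P T ξ σ est W := by
    intro S hS
    refine le_trans ?_ (le_iSup₂ (f := fun f (_ : f ∈ W) => mse P T ξ σ est f) _ (hW S hS))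
    rw [hR, ← lintegral_finsetSum _ fun k _ => by
      exact ((((hinner k).comp (hobs _)).sub_const _).pow_const 2).ennreal_ofReal, mse]
    refine lintegral_mono fun ω => ?_
    rw [← ENNReal.ofReal_sum_of_nonneg fun _ _ => sq_nonneg _, ← ofReal_norm,
      ← ENNReal.ofReal_pow (norm_nonneg _)]
    refine ENNReal.ofReal_le_ofReal ?_
    have h1 := e.orthonormal.sum_inner_products_le (s := F)
      (est (obs T ξ σ (cubeVertex e b F S) ω) - cubeVertex e b F S)
    refine le_trans (le_of_eq (Finset.sum_congr rfl fun k hk => ?_)) h1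
    rw [inner_sub_right, hcoord S k hk, Real.norm_eq_abs, sq_abs]
  have hpair : ∀ k ∈ F, ∀ S ⊆ F.erase k,
      ENNReal.ofReal (4 * gaussianFloor * b ^ 2) ≤ R k S + R k (insert k S) := by
    intro k hk S hS
    have hkS : k ∉ S := fun h => by simpa using hS h
    have hrest : ∀ S', cubeVertex e b F S' = (∑ j ∈ F.erase k, (if j ∈ S' then b else -b) • e j)
        + (if k ∈ S' then b else -b) • e k := fun S' => (Finset.sum_erase_add _ _ hk).symm
    have hrest2 : ∑ j ∈ F.erase k, (if j ∈ insert k S then b else -b) • e j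
        = ∑ j ∈ F.erase k, (if j ∈ S then b else -b) • e j := by
      refine Finset.sum_congr rfl fun j hj => ?_
      have : j ≠ k := Finset.ne_of_mem_erase hj
      simp [this]
    have h2 := hξ.two_point (h := T (e k)) (σ := σ) (b := b)
      (by rw [he.inner_map_map, if_pos rfl]) (he.pos k) hσ (hb k hk)
      (T (∑ j ∈ F.erase k, (if j ∈ S then b else -b) • e j)) (hinner k)
    refine h2.trans_eq ?_
    rw [add_comm]
    have hobs' : ∀ f ω, obs T ξ σ f ω = fun y => ⟪T f, y⟫_ℝ + σ * ξ y ω := fun _ _ => rfl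
    simp only [hR, hobs']
    rw [hrest, hrest, hrest2, if_neg hkS, if_pos (Finset.mem_insert_self k S), map_add, map_add,
      map_smul, map_smul, neg_smul, ← sub_eq_add_neg]
    simp only [sub_neg_eq_add]
  have hsum : ∑ S ∈ F.powerset, ∑ k ∈ F, R k S ≤ 2 ^ F.card * worstMse P T ξ σ est W := by
    refine (Finset.sum_le_sum fun S hS => hmse S (Finset.mem_powerset.1 hS)).trans_eq ?_
    rw [Finset.sum_const, Finset.card_powerset, nsmul_eq_mul]
    push_cast; rfl
  have hge : ∀ k ∈ F, 2 ^ F.card * ENNReal.ofReal (2 * gaussianFloor * b ^ 2)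
      ≤ ∑ S ∈ F.powerset, R k S := by
    intro k hk
    have hF : F.card = (F.erase k).card + 1 := (Finset.card_erase_add_one hk).symm
    have h3 : ∑ S ∈ F.powerset, R k S
        = ∑ S ∈ (F.erase k).powerset, (R k S + R k (insert k S)) := by
      conv_lhs => rw [← Finset.insert_erase hk]
      rw [Finset.sum_powerset_insert (Finset.notMem_erase k F), Finset.sum_add_distrib]
    rw [h3]
    calc 2 ^ F.card * ENNReal.ofReal (2 * gaussianFloor * b ^ 2)
        = ∑ S ∈ (F.erase k).powerset, ENNReal.ofReal (4 * gaussianFloor * b ^ 2) := by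
          rw [Finset.sum_const, Finset.card_powerset, nsmul_eq_mul, hF, pow_succ, mul_assoc,
            show (2 : ℝ≥0∞) * ENNReal.ofReal (2 * gaussianFloor * b ^ 2)
              = ENNReal.ofReal (4 * gaussianFloor * b ^ 2) by
                rw [show (2 : ℝ≥0∞) = ENNReal.ofReal 2 by simp,
                  ← ENNReal.ofReal_mul (by norm_num)]; ring_nf]
          push_cast; rfl
      _ ≤ _ := Finset.sum_le_sum fun S hS => hpair k hk S (Finset.mem_powerset.1 hS)
  have hfin : 2 ^ F.card * ENNReal.ofReal (F.card * (2 * gaussianFloor * b ^ 2))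
      ≤ 2 ^ F.card * worstMse P T ξ σ est W := by
    refine le_trans ?_ hsum
    rw [Finset.sum_comm]
    refine le_trans (le_of_eq ?_) (Finset.sum_le_sum hge)
    rw [Finset.sum_const, nsmul_eq_mul, ENNReal.ofReal_mul (Nat.cast_nonneg _),
      ENNReal.ofReal_natCast]
    ring
  exact (ENNReal.mul_le_mul_iff_right (by positivity) (by simp)).1 hfin

end Assouad

/-! ### Asymptotics of the balancing parameter and of the rate. -/

section Rate

/-- The balancing regularization parameter
`(σ²)^{1/(2ν+1+1/a)} (-log σ²)^{2τ/(2ν+1+1/a)}`. -/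
noncomputable def idealPar (a ν τ σ : ℝ) : ℝ :=
  (σ ^ 2) ^ (1 / (2 * ν + 1 + 1 / a)) * (-Real.log (σ ^ 2)) ^ (2 * τ / (2 * ν + 1 + 1 / a))

theorem tendsto_neg_log_sq : Tendsto (fun σ : ℝ => -Real.log (σ ^ 2)) (𝓝[>] 0) atTop := by
  simp_rw [Real.log_pow]
  have h := Real.tendsto_log_nhdsGT_zero
  have h2 : Tendsto (fun σ : ℝ => 2 * -Real.log σ) (𝓝[>] 0) atTop :=
    (tendsto_neg_atBot_atTop.comp h).const_mul_atTop (by norm_num)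
  refine h2.congr fun σ => ?_
  push_cast; ring

theorem eventually_log_log_le (d M : ℝ) {c : ℝ} (hc : 0 < c) :
    ∀ᶠ σ : ℝ in 𝓝[>] 0, d * Real.log (-Real.log (σ ^ 2)) + M ≤ c * -Real.log (σ ^ 2) := by
  refine tendsto_neg_log_sq.eventually (p := fun L => d * Real.log L + M ≤ c * L) ?_
  have h1 := (Real.isLittleO_log_id_atTop.const_mul_left d).def (c := c / 2) (by positivity)
  filter_upwards [h1, eventually_ge_atTop 0, eventually_ge_atTop (2 * M / c)] with L hL h0 hM
  rw [div_le_iff₀ hc] at hM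
  simp only [id, Real.norm_eq_abs, abs_of_nonneg h0] at hL
  have := (le_abs_self _).trans hL
  linarith

theorem eventually_le_neg_log_sq (M : ℝ) : ∀ᶠ σ : ℝ in 𝓝[>] 0, M ≤ -Real.log (σ ^ 2) :=
  tendsto_neg_log_sq.eventually_ge_atTop M

variable {a ν τ : ℝ}

theorem rateExponent_pos (ha : 1 < a) (hν : 0 ≤ ν) : 0 < 2 * ν + 1 + 1 / a := by positivity

theorem idealPar_pos {σ : ℝ} (hσ : 0 < σ) (hL : 0 < -Real.log (σ ^ 2)) :
    0 < idealPar a ν τ σ := by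
  unfold idealPar; positivity

theorem mildRate_pos {σ : ℝ} (hσ : 0 < σ) (hL : 0 < -Real.log (σ ^ 2)) :
    0 < mildRate a ν τ σ := by
  unfold mildRate; positivity

theorem log_idealPar {σ : ℝ} (hσ : 0 < σ) (hL : 0 < -Real.log (σ ^ 2)) :
    Real.log (idealPar a ν τ σ) = 1 / (2 * ν + 1 + 1 / a) * Real.log (σ ^ 2)
      + 2 * τ / (2 * ν + 1 + 1 / a) * Real.log (-Real.log (σ ^ 2)) := by
  unfold idealPar
  rw [Real.log_mul (by positivity) (by positivity), Real.log_rpow (by positivity),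
    Real.log_rpow hL]

theorem log_mildRate {σ : ℝ} (hσ : 0 < σ) (hL : 0 < -Real.log (σ ^ 2)) :
    Real.log (mildRate a ν τ σ) = 2 * ν / (2 * ν + 1 + 1 / a) * Real.log (σ ^ 2)
      + -(2 * τ * (1 + 1 / a) / (2 * ν + 1 + 1 / a)) * Real.log (-Real.log (σ ^ 2)) := by
  unfold mildRate
  rw [Real.log_mul (by positivity) (by positivity), Real.log_rpow (by positivity),
    Real.log_rpow hL]

/-- The variance side of the balance. After taking logarithms it reads `1 - (1 + 1/a)/s = 2ν/s`;
`idealPar_rpow_mul` is the bias side. -/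
theorem sq_mul_idealPar_rpow (ha : 1 < a) (hν : 0 ≤ ν) {σ : ℝ} (hσ : 0 < σ)
    (hL : 0 < -Real.log (σ ^ 2)) :
    σ ^ 2 * idealPar a ν τ σ ^ (-(1 + 1 / a)) = mildRate a ν τ σ := by
  have hs := rateExponent_pos ha hν
  have hI := idealPar_pos (a := a) (ν := ν) (τ := τ) hσ hL
  refine Real.log_injOn_pos (mem_Ioi.2 (by positivity)) (mem_Ioi.2 (mildRate_pos hσ hL)) ?_
  rw [Real.log_mul (by positivity) (by positivity), Real.log_rpow hI, log_idealPar hσ hL,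
    log_mildRate hσ hL]
  set s := 2 * ν + 1 + 1 / a with hsdef
  have h1 : 1 + 1 / a = s - 2 * ν := by rw [hsdef]; ring
  rw [h1]
  field_simp
  ring

theorem idealPar_rpow_mul (ha : 1 < a) (hν : 0 ≤ ν) {σ : ℝ} (hσ : 0 < σ)
    (hL : 0 < -Real.log (σ ^ 2)) :
    idealPar a ν τ σ ^ (2 * ν) * (-Real.log (σ ^ 2)) ^ (-(2 * τ)) = mildRate a ν τ σ := by
  have hs := rateExponent_pos ha hν
  have hI := idealPar_pos (a := a) (ν := ν) (τ := τ) hσ hL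
  refine Real.log_injOn_pos (mem_Ioi.2 (by positivity)) (mem_Ioi.2 (mildRate_pos hσ hL)) ?_
  rw [Real.log_mul (by positivity) (by positivity), Real.log_rpow hI, Real.log_rpow hL,
    log_idealPar hσ hL, log_mildRate hσ hL]
  set s := 2 * ν + 1 + 1 / a with hsdef
  have h1 : 1 + 1 / a = s - 2 * ν := by rw [hsdef]; ring
  rw [h1]
  field_simp
  ring

/-- The logarithm is `L/s` with `L = -log σ²`, up to a constant and a multiple of `log L`. Both are
eventually below `L/(2s)`, whatever `c` is. -/
theorem eventually_neg_log_idealPar (ha : 1 < a) (hν : 0 ≤ ν) (τ : ℝ) {c : ℝ} (hc : 0 < c) :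
    ∀ᶠ σ : ℝ in 𝓝[>] 0,
      1 / (2 * (2 * ν + 1 + 1 / a)) * -Real.log (σ ^ 2) ≤ -Real.log (c * idealPar a ν τ σ) ∧
      -Real.log (c * idealPar a ν τ σ) ≤ 2 / (2 * ν + 1 + 1 / a) * -Real.log (σ ^ 2) := by
  have hs := rateExponent_pos ha hν
  filter_upwards [eventually_log_log_le (2 * τ / (2 * ν + 1 + 1 / a)) (Real.log c)
      (c := 1 / (2 * (2 * ν + 1 + 1 / a))) (by positivity),
    eventually_log_log_le (-(2 * τ / (2 * ν + 1 + 1 / a))) (-Real.log c)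
      (c := 1 / (2 * ν + 1 + 1 / a)) (by positivity),
    eventually_le_neg_log_sq 1, self_mem_nhdsWithin] with σ h1 h2 hL hσ
  have hσ : 0 < σ := hσ
  have hL : 0 < -Real.log (σ ^ 2) := by linarith
  have hI := idealPar_pos (a := a) (ν := ν) (τ := τ) hσ hL
  rw [Real.log_mul hc.ne' hI.ne', log_idealPar hσ hL]
  set s := 2 * ν + 1 + 1 / a
  set L := Real.log (σ ^ 2)
  have e1 : 1 / (2 * s) = 1 / s / 2 := by field_simp
  have e2 : 2 / s = 2 * (1 / s) := by field_simp
  rw [e1] at h1 ⊢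
  rw [e2]
  constructor <;> nlinarith

theorem eventually_idealPar_le (ha : 1 < a) (hν : 0 ≤ ν) (τ : ℝ) {c : ℝ} (hc : 0 < c) :
    ∀ᶠ σ : ℝ in 𝓝[>] 0, idealPar a ν τ σ ≤ c := by
  have hs := rateExponent_pos ha hν
  filter_upwards [eventually_neg_log_idealPar ha hν τ (inv_pos.2 hc),
    eventually_le_neg_log_sq 1, self_mem_nhdsWithin] with σ h1 hL hσ
  have hσ : 0 < σ := hσ
  have hL : 0 < -Real.log (σ ^ 2) := by linarith
  have hI := idealPar_pos (a := a) (ν := ν) (τ := τ) hσ hL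
  have h2 : Real.log (c⁻¹ * idealPar a ν τ σ) ≤ 0 := by
    have : 0 ≤ 1 / (2 * (2 * ν + 1 + 1 / a)) * -Real.log (σ ^ 2) := by positivity
    linarith [h1.1]
  rw [Real.log_nonpos_iff (by positivity), inv_mul_le_iff₀ hc, mul_one] at h2
  exact h2

theorem eventually_mildRate_le (ha : 1 < a) (h : 0 < ν ∨ (ν = 0 ∧ 0 < τ)) {c : ℝ}
    (hc : 0 < c) : ∀ᶠ σ : ℝ in 𝓝[>] 0, mildRate a ν τ σ ≤ c := by
  have hν : 0 ≤ ν := by rcases h with h | h <;> linarith [h]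
  have hs := rateExponent_pos ha hν
  suffices hlog : ∀ᶠ σ : ℝ in 𝓝[>] 0, 2 * ν / (2 * ν + 1 + 1 / a) * Real.log (σ ^ 2)
      + -(2 * τ * (1 + 1 / a) / (2 * ν + 1 + 1 / a)) * Real.log (-Real.log (σ ^ 2))
      ≤ Real.log c by
    filter_upwards [hlog, eventually_le_neg_log_sq 1, self_mem_nhdsWithin] with σ h1 hL hσ
    have hσ : 0 < σ := hσ
    have hL : 0 < -Real.log (σ ^ 2) := by linarith
    rw [← log_mildRate hσ hL] at h1
    exact (Real.log_le_log_iff (mildRate_pos hσ hL) hc).1 h1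
  rcases h with h | ⟨rfl, h⟩
  · filter_upwards [eventually_log_log_le (-(2 * τ * (1 + 1 / a) / (2 * ν + 1 + 1 / a)))
      (-Real.log c) (c := 2 * ν / (2 * ν + 1 + 1 / a)) (by positivity)] with σ h1
    linarith
  -- For `ν = 0` the power of `σ²` is trivial and the decay comes from the logarithm alone.
  · have hd : 0 < 2 * τ * (1 + 1 / a) / (2 * 0 + 1 + 1 / a) := by positivity
    filter_upwards [(Real.tendsto_log_atTop.comp tendsto_neg_log_sq).eventually_ge_atTop
      (-Real.log c / (2 * τ * (1 + 1 / a) / (2 * 0 + 1 + 1 / a)))] with σ h1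
    rw [div_le_iff₀ hd] at h1
    simp only [Function.comp_apply] at h1
    have e : (2 * 0 / (2 * 0 + 1 + 1 / a) : ℝ) = 0 := by simp
    rw [e]
    linarith

theorem eventually_sq_mul_log_sq_le (ha : 1 < a) (hν : 0 ≤ ν) (τ : ℝ) :
    ∀ᶠ σ : ℝ in 𝓝[>] 0, σ ^ 2 * (-Real.log (σ ^ 2)) ^ 2 ≤ mildRate a ν τ σ := by
  have hs := rateExponent_pos ha hν
  have hc : 0 < 1 - 2 * ν / (2 * ν + 1 + 1 / a) := by
    rw [sub_pos, div_lt_one hs]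
    have : 0 < 1 / a := by positivity
    linarith
  filter_upwards [eventually_log_log_le (2 + 2 * τ * (1 + 1 / a) / (2 * ν + 1 + 1 / a)) 0 hc,
    eventually_le_neg_log_sq 1, self_mem_nhdsWithin] with σ h1 hL hσ
  have hσ : 0 < σ := hσ
  have hL : 0 < -Real.log (σ ^ 2) := by linarith
  rw [← Real.log_le_log_iff (by positivity) (mildRate_pos hσ hL), log_mildRate hσ hL,
    Real.log_mul (by positivity) (by positivity), Real.log_pow (n := 2) (-Real.log (σ ^ 2))]
  push_cast
  linarith

/-- The sum of the endpoint values covers both signs of the exponent at once. -/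
theorem rpow_le_add_of_mem_Icc {A B y : ℝ} (hA : 0 < A) (h1 : A ≤ y) (h2 : y ≤ B) (r : ℝ) :
    y ^ r ≤ A ^ r + B ^ r := by
  have hy : 0 < y := hA.trans_le h1
  have hB : 0 < B := hy.trans_le h2
  rcases le_total 0 r with hr | hr
  · have := Real.rpow_le_rpow hy.le h2 hr
    have : 0 < A ^ r := by positivity
    linarith
  · have := Real.rpow_le_rpow_of_nonpos hA h1 hr
    have : 0 < B ^ r := by positivity
    linarith

theorem indexFn_sq {x : ℝ} (hx : 0 < x) (hl : 0 < -Real.log x) :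
    indexFn ν τ x ^ 2 = x ^ (2 * ν) * (-Real.log x) ^ (-(2 * τ)) := by
  rw [indexFn, mul_pow, ← Real.rpow_natCast, ← Real.rpow_natCast, ← Real.rpow_mul hx.le,
    ← Real.rpow_mul hl.le]
  push_cast
  ring_nf

/-- On the scale of `idealPar`, `-log x` is comparable to `-log σ²` with ratio in `[1/(2s), 2/s]`,
so the logarithmic factor of `φ²` is the one in the rate up to `M`. That `M` precedes `c₁` and `c₂`
is essential: these are later chosen in terms of `M`. -/
theorem exists_indexFn_sq_bounds (ha : 1 < a) (hν : 0 ≤ ν) (τ : ℝ) :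
    ∃ M > 0, ∀ c₁ > 0, ∀ c₂ > 0, ∀ᶠ σ : ℝ in 𝓝[>] 0, ∀ x : ℝ, c₁ * idealPar a ν τ σ ≤ x →
      x ≤ c₂ * idealPar a ν τ σ →
      indexFn ν τ x ^ 2 ≤ M * c₂ ^ (2 * ν) * mildRate a ν τ σ ∧
      c₁ ^ (2 * ν) * mildRate a ν τ σ ≤ M * indexFn ν τ x ^ 2 := by
  have hs := rateExponent_pos ha hν
  set s := 2 * ν + 1 + 1 / a with hsdef
  set A := 1 / (2 * s) with hA
  set B := 2 / s with hB
  have hA0 : 0 < A := by positivity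
  have hB0 : 0 < B := by positivity
  refine ⟨(A ^ (-(2 * τ)) + B ^ (-(2 * τ))) + (A ^ (2 * τ) + B ^ (2 * τ)), by positivity,
    fun c₁ hc₁ c₂ hc₂ => ?_⟩
  filter_upwards [eventually_neg_log_idealPar ha hν τ hc₁, eventually_neg_log_idealPar ha hν τ hc₂,
    eventually_le_neg_log_sq 1, self_mem_nhdsWithin] with σ h1 h2 hL hσ x hx1 hx2
  have hσ : 0 < σ := hσ
  have hL : 0 < -Real.log (σ ^ 2) := by linarith
  have hI := idealPar_pos (a := a) (ν := ν) (τ := τ) hσ hL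
  have hx : 0 < x := lt_of_lt_of_le (by positivity) hx1
  have hl1 : A * -Real.log (σ ^ 2) ≤ -Real.log x :=
    h2.1.trans (neg_le_neg (Real.log_le_log hx hx2))
  have hl2 : -Real.log x ≤ B * -Real.log (σ ^ 2) :=
    (neg_le_neg (Real.log_le_log (by positivity) hx1)).trans h1.2
  have hl : 0 < -Real.log x := lt_of_lt_of_le (by positivity) hl1
  set L := -Real.log (σ ^ 2) with hLdef
  set y := -Real.log x / L with hy
  have hy1 : A ≤ y := by rw [hy, le_div_iff₀ hL]; exact hl1
  have hy2 : y ≤ B := by rw [hy, div_le_iff₀ hL]; exact hl2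
  have hy0 : 0 < y := hA0.trans_le hy1
  have hyL : -Real.log x = y * L := by rw [hy]; field_simp
  have u1 := rpow_le_add_of_mem_Icc hA0 hy1 hy2 (-(2 * τ))
  have u2 := rpow_le_add_of_mem_Icc hA0 hy1 hy2 (2 * τ)
  have hp1 : 0 < A ^ (-(2 * τ)) + B ^ (-(2 * τ)) := by positivity
  have hp2 : 0 < A ^ (2 * τ) + B ^ (2 * τ) := by positivity
  have hrate := idealPar_rpow_mul (τ := τ) ha hν hσ hL
  rw [indexFn_sq hx hl, hyL, Real.mul_rpow hy0.le hL.le]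
  have hx1' : c₁ ^ (2 * ν) * idealPar a ν τ σ ^ (2 * ν) ≤ x ^ (2 * ν) := by
    rw [← Real.mul_rpow hc₁.le hI.le]
    exact Real.rpow_le_rpow (by positivity) hx1 (by positivity)
  have hx2' : x ^ (2 * ν) ≤ c₂ ^ (2 * ν) * idealPar a ν τ σ ^ (2 * ν) := by
    rw [← Real.mul_rpow hc₂.le hI.le]
    exact Real.rpow_le_rpow hx.le hx2 (by positivity)
  rw [← hrate]
  set MM := (A ^ (-(2 * τ)) + B ^ (-(2 * τ))) + (A ^ (2 * τ) + B ^ (2 * τ)) with hMM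
  constructor
  · calc x ^ (2 * ν) * (y ^ (-(2 * τ)) * L ^ (-(2 * τ)))
        ≤ (c₂ ^ (2 * ν) * idealPar a ν τ σ ^ (2 * ν)) * (MM * L ^ (-(2 * τ))) := by
          gcongr
          linarith
      _ = _ := by ring
  · have h3 : 1 ≤ MM * y ^ (-(2 * τ)) := by
      have : y ^ (2 * τ) * y ^ (-(2 * τ)) = 1 := by
        rw [← Real.rpow_add hy0]; simp
      rw [← this]
      gcongr
      linarith
    calc c₁ ^ (2 * ν) * (idealPar a ν τ σ ^ (2 * ν) * L ^ (-(2 * τ)))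
        = (c₁ ^ (2 * ν) * idealPar a ν τ σ ^ (2 * ν)) * (1 * L ^ (-(2 * τ))) := by ring
      _ ≤ x ^ (2 * ν) * ((MM * y ^ (-(2 * τ))) * L ^ (-(2 * τ))) := by gcongr
      _ = _ := by ring

end Rate

/-! ### Variances of ordered filter weights. -/

/-- Weights `w m k = q_{α m}(λ k)` of an ordered filter along a sequence of parameters, over a
summable sequence of eigenvalues. -/
structure IsWeightSystem (lam α : ℕ → ℝ) (w : ℕ → ℕ → ℝ) (C : ℝ) : Prop where
  lam_pos : ∀ k, 0 < lam k
  lam_summable : Summable lam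
  par_pos : ∀ m, 0 < α m
  nonneg : ∀ m k, 0 ≤ w m k
  nonexp : ∀ m k, lam k * w m k ≤ 1
  mono : ∀ k, Monotone fun m => w m k
  bound : ∀ m k, α m * w m k ≤ C

/-- The variance `∑ₖ λₖ w_{m,k}²` of the weights with index `m`. -/
noncomputable def weightVar (lam : ℕ → ℝ) (w : ℕ → ℕ → ℝ) (m : ℕ) : ℝ :=
  ∑' k, lam k * w m k ^ 2

/-- The variance `∑ₖ λₖ (w_{n,k} - w_{m,k})²` of a difference of weights. -/
noncomputable def weightPairVar (lam : ℕ → ℝ) (w : ℕ → ℕ → ℝ) (m n : ℕ) : ℝ :=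
  ∑' k, lam k * (w m k - w n k) ^ 2

namespace IsWeightSystem

variable {lam α : ℕ → ℝ} {w : ℕ → ℕ → ℝ} {C : ℝ}

theorem le_div (h : IsWeightSystem lam α w C) (m k : ℕ) : w m k ≤ C / α m := by
  rw [le_div_iff₀ (h.par_pos m), mul_comm]
  exact h.bound m k

theorem const_nonneg (h : IsWeightSystem lam α w C) : 0 ≤ C :=
  (mul_nonneg (h.par_pos 0).le (h.nonneg 0 0)).trans (h.bound 0 0)

theorem mul_sq_le (h : IsWeightSystem lam α w C) (m k : ℕ) : lam k * w m k ^ 2 ≤ C / α m := by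
  refine le_trans ?_ (h.le_div m k)
  rw [sq, ← mul_assoc]
  exact mul_le_of_le_one_left (h.nonneg m k) (h.nonexp m k)

theorem mul_sq_le' (h : IsWeightSystem lam α w C) (m k : ℕ) :
    lam k * w m k ^ 2 ≤ (C / α m) ^ 2 * lam k := by
  rw [mul_comm]
  exact mul_le_mul_of_nonneg_right (pow_le_pow_left₀ (h.nonneg m k) (h.le_div m k) 2)
    (h.lam_pos k).le

theorem term_nonneg (h : IsWeightSystem lam α w C) (x : ℝ) (k : ℕ) : 0 ≤ lam k * x ^ 2 :=
  mul_nonneg (h.lam_pos k).le (sq_nonneg x)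

theorem summable_var (h : IsWeightSystem lam α w C) (m : ℕ) :
    Summable fun k => lam k * w m k ^ 2 :=
  Summable.of_nonneg_of_le (fun k => h.term_nonneg _ k) (h.mul_sq_le' m)
    (h.lam_summable.mul_left _)

theorem var_nonneg (h : IsWeightSystem lam α w C) (m : ℕ) : 0 ≤ weightVar lam w m :=
  tsum_nonneg fun k => h.term_nonneg _ k

theorem var_mono (h : IsWeightSystem lam α w C) : Monotone (weightVar lam w) := fun m n hmn =>
  (h.summable_var m).tsum_le_tsum (fun k => mul_le_mul_of_nonneg_left
    (pow_le_pow_left₀ (h.nonneg m k) (h.mono k hmn) 2) (h.lam_pos k).le) (h.summable_var n)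

theorem sub_sq_le (h : IsWeightSystem lam α w C) {m n : ℕ} (hmn : m ≤ n) (k : ℕ) :
    lam k * (w m k - w n k) ^ 2 ≤ lam k * w n k ^ 2 := by
  refine mul_le_mul_of_nonneg_left ?_ (h.lam_pos k).le
  nlinarith [h.nonneg m k, h.nonneg n k, h.mono k hmn]

theorem summable_pairVar (h : IsWeightSystem lam α w C) {m n : ℕ} (hmn : m ≤ n) :
    Summable fun k => lam k * (w m k - w n k) ^ 2 :=
  Summable.of_nonneg_of_le (fun k => h.term_nonneg _ k) (h.sub_sq_le hmn) (h.summable_var n)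

theorem pairVar_le (h : IsWeightSystem lam α w C) {m n : ℕ} (hmn : m ≤ n) :
    weightPairVar lam w m n ≤ weightVar lam w n :=
  (h.summable_pairVar hmn).tsum_le_tsum (h.sub_sq_le hmn) (h.summable_var n)

/-- Young's inequality `w_n² ≤ (1 + ε) w_m² + (1 + 1/ε)(w_m - w_n)²` with `ε = (θ - 1)/2`. Since
`V_m ≤ V_n/θ`, the first term cannot absorb all of `V_n`. Hence thresholds for a pair see the full
variance of the later index. -/
theorem le_pairVar (h : IsWeightSystem lam α w C) {m n : ℕ} (hmn : m ≤ n) {θ : ℝ} (hθ : 1 < θ)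
    (hV : θ * weightVar lam w m ≤ weightVar lam w n) :
    (θ - 1) ^ 2 / (2 * θ * (θ + 1)) * weightVar lam w n ≤ weightPairVar lam w m n := by
  have h1 : weightVar lam w n ≤ (1 + θ) / 2 * weightVar lam w m
      + (θ + 1) / (θ - 1) * weightPairVar lam w m n := by
    rw [weightVar, weightVar, weightPairVar, ← tsum_mul_left, ← tsum_mul_left,
      ← ((h.summable_var m).mul_left _).tsum_add ((h.summable_pairVar hmn).mul_left _)]
    refine (h.summable_var n).tsum_le_tsum (fun k => ?_)
      (((h.summable_var m).mul_left _).add ((h.summable_pairVar hmn).mul_left _))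
    have hk := (h.lam_pos k).le
    have hθ' : 0 < θ - 1 := by linarith
    have key : w n k ^ 2 ≤ (1 + θ) / 2 * w m k ^ 2 + (θ + 1) / (θ - 1) * (w m k - w n k) ^ 2 := by
      have : (1 + θ) / 2 * w m k ^ 2 + (θ + 1) / (θ - 1) * (w m k - w n k) ^ 2 - w n k ^ 2
          = ((θ - 1) * w m k - 2 * (w n k - w m k)) ^ 2 / (2 * (θ - 1)) := by
        field_simp
        ring
      have h2 : 0 ≤ ((θ - 1) * w m k - 2 * (w n k - w m k)) ^ 2 / (2 * (θ - 1)) := by positivity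
      linarith
    have := mul_le_mul_of_nonneg_left key hk
    linarith
  have hθ' : 0 < θ - 1 := by linarith
  have hθ0 : 0 < θ := by linarith
  have h2 : (1 + θ) / 2 * weightVar lam w m ≤ (1 + θ) / (2 * θ) * weightVar lam w n := by
    calc (1 + θ) / 2 * weightVar lam w m = (1 + θ) / (2 * θ) * (θ * weightVar lam w m) := by
          field_simp
      _ ≤ _ := by gcongr
  have h3 : (θ - 1) / (2 * θ) * weightVar lam w n
      ≤ (θ + 1) / (θ - 1) * weightPairVar lam w m n := by
    have : (θ - 1) / (2 * θ) = 1 - (1 + θ) / (2 * θ) := by field_simp; ring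
    rw [this]; linarith
  calc (θ - 1) ^ 2 / (2 * θ * (θ + 1)) * weightVar lam w n
      = (θ - 1) / (θ + 1) * ((θ - 1) / (2 * θ) * weightVar lam w n) := by field_simp
    _ ≤ (θ - 1) / (θ + 1) * ((θ + 1) / (θ - 1) * weightPairVar lam w m n) := by gcongr
    _ = _ := by field_simp

theorem pairVar_term_le (h : IsWeightSystem lam α w C) {m n : ℕ} (hmn : m ≤ n) (k : ℕ) :
    lam k * (w m k - w n k) ^ 2 ≤ C / α n :=
  (h.sub_sq_le hmn k).trans (h.mul_sq_le n k)

theorem pow_mul_var_le {θ : ℝ} (hθ : 0 ≤ θ)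
    (hV : ∀ m, θ * weightVar lam w m ≤ weightVar lam w (m + 1)) (m : ℕ) :
    θ ^ m * weightVar lam w 0 ≤ weightVar lam w m := by
  induction m with
  | zero => simp
  | succ m ih =>
    refine le_trans ?_ (hV m)
    rw [pow_succ', mul_assoc]
    exact mul_le_mul_of_nonneg_left ih hθ

theorem tendsto_var {θ : ℝ} (hθ : 1 < θ)
    (hV : ∀ m, θ * weightVar lam w m ≤ weightVar lam w (m + 1)) (h0 : 0 < weightVar lam w 0) :
    Tendsto (weightVar lam w) atTop atTop :=
  tendsto_atTop_mono (pow_mul_var_le (by linarith) hV)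
    ((tendsto_pow_atTop_atTop_of_one_lt hθ).atTop_mul_const h0)

/-- The filter bound gives `V_m α_m² ≤ C² ∑ λ_k`, so diverging variances force the parameters to
`0`. -/
theorem tendsto_par (h : IsWeightSystem lam α w C)
    (hV : Tendsto (weightVar lam w) atTop atTop) : Tendsto α atTop (𝓝 0) := by
  have h1 : ∀ m, weightVar lam w m * α m ^ 2 ≤ C ^ 2 * ∑' k, lam k := by
    intro m
    have hp := h.par_pos m
    have : weightVar lam w m ≤ (C / α m) ^ 2 * ∑' k, lam k := by
      rw [← tsum_mul_left]
      exact (h.summable_var m).tsum_le_tsum (h.mul_sq_le' m) (h.lam_summable.mul_left _)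
    calc weightVar lam w m * α m ^ 2 ≤ ((C / α m) ^ 2 * ∑' k, lam k) * α m ^ 2 := by gcongr
      _ = _ := by field_simp
  have h2 : Tendsto (fun m => α m ^ 2) atTop (𝓝 0) := by
    refine squeeze_zero' (Eventually.of_forall fun m => sq_nonneg _)
      ?_ (hV.const_div_atTop (C ^ 2 * ∑' k, lam k))
    filter_upwards [hV.eventually_gt_atTop 0] with m hm
    rw [le_div_iff₀ hm, mul_comm]
    exact h1 m
  have h3 := h2.sqrt
  simp only [Real.sqrt_zero] at h3
  exact h3.congr fun m => Real.sqrt_sq (h.par_pos m).le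

/-- The logarithmic factor of the critical values is absorbed by the effective dimension. -/
theorem exists_log_mul_le (h : IsWeightSystem lam α w C) {p c : ℝ} (hp : 1 < p) (hc : 0 < c)
    (h0 : 0 < weightVar lam w 0)
    (hV : ∀ᶠ m in atTop, c * α m ^ (-p) ≤ weightVar lam w m) :
    ∃ K > 0, ∀ m, Real.log (weightVar lam w m / weightVar lam w 0) * (C / α m)
      ≤ K * weightVar lam w m := by
  have hV0 : ∀ m, 0 < weightVar lam w m := fun m => h0.trans_le (h.var_mono (Nat.zero_le m))
  set r : ℕ → ℝ := fun m => Real.log (weightVar lam w m / weightVar lam w 0) * (C / α m)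
    / weightVar lam w m with hr
  have hC := h.const_nonneg
  obtain ⟨B, hB⟩ : ∃ B, ∀ᶠ m in atTop, r m ≤ B := by
    -- The lower bound on `V` gives `1/α ≲ V^{1/p}`, and `log V ≲ V^ε`; this `ε`, positive since `p
    -- > 1`, makes the product exactly of order `V`.
    set ε := 1 - 1 / p with hε
    have hp0 : 0 < p := by linarith
    have hε0 : 0 < ε := by rw [hε, sub_pos, div_lt_one hp0]; exact hp
    refine ⟨(1 / weightVar lam w 0) ^ ε / ε * (C * (1 / c) ^ (1 / p)), ?_⟩
    filter_upwards [hV] with m hm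
    have ha := h.par_pos m
    rw [hr, div_le_iff₀ (hV0 m)]
    have h1 : 1 / α m ≤ (1 / c) ^ (1 / p) * weightVar lam w m ^ (1 / p) := by
      rw [← Real.mul_rpow (by positivity) (hV0 m).le]
      have h2 : α m ^ (-p) ≤ 1 / c * weightVar lam w m := by
        rw [one_div, ← div_eq_inv_mul, le_div_iff₀ hc, mul_comm]; exact hm
      calc 1 / α m = (α m ^ (-p)) ^ (1 / p) := by
            rw [← Real.rpow_mul ha.le, neg_mul, mul_one_div_cancel hp0.ne', Real.rpow_neg_one,
              one_div]
        _ ≤ _ := Real.rpow_le_rpow (by positivity) h2 (by positivity)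
    have h3 := Real.log_le_rpow_div (x := weightVar lam w m / weightVar lam w 0)
      (div_nonneg (hV0 m).le h0.le) hε0
    have h4 : (weightVar lam w m / weightVar lam w 0) ^ ε
        = (1 / weightVar lam w 0) ^ ε * weightVar lam w m ^ ε := by
      rw [← Real.mul_rpow (by positivity) (hV0 m).le]; congr 1; ring
    have h5 : weightVar lam w m ^ ε * weightVar lam w m ^ (1 / p) = weightVar lam w m := by
      rw [← Real.rpow_add (hV0 m), hε]; simp
    have hpos := hV0 m
    have hb : C / α m ≤ C * ((1 / c) ^ (1 / p) * weightVar lam w m ^ (1 / p)) := by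
      rw [div_eq_mul_one_div]; gcongr
    calc Real.log (weightVar lam w m / weightVar lam w 0) * (C / α m)
        ≤ ((weightVar lam w m / weightVar lam w 0) ^ ε / ε)
          * (C * ((1 / c) ^ (1 / p) * weightVar lam w m ^ (1 / p))) := by
          gcongr
      _ = (1 / weightVar lam w 0) ^ ε / ε * (C * (1 / c) ^ (1 / p))
          * (weightVar lam w m ^ ε * weightVar lam w m ^ (1 / p)) := by rw [h4]; ring
      _ = _ := by rw [h5]
  -- A sequence that is eventually bounded is bounded, which extends the estimate to all indices.
  have hbdd : BddAbove (Set.range r) := by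
    refine Filter.IsBoundedUnder.bddAbove_range ⟨B, ?_⟩
    simpa using hB
  obtain ⟨K, hK⟩ := hbdd
  refine ⟨max K 1, by positivity, fun m => ?_⟩
  have := (hK (mem_range_self m)).trans (le_max_left K 1)
  rwa [hr, div_le_iff₀ (hV0 m)] at this

end IsWeightSystem

/-! ### Consequences of polynomial decay of the eigenvalues. -/

section PolynomialDecay

theorem tsum_shift_rpow_le {a : ℝ} (ha : 1 < a) {K : ℕ} (hK : 0 < K) (n : ℕ) :
    ∑ i ∈ Finset.range n, ((K : ℝ) + (i + 1 : ℕ)) ^ (-a) ≤ (K : ℝ) ^ (1 - a) / (a - 1) := by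
  have hK' : (0 : ℝ) < K := Nat.cast_pos.2 hK
  have hanti : AntitoneOn (fun x : ℝ => x ^ (-a)) (Icc (K : ℝ) (K + n)) := by
    intro x hx y _ hxy
    exact Real.rpow_le_rpow_of_nonpos (hK'.trans_le hx.1) hxy (by linarith)
  refine hanti.sum_le_integral.trans ?_
  rw [integral_rpow (Or.inr ⟨by linarith, by
    rw [uIcc_of_le (by linarith [(Nat.cast_nonneg n : (0 : ℝ) ≤ n)])]
    exact fun h => absurd h.1 (not_le.2 hK')⟩)]
  have h1 : 0 ≤ ((K : ℝ) + n) ^ (-a + 1) := by positivity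
  rw [show -a + 1 = -(a - 1) by ring] at *
  rw [div_neg, ← neg_div, show 1 - a = -(a - 1) by ring]
  gcongr
  · linarith

theorem summable_of_le_rpow {lam : ℕ → ℝ} {a cmax : ℝ} (ha : 1 < a) (h0 : ∀ k, 0 < lam k)
    (h : ∀ k : ℕ, lam k ≤ cmax * ((k : ℝ) + 1) ^ (-a)) : Summable lam := by
  have h1 : Summable fun k : ℕ => ((k : ℝ) + 1) ^ (-a) := by
    have := (summable_nat_add_iff 1).2 (Real.summable_nat_rpow.2 (show -a < -1 by linarith))
    simpa using this
  exact Summable.of_nonneg_of_le (fun k => (h0 k).le) h (h1.mul_left cmax)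

theorem IsWeightSystem.exists_var_le {lam α : ℕ → ℝ} {w : ℕ → ℕ → ℝ} {C a cmax : ℝ}
    (h : IsWeightSystem lam α w C) (ha : 1 < a)
    (hdecay : ∀ k : ℕ, lam k ≤ cmax * ((k : ℝ) + 1) ^ (-a)) :
    ∃ D > 0, ∀ m, α m ≤ 1 → weightVar lam w m ≤ D * α m ^ (-(1 + 1 / a)) := by
  have ha0 : 0 < a := by linarith
  have ha1 : 0 < a - 1 := by linarith
  have hC := h.const_nonneg
  have hcmax : 0 < cmax := by
    have := (h.lam_pos 0).trans_le (hdecay 0)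
    simpa using this
  refine ⟨2 * C + C ^ 2 * cmax / (a - 1) + 1, by positivity, fun m hm => ?_⟩
  have hp := h.par_pos m
  set x := α m with hx
  -- The cut where `λ_k` falls to order `α`. Before it each term is at most `C/α`; after it the
  -- terms are at most `(C/α)² λ_k`, and comparison with an integral sums them to the same order.
  set K := ⌈x ^ (-(1 / a))⌉₊ with hKdef
  have hx1 : 1 ≤ x ^ (-(1 / a)) := Real.one_le_rpow_of_pos_of_le_one_of_nonpos hp hm (by
    rw [neg_nonpos]; positivity)
  have hKle : (K : ℝ) ≤ 2 * x ^ (-(1 / a)) := by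
    have := (Nat.ceil_lt_add_one (a := x ^ (-(1 / a))) (by positivity)).le
    linarith
  have hKge : x ^ (-(1 / a)) ≤ K := Nat.le_ceil _
  have hK0 : 0 < K := by
    have : (0 : ℝ) < K := by linarith
    exact_mod_cast this
  have hxx : x ^ (-(1 + 1 / a)) = x⁻¹ * x ^ (-(1 / a)) := by
    rw [neg_add, Real.rpow_add hp, Real.rpow_neg_one]
  have hfirst : ∑ k ∈ Finset.range K, lam k * w m k ^ 2 ≤ 2 * C * x ^ (-(1 + 1 / a)) := by
    calc ∑ k ∈ Finset.range K, lam k * w m k ^ 2 ≤ ∑ k ∈ Finset.range K, C / x :=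
          Finset.sum_le_sum fun k _ => h.mul_sq_le m k
      _ = K * (C / x) := by simp
      _ ≤ 2 * x ^ (-(1 / a)) * (C / x) := by gcongr
      _ = _ := by rw [hxx]; field_simp
  have htail : ∑' k, lam (k + K) * w m (k + K) ^ 2
      ≤ C ^ 2 * cmax / (a - 1) * x ^ (-(1 + 1 / a)) := by
    refine Real.tsum_le_of_sum_range_le (fun k => h.term_nonneg _ _) fun n => ?_
    have h1 : ∀ i ∈ Finset.range n, lam (i + K) * w m (i + K) ^ 2
        ≤ (C / x) ^ 2 * cmax * ((K : ℝ) + (i + 1 : ℕ)) ^ (-a) := by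
      intro i _
      refine (h.mul_sq_le' m _).trans ?_
      rw [mul_assoc]
      refine mul_le_mul_of_nonneg_left ((hdecay _).trans_eq ?_) (by positivity)
      congr 2
      push_cast; ring
    refine (Finset.sum_le_sum h1).trans ?_
    rw [← Finset.mul_sum]
    have h2 := tsum_shift_rpow_le ha hK0 n
    have h3 : (K : ℝ) ^ (1 - a) ≤ x ^ (1 - 1 / a) := by
      calc (K : ℝ) ^ (1 - a) ≤ (x ^ (-(1 / a))) ^ (1 - a) :=
            Real.rpow_le_rpow_of_nonpos (by positivity) hKge (by linarith)
        _ = x ^ (1 - 1 / a) := by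
            rw [← Real.rpow_mul hp.le]; congr 1; field_simp; ring
    have h4 : x ^ (1 - 1 / a) = x ^ 2 * x ^ (-(1 + 1 / a)) := by
      rw [← Real.rpow_natCast, ← Real.rpow_add hp]; congr 1; push_cast; ring
    calc (C / x) ^ 2 * cmax * ∑ i ∈ Finset.range n, ((K : ℝ) + (i + 1 : ℕ)) ^ (-a)
        ≤ (C / x) ^ 2 * cmax * (x ^ (1 - 1 / a) / (a - 1)) := by
          refine mul_le_mul_of_nonneg_left (h2.trans ?_) (by positivity)
          gcongr
      _ = _ := by rw [h4]; field_simp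
  have hpos : 0 < x ^ (-(1 + 1 / a)) := by positivity
  rw [weightVar, ← (h.summable_var m).sum_add_tsum_nat_add K]
  linarith

theorem countFn_ge {lam : ℕ → ℝ} {a cmin : ℝ} (ha : 1 < a) (hc : 0 < cmin)
    (hs : Summable lam) (hdecay : ∀ k : ℕ, cmin * ((k : ℝ) + 1) ^ (-a) ≤ lam k) {x : ℝ}
    (hx : 0 < x) (hxc : x ≤ cmin) : cmin ^ (1 / a) / 2 * x ^ (-(1 / a)) ≤ countFn lam x := by
  have ha0 : 0 < a := by linarith
  set y := (cmin / x) ^ (1 / a) with hy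
  have hy1 : 1 ≤ y := Real.one_le_rpow (by rwa [one_le_div hx]) (by positivity)
  have hya : y ^ (-a) = x / cmin := by
    rw [hy, ← Real.rpow_mul (by positivity), show 1 / a * -a = -1 by field_simp,
      Real.rpow_neg_one, inv_div]
  have hsub : ((Finset.range ⌊y⌋₊ : Finset ℕ) : Set ℕ) ⊆ {k | x ≤ lam k} := by
    intro k hk
    have hk : k < ⌊y⌋₊ := by simpa using hk
    have hk1 : (k : ℝ) + 1 ≤ y := by
      have := (Nat.le_floor_iff (by positivity)).1 (Nat.succ_le_of_lt hk)
      simpa using this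
    refine le_trans ?_ (hdecay k)
    calc x = cmin * y ^ (-a) := by rw [hya]; field_simp
      _ ≤ _ := by
        gcongr ?_ * ?_
        exact Real.rpow_le_rpow_of_nonpos (by positivity) hk1 (by linarith)
  -- Finiteness is indispensable: `ncard` of an infinite set is `0`.
  have hfin : {k | x ≤ lam k}.Finite := by
    have h1 := hs.tendsto_cofinite_zero.eventually (gt_mem_nhds hx)
    refine (Filter.eventually_cofinite.1 h1).subset fun k hk => ?_
    simpa using hk
  have hcard := Set.ncard_le_ncard hsub hfin
  rw [Set.ncard_coe_finset, Finset.card_range] at hcard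
  have h2 : y / 2 ≤ ⌊y⌋₊ := by
    have := Nat.lt_floor_add_one y
    have h3 : (1 : ℝ) ≤ ⌊y⌋₊ := by
      exact_mod_cast (Nat.le_floor_iff (by positivity)).2 (by simpa using hy1)
    linarith
  have h4 : cmin ^ (1 / a) / 2 * x ^ (-(1 / a)) = y / 2 := by
    rw [hy, Real.div_rpow hc.le hx.le, Real.rpow_neg hx.le]; field_simp
  rw [h4, countFn]
  exact h2.trans (by exact_mod_cast hcard)

end PolynomialDecay

/-- The weights `q_{α m}(λ k)`. -/
def filterWeight (lam : ℕ → ℝ) (q : ℝ → ℝ → ℝ) (α : ℕ → ℝ) (m k : ℕ) : ℝ := q (α m) (lam k)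

/-! ### Comparison of basis series. -/

section Sums

variable {X : Type*} [NormedAddCommGroup X] [InnerProductSpace ℝ X] [CompleteSpace X]

theorem summable_sq_of_abs_le {c d : ℕ → ℝ} (hd : Summable fun k => d k ^ 2) {B : ℝ}
    (h : ∀ k, |c k| ≤ B * |d k|) : Summable fun k => c k ^ 2 := by
  refine Summable.of_nonneg_of_le (fun k => sq_nonneg _) (fun k => ?_) (hd.mul_left (B ^ 2))
  rw [← sq_abs, ← sq_abs (d k), ← mul_pow]
  exact pow_le_pow_left₀ (abs_nonneg _) (h k) 2

theorem tsum_smul_basis_sub (e : HilbertBasis ℕ ℝ X) {c d : ℕ → ℝ}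
    (hc : Summable fun k => c k ^ 2) (hd : Summable fun k => d k ^ 2) :
    ∑' k, c k • e k - ∑' k, d k • e k = ∑' k, (c k - d k) • e k := by
  rw [← ((summable_smul_basis_iff e c).2 hc).tsum_sub ((summable_smul_basis_iff e d).2 hd)]
  simp_rw [sub_smul]

theorem norm_tsum_smul_basis_le (e : HilbertBasis ℕ ℝ X) {c d : ℕ → ℝ}
    (hd : Summable fun k => d k ^ 2) (h : ∀ k, |c k| ≤ |d k|) :
    ‖∑' k, c k • e k‖ ≤ ‖∑' k, d k • e k‖ := by
  have hc : Summable fun k => c k ^ 2 := summable_sq_of_abs_le hd (B := 1) (by simpa using h)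
  refine le_of_sq_le_sq ?_ (norm_nonneg _)
  rw [norm_sq_tsum_smul_basis e hc, norm_sq_tsum_smul_basis e hd]
  exact hc.tsum_le_tsum (fun k => sq_le_sq.2 (h k)) hd

end Sums

/-! ### Noise norms and critical values. -/

section Noise

variable {X Y Ω : Type*}
  [NormedAddCommGroup X] [InnerProductSpace ℝ X] [CompleteSpace X]
  [NormedAddCommGroup Y] [InnerProductSpace ℝ Y] [CompleteSpace Y]
  [MeasurableSpace Ω] {P : Measure Ω} {ξ : Y → Ω → ℝ}
  {T : X →L[ℝ] Y} {e : HilbertBasis ℕ ℝ X} {lam α : ℕ → ℝ} {q : ℝ → ℝ → ℝ} {C : ℝ}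

omit [CompleteSpace Y] in
theorem measurable_norm_filterEst (hξ : IsWhiteNoise P ξ) (a : ℝ) :
    Measurable fun ω => ‖filterEst T e lam q a (fun y => ξ y ω)‖ := by
  let _ : MeasurableSpace X := borel X
  have : BorelSpace X := ⟨rfl⟩
  exact ((measurable_filterEst T e lam q a).comp (measurable_pi_lambda _ hξ.measurable)).norm

omit [CompleteSpace Y] in
theorem measurable_noiseNorm (hξ : IsWhiteNoise P ξ) (m n : ℕ) :
    Measurable (noiseNorm T e lam q α ξ m n) := by
  let _ : MeasurableSpace X := borel X
  have : BorelSpace X := ⟨rfl⟩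
  have := secondCountableTopology_of_hilbertBasis e
  have h : Measurable fun ω y => ξ y ω := measurable_pi_lambda _ hξ.measurable
  exact (((measurable_filterEst T e lam q _).comp h).sub
    ((measurable_filterEst T e lam q _).comp h)).norm

omit [CompleteSpace Y] [MeasurableSpace Ω] in
theorem noiseNorm_eq (h : IsWeightSystem lam α (filterWeight lam q α) C) (m n : ℕ) {ω : Ω}
    (hω : Summable fun k => ξ (T (e k)) ω ^ 2) :
    noiseNorm T e lam q α ξ m n ω
      = ‖∑' k, ((filterWeight lam q α m k - filterWeight lam q α n k) * ξ (T (e k)) ω) • e k‖ := by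
  have hs : ∀ m, Summable fun k => (filterWeight lam q α m k * ξ (T (e k)) ω) ^ 2 := fun m =>
    summable_sq_of_abs_le hω (B := C / α m) fun k => by
      rw [abs_mul, abs_of_nonneg (h.nonneg m k)]
      exact mul_le_mul_of_nonneg_right (h.le_div m k) (abs_nonneg _)
  have h1 := tsum_smul_basis_sub e (hs m) (hs n)
  simp_rw [← sub_mul] at h1
  rw [← h1]
  rfl

theorem pairVar_eq (σ : ℝ) (m n : ℕ) :
    pairVar lam q α σ m n = σ ^ 2 * weightPairVar lam (filterWeight lam q α) m n := rfl

variable [IsProbabilityMeasure P]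

theorem measureReal_noiseNorm_gt_le (hξ : IsWhiteNoise P ξ) (he : IsEigensystem T e lam)
    (h : IsWeightSystem lam α (filterWeight lam q α) C) (hC : 0 < C) {m n : ℕ} (hmn : m ≤ n)
    {x : ℝ} (hx : 0 ≤ x) :
    P.real {ω | √(2 * weightPairVar lam (filterWeight lam q α) m n + 4 * (C / α n) * x)
      < noiseNorm T e lam q α ξ m n ω} ≤ Real.exp (-x) := by
  have hα := h.par_pos n
  have hv : ∀ k, ((lam k).toNNReal : ℝ) = lam k := fun k => Real.coe_toNNReal _ (h.lam_pos k).le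
  have h1 := (he.isGaussianSeq hξ).measure_norm_sq_gt_le e
    (fun k => filterWeight lam q α m k - filterWeight lam q α n k) (M := C / α n)
    (by simp_rw [hv, mul_comm _ (lam _)]; exact h.summable_pairVar hmn) (by positivity)
    (fun k => by rw [hv, mul_comm]; exact h.pairVar_term_le hmn k) x
  simp_rw [hv, mul_comm _ (lam _)] at h1
  refine le_trans (le_of_eq ?_) h1
  refine measureReal_congr ?_
  filter_upwards [he.ae_summable_sq hξ h.lam_summable] with ω hω
  refine propext ?_
  change √_ < noiseNorm T e lam q α ξ m n ω ↔ _ < _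
  rw [noiseNorm_eq h m n hω]
  have hW : 0 ≤ weightPairVar lam (filterWeight lam q α) m n :=
    tsum_nonneg fun k => h.term_nonneg _ k
  have aux : ∀ s r : ℝ, 0 ≤ s → 0 ≤ r → (√s < r ↔ s < r ^ 2) := fun s r hs hr => by
    rw [← Real.sqrt_lt_sqrt_iff hs, Real.sqrt_sq hr]
  exact aux _ _ (by positivity) (norm_nonneg _)

theorem critValue_le (hξ : IsWhiteNoise P ξ) (he : IsEigensystem T e lam)
    (h : IsWeightSystem lam α (filterWeight lam q α) C) (hC : 0 < C) {m n : ℕ} (hmn : m ≤ n)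
    {x : ℝ} (hx : 0 ≤ x) :
    critValue P T e lam q α ξ m n x
      ≤ √(2 * weightPairVar lam (filterWeight lam q α) m n + 4 * (C / α n) * x) :=
  csInf_le ⟨0, fun _ hz => hz.1⟩
    ⟨Real.sqrt_nonneg _, measureReal_noiseNorm_gt_le hξ he h hC hmn hx⟩

omit [CompleteSpace X] [CompleteSpace Y] [IsProbabilityMeasure P] in
theorem critValue_nonneg (m n : ℕ) (x : ℝ) : 0 ≤ critValue P T e lam q α ξ m n x :=
  Real.sInf_nonneg fun _ hz => hz.1

/-- The infimum defining the quantile is attained: `{z < N}` is the increasing union of the events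
`{z + 1/(i+1) < N}`, and every level above `z` exceeds some admissible one. Continuity of the law is
not needed. -/
theorem measure_critValue_lt_le (hξ : IsWhiteNoise P ξ) (he : IsEigensystem T e lam)
    (h : IsWeightSystem lam α (filterWeight lam q α) C) (hC : 0 < C) {m n : ℕ} (hmn : m ≤ n)
    {x : ℝ} (hx : 0 ≤ x) :
    P {ω | critValue P T e lam q α ξ m n x < noiseNorm T e lam q α ξ m n ω}
      ≤ ENNReal.ofReal (Real.exp (-x)) := by
  set z := critValue P T e lam q α ξ m n x with hz
  have hU : {ω | z < noiseNorm T e lam q α ξ m n ω}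
      = ⋃ i : ℕ, {ω | z + 1 / ((i : ℝ) + 1) < noiseNorm T e lam q α ξ m n ω} := by
    ext ω
    simp only [mem_ofPred_eq, mem_iUnion]
    refine ⟨fun hω => ?_, fun ⟨i, hi⟩ => lt_trans (by simp; positivity) hi⟩
    obtain ⟨i, hi⟩ := exists_nat_one_div_lt (sub_pos.2 hω)
    exact ⟨i, by linarith⟩
  have hmono : Monotone fun i : ℕ =>
      {ω | z + 1 / ((i : ℝ) + 1) < noiseNorm T e lam q α ξ m n ω} := by
    intro i j hij ω hω
    refine lt_of_le_of_lt ?_ (show z + 1 / ((i : ℝ) + 1) < _ from hω)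
    have : (i : ℝ) ≤ j := Nat.cast_le.2 hij
    gcongr
  rw [hU, hmono.measure_iUnion]
  refine iSup_le fun i => ?_
  have hlt : z < z + 1 / ((i : ℝ) + 1) := by simp; positivity
  have hne : {z : ℝ | 0 ≤ z ∧
      P.real {ω | z < noiseNorm T e lam q α ξ m n ω} ≤ Real.exp (-x)}.Nonempty :=
    ⟨_, Real.sqrt_nonneg _, measureReal_noiseNorm_gt_le hξ he h hC hmn hx⟩
  obtain ⟨z', hz', hlt'⟩ := exists_lt_of_csInf_lt hne hlt
  rw [← ofReal_measureReal]
  refine ENNReal.ofReal_le_ofReal (le_trans (measureReal_mono fun ω hω => ?_) hz'.2)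
  exact lt_trans hlt' hω

theorem lintegral_norm_sq_filterEst_le (hξ : IsWhiteNoise P ξ) (he : IsEigensystem T e lam)
    (h : IsWeightSystem lam α (filterWeight lam q α) C) (m : ℕ)
    (hV : 0 < weightVar lam (filterWeight lam q α) m) :
    ∫⁻ ω, ENNReal.ofReal (‖filterEst T e lam q (α m) (fun y => ξ y ω)‖ ^ 2) ∂P
      ≤ ENNReal.ofReal (8 * weightVar lam (filterWeight lam q α) m) := by
  have hv : ∀ k, ((lam k).toNNReal : ℝ) = lam k := fun k => Real.coe_toNNReal _ (h.lam_pos k).le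
  have h1 := (he.isGaussianSeq hξ).lintegral_norm_sq_le e (fun k => filterWeight lam q α m k)
  simp_rw [hv, mul_comm _ (lam _)] at h1
  exact h1 (h.summable_var m) hV

theorem lintegral_norm_pow_four_filterEst_le (hξ : IsWhiteNoise P ξ) (he : IsEigensystem T e lam)
    (h : IsWeightSystem lam α (filterWeight lam q α) C) (m : ℕ)
    (hV : 0 < weightVar lam (filterWeight lam q α) m) :
    ∫⁻ ω, ENNReal.ofReal (‖filterEst T e lam q (α m) (fun y => ξ y ω)‖ ^ 4) ∂P
      ≤ ENNReal.ofReal (64 * weightVar lam (filterWeight lam q α) m ^ 2) := by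
  have hv : ∀ k, ((lam k).toNNReal : ℝ) = lam k := fun k => Real.coe_toNNReal _ (h.lam_pos k).le
  have h1 := (he.isGaussianSeq hξ).lintegral_norm_pow_four_le e
    (fun k => filterWeight lam q α m k)
  simp_rw [hv, mul_comm _ (lam _)] at h1
  exact h1 (h.summable_var m) hV

end Noise

/-! ### Bias, and the pathwise error bound for the selected estimator. -/

section Bias

variable {X Y Ω : Type*}
  [NormedAddCommGroup X] [InnerProductSpace ℝ X] [CompleteSpace X]
  [NormedAddCommGroup Y] [InnerProductSpace ℝ Y] [CompleteSpace Y]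
  [MeasurableSpace Ω] {P : Measure Ω} {ξ : Y → Ω → ℝ}
  {T : X →L[ℝ] Y} {e : HilbertBasis ℕ ℝ X} {lam α : ℕ → ℝ} {q : ℝ → ℝ → ℝ} {C : ℝ}

/-- The bias `(1 - q_{α m}(T* T) T* T) f`. -/
noncomputable def biasVec (e : HilbertBasis ℕ ℝ X) (lam : ℕ → ℝ) (q : ℝ → ℝ → ℝ) (α : ℕ → ℝ)
    (f : X) (m : ℕ) : X :=
  ∑' k, ((1 - lam k * filterWeight lam q α m k) * ⟪e k, f⟫_ℝ) • e k

theorem IsWeightSystem.residual_mem_Icc {w : ℕ → ℕ → ℝ} (h : IsWeightSystem lam α w C) (m k : ℕ) :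
    1 - lam k * w m k ∈ Icc (0 : ℝ) 1 :=
  ⟨sub_nonneg.2 (h.nonexp m k),
    sub_le_self _ (mul_nonneg (h.lam_pos k).le (h.nonneg m k))⟩

omit [CompleteSpace X] in
theorem summable_bias (h : IsWeightSystem lam α (filterWeight lam q α) C) (f : X) (m : ℕ) :
    Summable fun k => ((1 - lam k * filterWeight lam q α m k) * ⟪e k, f⟫_ℝ) ^ 2 :=
  summable_sq_of_abs_le (hasSum_inner_sq e f).summable (B := 1) fun k => by
    rw [abs_mul, abs_of_nonneg (h.residual_mem_Icc m k).1]
    exact mul_le_mul_of_nonneg_right (h.residual_mem_Icc m k).2 (abs_nonneg _)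

theorem norm_biasVec_anti (h : IsWeightSystem lam α (filterWeight lam q α) C) (f : X) {m n : ℕ}
    (hmn : m ≤ n) : ‖biasVec e lam q α f n‖ ≤ ‖biasVec e lam q α f m‖ := by
  refine norm_tsum_smul_basis_le e (summable_bias h f m) fun k => ?_
  rw [abs_mul, abs_mul, abs_of_nonneg (h.residual_mem_Icc m k).1,
    abs_of_nonneg (h.residual_mem_Icc n k).1]
  refine mul_le_mul_of_nonneg_right ?_ (abs_nonneg _)
  have := mul_le_mul_of_nonneg_left (h.mono k hmn) (h.lam_pos k).le
  linarith

/-- Ordering gives residuals `0 ≤ r_n ≤ r_m`, so each coordinate of the difference is at most that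
of the bias at `m`; the triangle inequality would lose a factor `2` here. -/
theorem norm_biasVec_sub_le (h : IsWeightSystem lam α (filterWeight lam q α) C) (f : X)
    {m n : ℕ} (hmn : m ≤ n) :
    ‖biasVec e lam q α f m - biasVec e lam q α f n‖ ≤ ‖biasVec e lam q α f m‖ := by
  rw [biasVec, biasVec, tsum_smul_basis_sub e (summable_bias h f m) (summable_bias h f n)]
  refine norm_tsum_smul_basis_le e (summable_bias h f m) fun k => ?_
  rw [← sub_mul, abs_mul, abs_mul, abs_of_nonneg (h.residual_mem_Icc m k).1]
  have h1 := mul_le_mul_of_nonneg_left (h.mono k hmn) (h.lam_pos k).le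
  have h2 := (h.residual_mem_Icc n k).1
  refine mul_le_mul_of_nonneg_right ?_ (abs_nonneg _)
  simp only at h1
  rw [abs_of_nonneg (by linarith)]
  linarith

omit [MeasurableSpace Ω] in
/-- Bias-variance decomposition of a filter estimator. -/
theorem filterEst_obs (he : IsEigensystem T e lam)
    (h : IsWeightSystem lam α (filterWeight lam q α) C) (f : X) (σ : ℝ) (m : ℕ) {ω : Ω}
    (hω : Summable fun k => ξ (T (e k)) ω ^ 2) :
    filterEst T e lam q (α m) (obs T ξ σ f ω)
      = f - biasVec e lam q α f m + σ • filterEst T e lam q (α m) (fun y => ξ y ω) := by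
  have hn : Summable fun k => (filterWeight lam q α m k * ξ (T (e k)) ω) ^ 2 :=
    summable_sq_of_abs_le hω (B := C / α m) fun k => by
      rw [abs_mul, abs_of_nonneg (h.nonneg m k)]
      exact mul_le_mul_of_nonneg_right (h.le_div m k) (abs_nonneg _)
  have h1 := ((summable_smul_basis_iff e _).2 hn).hasSum.const_smul σ
  have h2 := ((summable_smul_basis_iff e _).2 (summable_bias (e := e) h f m)).hasSum
  have h3 := ((summable_smul_basis_iff e _).2 (hasSum_inner_sq e f).summable).hasSum
  rw [tsum_inner_smul_basis] at h3
  refine (((h3.sub h2).add h1).congr_fun fun k => ?_).tsum_eq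
  rw [← sub_smul, smul_smul, ← add_smul]
  congr 1
  change q (α m) (lam k) * (⟪T f, T (e k)⟫_ℝ + σ * ξ (T (e k)) ω) = _
  rw [he.inner_map_basis, filterWeight]
  ring

/-- Deterministic error bound for the selected estimator: up to the error at a fixed index `M`
only the failures of the noise events at larger indices contribute. -/
theorem norm_sq_solitEst_sub_le (he : IsEigensystem T e lam)
    (h : IsWeightSystem lam α (filterWeight lam q α) C) {β γ σ : ℝ} (hσ : 0 < σ) {f : X} {M : ℕ}
    (hM : M ≤ maxIndex lam q α σ) {Θ : ℝ}
    (hΘ : ∀ m < M, threshold P T e lam q α ξ β γ σ m M ^ 2 ≤ Θ)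
    (hbias : ∀ m n, M ≤ m → m < n → ‖biasVec e lam q α f M‖ ≤ β * √(pairVar lam q α σ m n))
    {ω : Ω} (hω : Summable fun k => ξ (T (e k)) ω ^ 2) (hΘ0 : 0 ≤ Θ) :
    ‖solitEst P T e lam q α ξ β γ σ (obs T ξ σ f ω) - f‖ ^ 2
      ≤ 3 * Θ + 3 * ‖biasVec e lam q α f M‖ ^ 2
        + 3 * σ ^ 2 * ‖filterEst T e lam q (α M) (fun y => ξ y ω)‖ ^ 2
        + ∑ j ∈ Finset.Ico M (maxIndex lam q α σ), ∑ n ∈ Finset.Ioc j (maxIndex lam q α σ),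
          {ω | critValue P T e lam q α ξ j n (levelParam lam q α γ σ j)
            < noiseNorm T e lam q α ξ j n ω}.indicator
            (fun ω => 2 * σ ^ 2 * ‖filterEst T e lam q (α (j + 1)) (fun y => ξ y ω)‖ ^ 2) ω := by
  set D := obs T ξ σ f ω with hD
  set N := maxIndex lam q α σ with hN
  set F : ℕ → X := fun m => filterEst T e lam q (α m) D with hF
  set B : ℕ → X := biasVec e lam q α f with hB
  set ζ : ℕ → X := fun m => filterEst T e lam q (α m) (fun y => ξ y ω) with hζ
  set S : Set ℕ := {m₁ | m₁ ≤ N ∧ ∀ m₂, m₁ < m₂ → m₂ ≤ N →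
    ‖F m₁ - F m₂‖ - threshold P T e lam q α ξ β γ σ m₁ m₂ ≤ 0} with hS
  set i := solitIndex P T e lam q α ξ β γ σ D with hi
  have hiS : i = sInf S := rfl
  have hne : S.Nonempty := ⟨N, le_rfl, fun m₂ h1 h2 => absurd h2 (not_le.2 h1)⟩
  have hmem : i ∈ S := hiS ▸ Nat.sInf_mem hne
  have hdec : ∀ m, F m = f - B m + σ • ζ m := fun m => filterEst_obs he h f σ m hω
  have herr : ∀ m, ‖F m - f‖ ≤ ‖B m‖ + σ * ‖ζ m‖ := by
    intro m
    rw [hdec]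
    calc ‖f - B m + σ • ζ m - f‖ = ‖σ • ζ m - B m‖ := by congr 1; abel
      _ ≤ ‖σ • ζ m‖ + ‖B m‖ := norm_sub_le _ _
      _ = _ := by rw [norm_smul, Real.norm_eq_abs, abs_of_pos hσ]; ring
  have hsum0 : 0 ≤ ∑ j ∈ Finset.Ico M N, ∑ n ∈ Finset.Ioc j N,
      {ω | critValue P T e lam q α ξ j n (levelParam lam q α γ σ j)
        < noiseNorm T e lam q α ξ j n ω}.indicator
        (fun ω => 2 * σ ^ 2 * ‖filterEst T e lam q (α (j + 1)) (fun y => ξ y ω)‖ ^ 2) ω :=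
    Finset.sum_nonneg fun j _ => Finset.sum_nonneg fun n _ =>
      Set.indicator_nonneg (fun _ _ => by positivity) _
  change ‖F i - f‖ ^ 2 ≤ _
  rcases le_or_gt i M with hiM | hMi
  · have h1 : ‖F i - f‖ ≤ √Θ + ‖B M‖ + σ * ‖ζ M‖ := by
      rcases hiM.eq_or_lt with heq | hlt
      · rw [heq]
        linarith [herr M, Real.sqrt_nonneg Θ]
      · have h2 := hmem.2 M hlt hM
        have h3 := Real.le_sqrt_of_sq_le (hΘ i hlt)
        calc ‖F i - f‖ = ‖(F i - F M) + (F M - f)‖ := by congr 1; abel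
          _ ≤ ‖F i - F M‖ + ‖F M - f‖ := norm_add_le _ _
          _ ≤ _ := by linarith [herr M]
    have h4 : ‖F i - f‖ ^ 2 ≤ (√Θ + ‖B M‖ + σ * ‖ζ M‖) ^ 2 :=
      pow_le_pow_left₀ (norm_nonneg _) h1 2
    have h5 : (√Θ + ‖B M‖ + σ * ‖ζ M‖) ^ 2
        ≤ 3 * Θ + 3 * ‖B M‖ ^ 2 + 3 * σ ^ 2 * ‖ζ M‖ ^ 2 := by
      nlinarith [Real.sq_sqrt hΘ0, sq_nonneg (√Θ - ‖B M‖), sq_nonneg (√Θ - σ * ‖ζ M‖),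
        sq_nonneg (‖B M‖ - σ * ‖ζ M‖)]
    linarith
  -- Overshoot: the predecessor `j ≥ M` of the selected index was rejected against some `n`. The
  -- bias at `M` controls the bias part of that comparison and is covered by `β √v_{j,n}`, so the
  -- noise exceeds its critical value. The noise in the error is then the one at `j + 1`, which is
  -- why `x_j` is defined through `v_{j+1}`.
  · obtain ⟨j, hj⟩ : ∃ j, i = j + 1 := Nat.exists_eq_succ_of_ne_zero (by omega)
    have hMj : M ≤ j := by omega
    have hjN : j < N := by have := hmem.1; omega
    have hjS : j ∉ S := Nat.notMem_of_lt_sInf (by rw [← hiS]; omega)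
    have hex : ∃ n, j < n ∧ n ≤ N ∧ threshold P T e lam q α ξ β γ σ j n < ‖F j - F n‖ := by
      by_contra! hcon
      exact hjS ⟨hjN.le, fun n h1 h2 => sub_nonpos.2 (hcon n h1 h2)⟩
    obtain ⟨n, hjn, hnN, hlt⟩ := hex
    have hdiff : ‖F j - F n‖ ≤ ‖B M‖ + σ * noiseNorm T e lam q α ξ j n ω := by
      have h1 : F j - F n = σ • (ζ j - ζ n) - (B j - B n) := by
        rw [hdec, hdec, smul_sub]; abel
      rw [h1]
      refine (norm_sub_le _ _).trans ?_
      rw [norm_smul, Real.norm_eq_abs, abs_of_pos hσ, add_comm]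
      exact add_le_add ((norm_biasVec_sub_le h f hjn.le).trans (norm_biasVec_anti h f hMj)) le_rfl
    have hbj := hbias j n hMj hjn
    have hev : critValue P T e lam q α ξ j n (levelParam lam q α γ σ j)
        < noiseNorm T e lam q α ξ j n ω := by
      rw [threshold] at hlt
      have : σ * critValue P T e lam q α ξ j n (levelParam lam q α γ σ j)
          < σ * noiseNorm T e lam q α ξ j n ω := by linarith
      exact lt_of_mul_lt_mul_left this hσ.le
    have hterm : 2 * σ ^ 2 * ‖ζ (j + 1)‖ ^ 2 ≤ ∑ j ∈ Finset.Ico M N, ∑ n ∈ Finset.Ioc j N,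
        {ω | critValue P T e lam q α ξ j n (levelParam lam q α γ σ j)
          < noiseNorm T e lam q α ξ j n ω}.indicator
          (fun ω => 2 * σ ^ 2 * ‖filterEst T e lam q (α (j + 1)) (fun y => ξ y ω)‖ ^ 2) ω := by
      have hnn : ∀ j n, 0 ≤ {ω | critValue P T e lam q α ξ j n (levelParam lam q α γ σ j)
          < noiseNorm T e lam q α ξ j n ω}.indicator
          (fun ω => 2 * σ ^ 2 * ‖filterEst T e lam q (α (j + 1)) (fun y => ξ y ω)‖ ^ 2) ω :=
        fun j n => Set.indicator_nonneg (fun _ _ => by positivity) _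
      refine le_trans ?_ (Finset.single_le_sum (fun j _ => Finset.sum_nonneg fun n _ => hnn j n)
        (Finset.mem_Ico.2 ⟨hMj, hjN⟩))
      refine le_trans ?_ (Finset.single_le_sum (fun n _ => hnn j n)
        (Finset.mem_Ioc.2 ⟨hjn, hnN⟩))
      rw [Set.indicator_of_mem (by exact hev)]
    have h1 : ‖F i - f‖ ≤ ‖B M‖ + σ * ‖ζ (j + 1)‖ := by
      have := herr (j + 1)
      have h2 : ‖B (j + 1)‖ ≤ ‖B M‖ := norm_biasVec_anti h f (by omega)
      rw [hj]; linarith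
    have h4 : ‖F i - f‖ ^ 2 ≤ (‖B M‖ + σ * ‖ζ (j + 1)‖) ^ 2 :=
      pow_le_pow_left₀ (norm_nonneg _) h1 2
    have h5 : (‖B M‖ + σ * ‖ζ (j + 1)‖) ^ 2
        ≤ 2 * ‖B M‖ ^ 2 + 2 * σ ^ 2 * ‖ζ (j + 1)‖ ^ 2 := by
      nlinarith [sq_nonneg (‖B M‖ - σ * ‖ζ (j + 1)‖)]
    have h6 : 0 ≤ 3 * σ ^ 2 * ‖ζ M‖ ^ 2 := by positivity
    have h7 := sq_nonneg ‖B M‖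
    change _ ≤ 3 * Θ + 3 * ‖B M‖ ^ 2 + 3 * σ ^ 2 * ‖ζ M‖ ^ 2 + _
    linarith

end Bias

/-! ### The oracle inequality. -/

section Oracle

variable {X Y Ω : Type*}
  [NormedAddCommGroup X] [InnerProductSpace ℝ X] [CompleteSpace X]
  [NormedAddCommGroup Y] [InnerProductSpace ℝ Y] [CompleteSpace Y]
  [MeasurableSpace Ω] {P : Measure Ω} [IsProbabilityMeasure P] {ξ : Y → Ω → ℝ}
  {T : X →L[ℝ] Y} {e : HilbertBasis ℕ ℝ X} {lam α : ℕ → ℝ} {q : ℝ → ℝ → ℝ} {C : ℝ}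

theorem levelParam_eq {σ : ℝ} (hσ : 0 < σ) (γ : ℝ) (m : ℕ) :
    levelParam lam q α γ σ m = 2 * (1 + γ) * Real.log
      (weightVar lam (filterWeight lam q α) (m + 1) / weightVar lam (filterWeight lam q α) 0) := by
  rw [levelParam, candVar, candVar, mul_div_mul_left _ _ (by positivity)]
  rfl

/-- As `m + 1 ≤ n`, the level `x_m` is at most a multiple of `log (V_n / V_0)`, and `hK` absorbs its
product with `C/α_n` into `V_n`. The bound thus depends on the later index only. -/
theorem threshold_sq_le (hξ : IsWhiteNoise P ξ) (he : IsEigensystem T e lam)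
    (h : IsWeightSystem lam α (filterWeight lam q α) C) (hC : 0 < C)
    (h0 : 0 < weightVar lam (filterWeight lam q α) 0) {K : ℝ}
    (hK : ∀ m, Real.log (weightVar lam (filterWeight lam q α) m
      / weightVar lam (filterWeight lam q α) 0) * (C / α m)
      ≤ K * weightVar lam (filterWeight lam q α) m)
    {γ σ : ℝ} (β : ℝ) (hγ : 0 < γ) (hσ : 0 < σ) {m n : ℕ} (hmn : m < n) :
    threshold P T e lam q α ξ β γ σ m n ^ 2 ≤ (4 + 16 * (1 + γ) * K + 2 * β ^ 2)
      * (σ ^ 2 * weightVar lam (filterWeight lam q α) n) := by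
  set V := weightVar lam (filterWeight lam q α) with hV
  set W := weightPairVar lam (filterWeight lam q α) m n with hW
  set x := levelParam lam q α γ σ m with hx
  have hVm : 1 ≤ V (m + 1) / V 0 := by
    rw [one_le_div h0]; exact h.var_mono (Nat.zero_le _)
  have hx0 : 0 ≤ x := by
    rw [hx, levelParam_eq hσ]
    exact mul_nonneg (by positivity) (Real.log_nonneg hVm)
  have hα := h.par_pos n
  have hxK : C / α n * x ≤ 2 * (1 + γ) * K * V n := by
    have h1 : x ≤ 2 * (1 + γ) * Real.log (V n / V 0) := by
      rw [hx, levelParam_eq hσ]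
      have : V (m + 1) / V 0 ≤ V n / V 0 :=
        div_le_div_of_nonneg_right (h.var_mono hmn) h0.le
      have h2 := Real.log_le_log (by linarith) this
      gcongr
    calc C / α n * x ≤ C / α n * (2 * (1 + γ) * Real.log (V n / V 0)) := by gcongr
      _ = 2 * (1 + γ) * (Real.log (V n / V 0) * (C / α n)) := by ring
      _ ≤ 2 * (1 + γ) * (K * V n) := mul_le_mul_of_nonneg_left (hK n) (by positivity)
      _ = _ := by ring
  have hW0 : 0 ≤ W := tsum_nonneg fun k => h.term_nonneg _ k
  have hWV : W ≤ V n := h.pairVar_le hmn.le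
  set z := critValue P T e lam q α ξ m n x with hz
  have hz2 : z ^ 2 ≤ 2 * W + 4 * (C / α n) * x := by
    have h1 := critValue_le hξ he h hC hmn.le hx0
    have h2 := pow_le_pow_left₀ (critValue_nonneg m n x) h1 2
    rwa [Real.sq_sqrt (by positivity)] at h2
  have hp : √(pairVar lam q α σ m n) ^ 2 = σ ^ 2 * W := Real.sq_sqrt (by
    rw [pairVar_eq]; positivity)
  have hsplit : threshold P T e lam q α ξ β γ σ m n ^ 2
      ≤ 2 * (σ ^ 2 * z ^ 2) + 2 * β ^ 2 * (σ ^ 2 * W) := by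
    rw [threshold, ← hp]
    nlinarith [sq_nonneg (σ * z - β * √(pairVar lam q α σ m n))]
  have h3 : z ^ 2 ≤ 2 * V n + 4 * (2 * (1 + γ) * K * V n) := by
    have : 4 * (C / α n) * x = 4 * (C / α n * x) := by ring
    linarith
  have hσ2 : 0 ≤ σ ^ 2 := sq_nonneg σ
  have h4 := mul_le_mul_of_nonneg_left h3 hσ2
  have h5 := mul_le_mul_of_nonneg_left hWV (by positivity : 0 ≤ 2 * β ^ 2 * σ ^ 2)
  refine hsplit.trans ?_
  nlinarith

/-- The contribution of a single failure of a noise event. -/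
theorem lintegral_failure_le (hξ : IsWhiteNoise P ξ) (he : IsEigensystem T e lam)
    (h : IsWeightSystem lam α (filterWeight lam q α) C) (hC : 0 < C)
    (h0 : 0 < weightVar lam (filterWeight lam q α) 0) {γ σ : ℝ} (hγ : 0 < γ) (hσ : 0 < σ)
    {j n : ℕ} (hjn : j < n) :
    ∫⁻ ω, ENNReal.ofReal ({ω | critValue P T e lam q α ξ j n (levelParam lam q α γ σ j)
        < noiseNorm T e lam q α ξ j n ω}.indicator
        (fun ω => 2 * σ ^ 2 * ‖filterEst T e lam q (α (j + 1)) (fun y => ξ y ω)‖ ^ 2) ω) ∂P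
      ≤ ENNReal.ofReal (130 * (σ ^ 2 * weightVar lam (filterWeight lam q α) 0)) := by
  set V := weightVar lam (filterWeight lam q α) with hV
  set E := {ω | critValue P T e lam q α ξ j n (levelParam lam q α γ σ j)
        < noiseNorm T e lam q α ξ j n ω} with hE
  have hEm : MeasurableSet E := measurableSet_lt measurable_const (measurable_noiseNorm hξ j n)
  have hVj : 0 < V (j + 1) := h0.trans_le (h.var_mono (Nat.zero_le _))
  have hr : 1 ≤ V (j + 1) / V 0 := by
    rw [one_le_div h0]; exact h.var_mono (Nat.zero_le _)
  have hlog := Real.log_nonneg hr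
  have hx0 : 0 ≤ levelParam lam q α γ σ j := by
    rw [levelParam_eq hσ]; positivity
  -- `e^{-x_j}` equals `(V_0/V_{j+1})^{2(1+γ)}`; only the exponent `2` is kept.
  have hPE : P E ≤ ENNReal.ofReal ((V 0 / V (j + 1)) ^ 2) := by
    refine (measure_critValue_lt_le hξ he h hC hjn.le hx0).trans (ENNReal.ofReal_le_ofReal ?_)
    have h1 : (V 0 / V (j + 1)) ^ 2 = Real.exp (-(2 * Real.log (V (j + 1) / V 0))) := by
      have h2 : -(2 * Real.log (V (j + 1) / V 0)) = ((2 : ℕ) : ℝ) * Real.log (V 0 / V (j + 1)) := by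
        rw [← inv_div (V 0), Real.log_inv]; push_cast; ring
      rw [h2, Real.exp_nat_mul, Real.exp_log (by positivity)]
    rw [h1, levelParam_eq hσ]
    refine Real.exp_le_exp.2 (neg_le_neg ?_)
    nlinarith
  -- Young's inequality in place of Cauchy–Schwarz, weighted so that both parts are multiples of `σ²
  -- V_0`: the fourth moment gives `2 · 64` and the probability gives `2`, in total `130`.
  have hpt : ∀ ω, ENNReal.ofReal (E.indicator
        (fun ω => 2 * σ ^ 2 * ‖filterEst T e lam q (α (j + 1)) (fun y => ξ y ω)‖ ^ 2) ω)
      ≤ ENNReal.ofReal (2 * σ ^ 2 * (V 0 / V (j + 1) ^ 2))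
          * ENNReal.ofReal (‖filterEst T e lam q (α (j + 1)) (fun y => ξ y ω)‖ ^ 4)
        + E.indicator (fun _ => ENNReal.ofReal (2 * σ ^ 2 * (V (j + 1) ^ 2 / V 0))) ω := by
    intro ω
    by_cases hω : ω ∈ E
    · rw [Set.indicator_of_mem hω, Set.indicator_of_mem hω, ← ENNReal.ofReal_mul (by positivity),
        ← ENNReal.ofReal_add (by positivity) (by positivity)]
      refine ENNReal.ofReal_le_ofReal ?_
      set r := ‖filterEst T e lam q (α (j + 1)) (fun y => ξ y ω)‖
      have key : r ^ 2 ≤ V 0 / V (j + 1) ^ 2 * r ^ 4 + V (j + 1) ^ 2 / V 0 := by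
        have h1 : V 0 / V (j + 1) ^ 2 * r ^ 4 + V (j + 1) ^ 2 / V 0 - r ^ 2
            = ((V 0 * r ^ 2 - V (j + 1) ^ 2) ^ 2 + V 0 * r ^ 2 * V (j + 1) ^ 2)
              / (V 0 * V (j + 1) ^ 2) := by
          field_simp; ring
        have h2 : 0 ≤ ((V 0 * r ^ 2 - V (j + 1) ^ 2) ^ 2 + V 0 * r ^ 2 * V (j + 1) ^ 2)
              / (V 0 * V (j + 1) ^ 2) := by positivity
        linarith
      have := mul_le_mul_of_nonneg_left key (by positivity : 0 ≤ 2 * σ ^ 2)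
      linarith
    · rw [Set.indicator_of_notMem hω]; simp
  refine (lintegral_mono hpt).trans ?_
  rw [lintegral_add_right _ (measurable_const.indicator hEm),
    lintegral_const_mul' _ _ ENNReal.ofReal_ne_top, lintegral_indicator_const hEm]
  refine (add_le_add (mul_le_mul_right
    (lintegral_norm_pow_four_filterEst_le hξ he h (j + 1) hVj) _)
    (mul_le_mul_right hPE _)).trans ?_
  rw [← ENNReal.ofReal_mul (by positivity), ← ENNReal.ofReal_mul (by positivity),
    ← ENNReal.ofReal_add (by positivity) (by positivity)]
  refine ENNReal.ofReal_le_ofReal (le_of_eq ?_)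
  change 2 * σ ^ 2 * (V 0 / V (j + 1) ^ 2) * (64 * V (j + 1) ^ 2) + _ = _
  field_simp
  norm_num

/-- Oracle inequality: at any index whose bias is dominated by the noise level, the mean squared
error of the selected estimator is bounded by the variance at this index, up to a term of the
order of the smallest variance. -/
theorem mse_solitEst_le (hξ : IsWhiteNoise P ξ) (he : IsEigensystem T e lam)
    (h : IsWeightSystem lam α (filterWeight lam q α) C) (hC : 0 < C)
    (h0 : 0 < weightVar lam (filterWeight lam q α) 0) {K : ℝ} (hK0 : 0 < K)
    (hK : ∀ m, Real.log (weightVar lam (filterWeight lam q α) m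
      / weightVar lam (filterWeight lam q α) 0) * (C / α m)
      ≤ K * weightVar lam (filterWeight lam q α) m)
    {θ : ℝ} (hθ : 1 < θ)
    (hVθ : ∀ m, θ * weightVar lam (filterWeight lam q α) m
      ≤ weightVar lam (filterWeight lam q α) (m + 1))
    {β γ : ℝ} (hβ : 0 < β) (hγ : 0 < γ) :
    ∃ H > 0, ∀ σ > 0, ∀ f : X, ∀ M ≤ maxIndex lam q α σ,
      ‖biasVec e lam q α f M‖ ^ 2 ≤ β ^ 2 * ((θ - 1) ^ 2 / (2 * θ * (θ + 1)))
        * (σ ^ 2 * weightVar lam (filterWeight lam q α) M) →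
      mse P T ξ σ (solitEst P T e lam q α ξ β γ σ) f ≤ ENNReal.ofReal
        (H * (σ ^ 2 * weightVar lam (filterWeight lam q α) M
          + σ ^ 2 * (maxIndex lam q α σ : ℝ) ^ 2)) := by
  set V := weightVar lam (filterWeight lam q α) with hV
  set κ := (θ - 1) ^ 2 / (2 * θ * (θ + 1)) with hκ
  set G := 4 + 16 * (1 + γ) * K + 2 * β ^ 2 with hG
  have hκ0 : 0 < κ := by
    have : 0 < θ - 1 := by linarith
    positivity
  have hG0 : 0 < G := by positivity
  -- The contributions are those of the threshold, the bias, the second noise moment (`24 = 3 · 8`)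
  -- and the failure events.
  refine ⟨3 * G + 3 * (β ^ 2 * κ) + 24 + 130 * V 0, by positivity, fun σ hσ f M hM hb => ?_⟩
  set N := maxIndex lam q α σ with hN
  have hVpos : ∀ m, 0 < V m := fun m => h0.trans_le (h.var_mono (Nat.zero_le m))
  have hVM := hVpos M
  -- One step of geometric growth makes `v_{m,n}` at least `κ v_n ≥ κ v_M`, so the condition at `M`
  -- serves all later pairs.
  have hbias : ∀ m n, M ≤ m → m < n →
      ‖biasVec e lam q α f M‖ ≤ β * √(pairVar lam q α σ m n) := by
    intro m n hMm hmn
    have h1 : κ * V n ≤ weightPairVar lam (filterWeight lam q α) m n :=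
      h.le_pairVar hmn.le hθ ((hVθ m).trans (h.var_mono hmn))
    have h2 : V M ≤ V n := h.var_mono (hMm.trans hmn.le)
    refine le_of_sq_le_sq ?_ (by positivity)
    rw [mul_pow, Real.sq_sqrt (by
      rw [pairVar_eq]; exact mul_nonneg (sq_nonneg _) (tsum_nonneg fun k => h.term_nonneg _ k)),
      pairVar_eq]
    calc ‖biasVec e lam q α f M‖ ^ 2 ≤ β ^ 2 * κ * (σ ^ 2 * V M) := hb
      _ ≤ β ^ 2 * κ * (σ ^ 2 * V n) := by gcongr
      _ = β ^ 2 * (σ ^ 2 * (κ * V n)) := by ring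
      _ ≤ _ := by gcongr
  set A := 3 * (G * (σ ^ 2 * V M)) + 3 * ‖biasVec e lam q α f M‖ ^ 2 with hA
  set R : ℕ → ℕ → Ω → ℝ := fun j n =>
    {ω | critValue P T e lam q α ξ j n (levelParam lam q α γ σ j)
      < noiseNorm T e lam q α ξ j n ω}.indicator
      (fun ω => 2 * σ ^ 2 * ‖filterEst T e lam q (α (j + 1)) (fun y => ξ y ω)‖ ^ 2) with hR
  have hR0 : ∀ j n ω, 0 ≤ R j n ω := fun j n ω =>
    Set.indicator_nonneg (fun _ _ => by positivity) _
  have hRm : ∀ j n, Measurable fun ω => ENNReal.ofReal (R j n ω) := fun j n =>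
    ((((measurable_norm_filterEst hξ _).pow_const 2).const_mul _).indicator
      (measurableSet_lt measurable_const (measurable_noiseNorm hξ j n))).ennreal_ofReal
  have hpt : ∀ᵐ ω ∂P, ‖solitEst P T e lam q α ξ β γ σ (obs T ξ σ f ω) - f‖ₑ ^ 2
      ≤ ENNReal.ofReal A + ENNReal.ofReal (3 * σ ^ 2)
          * ENNReal.ofReal (‖filterEst T e lam q (α M) (fun y => ξ y ω)‖ ^ 2)
        + ∑ j ∈ Finset.Ico M N, ∑ n ∈ Finset.Ioc j N, ENNReal.ofReal (R j n ω) := by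
    filter_upwards [he.ae_summable_sq hξ h.lam_summable] with ω hω
    have h1 := norm_sq_solitEst_sub_le he h hσ (β := β) (γ := γ) hM
      (fun m hm => threshold_sq_le hξ he h hC h0 hK β hγ hσ hm) hbias hω (by positivity)
    rw [← ofReal_norm, ← ENNReal.ofReal_pow (norm_nonneg _), ← ENNReal.ofReal_mul (by positivity),
      ← ENNReal.ofReal_add (by positivity) (by positivity)]
    have h2 : ∑ j ∈ Finset.Ico M N, ∑ n ∈ Finset.Ioc j N, ENNReal.ofReal (R j n ω)
        = ENNReal.ofReal (∑ j ∈ Finset.Ico M N, ∑ n ∈ Finset.Ioc j N, R j n ω) := by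
      rw [ENNReal.ofReal_sum_of_nonneg fun j _ => Finset.sum_nonneg fun n _ => hR0 j n ω]
      exact Finset.sum_congr rfl fun j _ =>
        (ENNReal.ofReal_sum_of_nonneg fun n _ => hR0 j n ω).symm
    rw [h2, ← ENNReal.ofReal_add (by positivity)
      (Finset.sum_nonneg fun j _ => Finset.sum_nonneg fun n _ => hR0 j n ω)]
    exact ENNReal.ofReal_le_ofReal h1
  refine (lintegral_mono_ae hpt).trans ?_
  rw [lintegral_add_right _ (Finset.measurable_sum _ fun j _ =>
      Finset.measurable_sum _ fun n _ => hRm j n), lintegral_add_left measurable_const,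
    lintegral_const, measure_univ, mul_one, lintegral_const_mul' _ _ ENNReal.ofReal_ne_top,
    lintegral_finsetSum _ fun j _ => Finset.measurable_sum _ fun n _ => hRm j n]
  have hsum : ∑ j ∈ Finset.Ico M N, ∫⁻ ω, ∑ n ∈ Finset.Ioc j N, ENNReal.ofReal (R j n ω) ∂P
      ≤ ENNReal.ofReal ((N : ℝ) ^ 2 * (130 * (σ ^ 2 * V 0))) := by
    have h1 : ∀ j ∈ Finset.Ico M N, ∫⁻ ω, ∑ n ∈ Finset.Ioc j N, ENNReal.ofReal (R j n ω) ∂P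
        ≤ N * ENNReal.ofReal (130 * (σ ^ 2 * V 0)) := by
      intro j _
      rw [lintegral_finsetSum _ fun n _ => hRm j n]
      refine (Finset.sum_le_card_nsmul _ _ _ fun n hn =>
        lintegral_failure_le hξ he h hC h0 hγ hσ (Finset.mem_Ioc.1 hn).1).trans ?_
      rw [nsmul_eq_mul, Nat.card_Ioc]
      gcongr
      exact Nat.sub_le _ _
    refine (Finset.sum_le_card_nsmul _ _ _ h1).trans ?_
    rw [nsmul_eq_mul, Nat.card_Ico, show (N : ℝ) ^ 2 * (130 * (σ ^ 2 * V 0))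
      = N * (N * (130 * (σ ^ 2 * V 0))) by ring, ENNReal.ofReal_mul (Nat.cast_nonneg N),
      ENNReal.ofReal_mul (Nat.cast_nonneg N), ENNReal.ofReal_natCast]
    gcongr
    exact Nat.sub_le _ _
  refine (add_le_add (add_le_add le_rfl (mul_le_mul_right
    (lintegral_norm_sq_filterEst_le hξ he h M hVM) _)) hsum).trans ?_
  rw [← ENNReal.ofReal_mul (by positivity), ← ENNReal.ofReal_add (by positivity) (by positivity),
    ← ENNReal.ofReal_add (by positivity) (by positivity)]
  refine ENNReal.ofReal_le_ofReal ?_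
  change A + 3 * σ ^ 2 * (8 * V M) + (N : ℝ) ^ 2 * (130 * (σ ^ 2 * V 0)) ≤ _
  have e1 : 0 ≤ σ ^ 2 * V M := by positivity
  have e2 : 0 ≤ σ ^ 2 * (N : ℝ) ^ 2 := by positivity
  have e3 : 0 ≤ (3 * G + 3 * (β ^ 2 * κ) + 24) * (σ ^ 2 * (N : ℝ) ^ 2) := by positivity
  have e4 : 0 ≤ V 0 * (σ ^ 2 * V M) := mul_nonneg h0.le e1
  rw [hA]
  nlinarith

end Oracle

/-! ### Source conditions: coordinates, cube vertices and bias. -/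

section SourceSet

variable {X Y : Type*}
  [NormedAddCommGroup X] [InnerProductSpace ℝ X] [CompleteSpace X]
  [NormedAddCommGroup Y] [InnerProductSpace ℝ Y] [CompleteSpace Y]
  {e : HilbertBasis ℕ ℝ X} {lam α : ℕ → ℝ}

/-- Only an inequality, because a divergent series defines `specApply` to be `0`; no boundedness of
`ψ` is then required. -/
theorem abs_inner_specApply_le (ψ : ℝ → ℝ) (g : X) (k : ℕ) :
    |⟪e k, specApply e lam ψ g⟫_ℝ| ≤ |ψ (lam k) * ⟪e k, g⟫_ℝ| := by
  by_cases h : Summable fun k => (ψ (lam k) * ⟪e k, g⟫_ℝ) ^ 2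
  · rw [specApply, inner_tsum_smul_basis e h]
  · rw [specApply,
      tsum_eq_zero_of_not_summable fun h' => h ((summable_smul_basis_iff e _).1 h'), inner_zero_right, abs_zero]
    exact abs_nonneg _

omit [CompleteSpace X] in
theorem cubeVertex_mem_sourceSet {ψ : ℝ → ℝ} {b ρ : ℝ} {F S : Finset ℕ}
    (hψ : ∀ k ∈ F, ψ (lam k) ≠ 0) (hρ : 0 ≤ ρ)
    (hb : ∑ k ∈ F, b ^ 2 / ψ (lam k) ^ 2 ≤ ρ ^ 2) :
    cubeVertex e b F S ∈ sourceSet e lam ψ ρ := by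
  set g : X := ∑ k ∈ F, ((if k ∈ S then b else -b) / ψ (lam k)) • e k with hg
  have hcoord : ∀ k, ⟪e k, g⟫_ℝ = if k ∈ F then (if k ∈ S then b else -b) / ψ (lam k) else 0 := by
    intro k
    rw [hg, inner_sum]
    simp_rw [inner_smul_right, orthonormal_iff_ite.1 e.orthonormal]
    simp
  refine ⟨g, ?_, ?_⟩
  · refine le_of_sq_le_sq ?_ hρ
    rw [← (hasSum_inner_sq e g).tsum_eq, tsum_eq_sum (s := F) fun k hk => by
      rw [hcoord, if_neg hk]; ring]
    refine le_trans (le_of_eq (Finset.sum_congr rfl fun k hk => ?_)) hb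
    rw [hcoord, if_pos hk, div_pow]
    congr 1
    split_ifs <;> ring
  · rw [specApply, tsum_eq_sum (s := F) fun k hk => by rw [hcoord, if_neg hk]; simp, cubeVertex]
    refine Finset.sum_congr rfl fun k hk => ?_
    rw [hcoord, if_pos hk, mul_div_cancel₀ _ (hψ k hk)]

theorem norm_biasVec_le_of_mem_sourceSet {q : ℝ → ℝ → ℝ} {C : ℝ}
    (h : IsWeightSystem lam α (filterWeight lam q α) C) {ψ : ℝ → ℝ} {ρ B : ℝ} {m : ℕ}
    (hψ : ∀ k, 0 ≤ ψ (lam k)) (hB : 0 ≤ B)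
    (hqual : ∀ k, ψ (lam k) * (1 - lam k * filterWeight lam q α m k) ≤ B) {f : X}
    (hf : f ∈ sourceSet e lam ψ ρ) : ‖biasVec e lam q α f m‖ ≤ B * ρ := by
  obtain ⟨g, hg, rfl⟩ := hf
  have hgs := hasSum_inner_sq e g
  have hd : Summable fun k => (B * ⟪e k, g⟫_ℝ) ^ 2 := by
    simp_rw [mul_pow]; exact hgs.summable.mul_left _
  have h1 : ‖biasVec e lam q α (specApply e lam ψ g) m‖ ≤ ‖∑' k, (B * ⟪e k, g⟫_ℝ) • e k‖ := by
    refine norm_tsum_smul_basis_le e hd fun k => ?_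
    have hr := (h.residual_mem_Icc m k).1
    rw [abs_mul, abs_mul, abs_of_nonneg hr, abs_of_nonneg hB]
    refine (mul_le_mul_of_nonneg_left (abs_inner_specApply_le ψ g k) hr).trans ?_
    rw [abs_mul, abs_of_nonneg (hψ k), ← mul_assoc, mul_comm _ (ψ (lam k))]
    exact mul_le_mul_of_nonneg_right (hqual k) (abs_nonneg _)
  refine h1.trans (le_trans (le_of_eq ?_) (mul_le_mul_of_nonneg_left hg hB))
  rw [← sq_eq_sq₀ (norm_nonneg _) (by positivity), norm_sq_tsum_smul_basis e hd, mul_pow,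
    ← hgs.tsum_eq, ← tsum_mul_left]
  simp_rw [mul_pow]

end SourceSet

/-! ### The largest candidate index grows at most logarithmically. -/

section MaxIndex

variable {lam α : ℕ → ℝ} {q : ℝ → ℝ → ℝ} {C : ℝ}

theorem maxIndex_spec (hV : Tendsto (weightVar lam (filterWeight lam q α)) atTop atTop) {σ : ℝ}
    (hσ : 0 < σ) : 1 ≤ σ ^ 2 * weightVar lam (filterWeight lam q α) (maxIndex lam q α σ) := by
  have hne : {m | 1 ≤ m ∧ 1 ≤ candVar lam q α σ m}.Nonempty := by
    obtain ⟨m, hm, hm1⟩ := ((hV.eventually_ge_atTop (1 / σ ^ 2)).and (eventually_ge_atTop 1)).exists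
    refine ⟨m, hm1, ?_⟩
    rw [div_le_iff₀ (by positivity), mul_comm] at hm
    exact hm
  exact (Nat.sInf_mem hne).2

theorem le_maxIndex (h : IsWeightSystem lam α (filterWeight lam q α) C)
    (hV : Tendsto (weightVar lam (filterWeight lam q α)) atTop atTop) {σ : ℝ} (hσ : 0 < σ) {m : ℕ}
    (hm : σ ^ 2 * weightVar lam (filterWeight lam q α) m < 1) : m ≤ maxIndex lam q α σ := by
  by_contra! hlt
  have h1 := maxIndex_spec hV hσ
  have h2 := mul_le_mul_of_nonneg_left (h.var_mono hlt.le) (sq_nonneg σ)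
  linarith

theorem exists_maxIndex_le {θ : ℝ} (hθ : 1 < θ)
    (hVθ : ∀ m, θ * weightVar lam (filterWeight lam q α) m
      ≤ weightVar lam (filterWeight lam q α) (m + 1))
    (h0 : 0 < weightVar lam (filterWeight lam q α) 0) :
    ∃ D > 0, ∀ σ : ℝ, 0 < σ → 1 ≤ -Real.log (σ ^ 2) →
      (maxIndex lam q α σ : ℝ) ≤ D * -Real.log (σ ^ 2) := by
  set V := weightVar lam (filterWeight lam q α) with hV
  have hlθ : 0 < Real.log θ := Real.log_pos hθ
  refine ⟨1 + (1 + |Real.log (V 0)|) / Real.log θ, by positivity, fun σ hσ hL => ?_⟩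
  set N := maxIndex lam q α σ with hN
  set L := -Real.log (σ ^ 2) with hLdef
  have hbound : ((N : ℝ) - 1) * Real.log θ ≤ L + |Real.log (V 0)| := by
    -- Since `m_max` is a minimum over `m ≥ 1`, minimality at `N - 1` is informative only for `N ≥
    -- 2`. Then `σ² θ^{N-1} V_0 < 1`.
    rcases Nat.lt_or_ge N 2 with h2 | h2
    · have : (N : ℝ) ≤ 1 := by exact_mod_cast Nat.lt_succ_iff.1 h2
      have h3 : ((N : ℝ) - 1) * Real.log θ ≤ 0 :=
        mul_nonpos_of_nonpos_of_nonneg (by linarith) hlθ.le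
      linarith [abs_nonneg (Real.log (V 0))]
    · have hnot : N - 1 ∉ {m | 1 ≤ m ∧ 1 ≤ candVar lam q α σ m} :=
        Nat.notMem_of_lt_sInf (by change N - 1 < N; omega)
      have hlt : σ ^ 2 * V (N - 1) < 1 := by
        by_contra! hcon
        exact hnot ⟨by omega, hcon⟩
      have h3 : σ ^ 2 * (θ ^ (N - 1) * V 0) < 1 :=
        lt_of_le_of_lt (mul_le_mul_of_nonneg_left
          (IsWeightSystem.pow_mul_var_le (by linarith) hVθ (N - 1)) (sq_nonneg σ)) hlt
      have hθ0 : 0 < θ := by linarith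
      have h4 := (Real.log_neg (by positivity) h3).le
      rw [Real.log_mul (by positivity) (by positivity), Real.log_mul (by positivity) h0.ne',
        Real.log_pow θ (N - 1), Nat.cast_sub (by omega), Nat.cast_one] at h4
      have := neg_abs_le (Real.log (V 0))
      rw [hLdef]
      linarith
  have h5 : (N : ℝ) - 1 ≤ (L + |Real.log (V 0)|) / Real.log θ := by rwa [le_div_iff₀ hlθ]
  have h6 : (L + |Real.log (V 0)|) / Real.log θ ≤ (1 + |Real.log (V 0)|) / Real.log θ * L := by
    rw [div_mul_eq_mul_div]
    refine div_le_div_of_nonneg_right ?_ hlθ.le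
    nlinarith [abs_nonneg (Real.log (V 0))]
  linarith

end MaxIndex

/-! ### The minimax lower bound. -/

section Rates

variable {X Y Ω : Type*}
  [NormedAddCommGroup X] [InnerProductSpace ℝ X] [CompleteSpace X]
  [NormedAddCommGroup Y] [InnerProductSpace ℝ Y] [CompleteSpace Y]
  [MeasurableSpace Ω] {P : Measure Ω} [IsProbabilityMeasure P] {ξ : Y → Ω → ℝ}
  {T : X →L[ℝ] Y} {e : HilbertBasis ℕ ℝ X} {lam α : ℕ → ℝ} {q : ℝ → ℝ → ℝ}
  {a cmin cmax ν τ ρ : ℝ}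

theorem indexFn_pos {x : ℝ} (hx : 0 < x) (hx1 : x ≤ Real.exp (-1)) : 0 < indexFn ν τ x := by
  have h1 : Real.log x ≤ -1 := by
    rw [← Real.log_exp (-1)]; exact Real.log_le_log hx hx1
  have h2 : 0 < -Real.log x := by linarith
  unfold indexFn
  positivity

theorem minimaxRisk_ge_mildRate [MeasurableSpace X] [BorelSpace X] (hξ : IsWhiteNoise P ξ)
    (he : IsEigensystem T e lam) (hlam : lam 0 ≤ Real.exp (-1)) (ha : 1 < a) (hcmin : 0 < cmin)
    (hdecay : ∀ k : ℕ, cmin * ((k : ℝ) + 1) ^ (-a) ≤ lam k ∧ lam k ≤ cmax * ((k : ℝ) + 1) ^ (-a))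
    (hν : 0 ≤ ν) (τ : ℝ) (hρ : 0 < ρ) :
    ∃ c > 0, ∀ᶠ σ in 𝓝[>] (0 : ℝ), ENNReal.ofReal (c * mildRate a ν τ σ)
      ≤ minimaxRisk P T ξ σ (sourceSet e lam (indexFn ν τ) ρ) := by
  have ha0 : 0 < a := by linarith
  have hcmax : 0 < cmax := by
    have := (he.pos 0).trans_le (hdecay 0).2
    simpa using this
  obtain ⟨M, hM, hφ⟩ := exists_indexFn_sq_bounds ha hν τ
  -- For `K ≤ k < 2K` one has `k + 1 ≤ 2K ≤ 4 x^{-1/a}`, hence `λ_k ≥ c₁ x`.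
  set c₁ := cmin * (4 : ℝ) ^ (-a) with hc₁
  have hc₁0 : 0 < c₁ := by positivity
  -- With `b² = c₀ σ²/x`, the first bound makes each sign undetectable (`b² λ_k ≤ σ²`) and the
  -- second keeps the vertices in the source ball.
  set c₀ := min (1 / cmax) (ρ ^ 2 * c₁ ^ (2 * ν) / (2 * M)) with hc₀
  have hc₀0 : 0 < c₀ := by positivity
  have hgf := gaussianFloor_pos
  refine ⟨2 * gaussianFloor * c₀, by positivity, ?_⟩
  filter_upwards [hφ c₁ hc₁0 cmax hcmax, eventually_idealPar_le ha hν τ one_pos,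
    eventually_le_neg_log_sq 1, self_mem_nhdsWithin] with σ hσφ hI1 hL hσ
  have hσ : 0 < σ := hσ
  have hL : 0 < -Real.log (σ ^ 2) := by linarith
  have hI := idealPar_pos (a := a) (ν := ν) (τ := τ) hσ hL
  have hr := mildRate_pos (a := a) (ν := ν) (τ := τ) hσ hL
  have hrate := sq_mul_idealPar_rpow (τ := τ) ha hν hσ hL
  set x := idealPar a ν τ σ with hx
  set K := ⌈x ^ (-(1 / a))⌉₊ with hKdef
  have hx1 : 1 ≤ x ^ (-(1 / a)) := Real.one_le_rpow_of_pos_of_le_one_of_nonpos hI hI1 (by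
    rw [neg_nonpos]; positivity)
  have hKle : (K : ℝ) ≤ 2 * x ^ (-(1 / a)) := by
    have := (Nat.ceil_lt_add_one (a := x ^ (-(1 / a))) (by positivity)).le
    linarith
  have hKge : x ^ (-(1 / a)) ≤ K := Nat.le_ceil _
  have hxx : x ^ (-(1 + 1 / a)) = x ^ (-(1 / a)) / x := by
    rw [neg_add, Real.rpow_add hI, Real.rpow_neg_one]; field_simp
  have hxa : (x ^ (-(1 / a))) ^ (-a) = x := by
    rw [← Real.rpow_mul hI.le, show -(1 / a) * -a = 1 by field_simp, Real.rpow_one]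
  set b := √(c₀ * σ ^ 2 / x) with hb
  have hb2 : b ^ 2 = c₀ * σ ^ 2 / x := Real.sq_sqrt (by positivity)
  have hlow : ∀ k ∈ Finset.Ico K (2 * K), c₁ * x ≤ lam k := by
    intro k hk
    have hk2 : (k : ℝ) + 1 ≤ 2 * K := by exact_mod_cast (Finset.mem_Ico.1 hk).2
    refine le_trans ?_ (hdecay k).1
    rw [hc₁, mul_assoc]
    refine mul_le_mul_of_nonneg_left ?_ hcmin.le
    calc (4 : ℝ) ^ (-a) * x = (4 * x ^ (-(1 / a))) ^ (-a) := by
          rw [Real.mul_rpow (by norm_num) (by positivity), hxa]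
      _ ≤ _ := Real.rpow_le_rpow_of_nonpos (by positivity) (by linarith) (by linarith)
  have hupp : ∀ k ∈ Finset.Ico K (2 * K), lam k ≤ cmax * x := by
    intro k hk
    have hk2 : (K : ℝ) ≤ k := by exact_mod_cast (Finset.mem_Ico.1 hk).1
    refine (hdecay k).2.trans (mul_le_mul_of_nonneg_left ?_ hcmax.le)
    calc ((k : ℝ) + 1) ^ (-a) ≤ (x ^ (-(1 / a))) ^ (-a) :=
          Real.rpow_le_rpow_of_nonpos (by positivity) (by linarith) (by linarith)
      _ = x := hxa
  have hφpos : ∀ k, 0 < indexFn ν τ (lam k) := fun k =>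
    indexFn_pos (he.pos k) ((he.anti (Nat.zero_le k)).trans hlam)
  have hcard : (Finset.Ico K (2 * K)).card = K := by rw [Nat.card_Ico]; omega
  have hKb : K * b ^ 2 ≤ 2 * c₀ * mildRate a ν τ σ := by
    rw [hb2, ← hrate, hxx]
    calc (K : ℝ) * (c₀ * σ ^ 2 / x) ≤ (2 * x ^ (-(1 / a))) * (c₀ * σ ^ 2 / x) := by gcongr
      _ = _ := by ring
  have h1 := minimaxRisk_ge_of_cube hξ he hσ (b := b) (Finset.Ico K (2 * K))
    (W := sourceSet e lam (indexFn ν τ) ρ) (fun k hk => ?_) (fun S _ => ?_)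
  · refine le_trans (ENNReal.ofReal_le_ofReal ?_) h1
    rw [hcard, hb2, ← hrate, hxx]
    calc 2 * gaussianFloor * c₀ * (σ ^ 2 * (x ^ (-(1 / a)) / x))
        = x ^ (-(1 / a)) * (2 * gaussianFloor * (c₀ * σ ^ 2 / x)) := by ring
      _ ≤ _ := by gcongr
  · rw [hb2]
    calc c₀ * σ ^ 2 / x * lam k ≤ (1 / cmax) * σ ^ 2 / x * (cmax * x) := by
          gcongr
          · exact (he.pos k).le
          · exact min_le_left _ _
          · exact hupp k hk
      _ = _ := by field_simp
  · refine cubeVertex_mem_sourceSet (fun k _ => (hφpos k).ne') hρ.le ?_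
    have hterm : ∀ k ∈ Finset.Ico K (2 * K), b ^ 2 / indexFn ν τ (lam k) ^ 2
        ≤ b ^ 2 * (M / (c₁ ^ (2 * ν) * mildRate a ν τ σ)) := by
      intro k hk
      rw [div_eq_mul_inv]
      refine mul_le_mul_of_nonneg_left ?_ (sq_nonneg b)
      have h2 := (hσφ (lam k) (hlow k hk) (hupp k hk)).2
      have h3 := hφpos k
      rw [inv_le_comm₀ (by positivity) (by positivity), inv_div, div_le_iff₀ hM]
      linarith
    refine (Finset.sum_le_card_nsmul _ _ _ hterm).trans ?_
    rw [hcard, nsmul_eq_mul, ← mul_assoc]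
    calc K * b ^ 2 * (M / (c₁ ^ (2 * ν) * mildRate a ν τ σ))
        ≤ 2 * c₀ * mildRate a ν τ σ * (M / (c₁ ^ (2 * ν) * mildRate a ν τ σ)) := by gcongr
      _ = 2 * M / c₁ ^ (2 * ν) * c₀ := by field_simp
      _ ≤ 2 * M / c₁ ^ (2 * ν) * (ρ ^ 2 * c₁ ^ (2 * ν) / (2 * M)) := by
          gcongr
          exact min_le_right _ _
      _ = ρ ^ 2 := by field_simp

end Rates

/-! ### The upper bound for the selected estimator. -/

section Upper

variable {X Y Ω : Type*}
  [NormedAddCommGroup X] [InnerProductSpace ℝ X] [CompleteSpace X]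
  [NormedAddCommGroup Y] [InnerProductSpace ℝ Y] [CompleteSpace Y]
  [MeasurableSpace Ω] {P : Measure Ω} [IsProbabilityMeasure P] {ξ : Y → Ω → ℝ}
  {T : X →L[ℝ] Y} {e : HilbertBasis ℕ ℝ X} {lam α : ℕ → ℝ} {q : ℝ → ℝ → ℝ} {A : Set ℝ}
  {a cmin cmax ν τ ρ θ₁ θ₂ : ℝ}

theorem exists_isWeightSystem (he : IsEigensystem T e lam) (hs : Summable lam)
    (hq : IsOrderedFilter A ‖normalOp T‖ q) (hα : IsCandidateSeq A lam q θ₁ θ₂ α) :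
    ∃ C > 0, IsWeightSystem lam α (filterWeight lam q α) C := by
  obtain ⟨C, hC⟩ := hq.bound
  have hmem : ∀ k, lam k ∈ Icc 0 ‖normalOp T‖ := fun k => ⟨(he.pos k).le, he.le_norm k⟩
  exact ⟨max C 1, by positivity, {
    lam_pos := he.pos
    lam_summable := hs
    par_pos := fun m => hq.pos _ (hα.mem m)
    nonneg := fun m k => hq.nonneg _ (hα.mem m) _ (hmem k)
    nonexp := fun m k => hq.nonexp _ (hα.mem m) _ (hmem k)
    mono := fun k m n hmn =>
      hq.ordered _ (hα.mem m) _ (hα.mem n) (hα.anti.antitone hmn) _ (hmem k)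
    bound := fun m k => (hC _ (hα.mem m) _ (hmem k)).trans (le_max_left _ _) }⟩

/-- A vanishing variance would make the next ratio `0` by the convention on division, against `θ₁ >
1`. -/
theorem IsCandidateSeq.weightVar_pos {C : ℝ} (hα : IsCandidateSeq A lam q θ₁ θ₂ α)
    (hθ₁ : 1 < θ₁) (h : IsWeightSystem lam α (filterWeight lam q α) C) (m : ℕ) :
    0 < weightVar lam (filterWeight lam q α) m := by
  refine (h.var_nonneg m).lt_of_ne' fun h0 => ?_
  have h1 := hα.ratio_lower m
  have h2 : varFn lam q (α m) = 0 := h0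
  rw [h2, div_zero] at h1
  linarith

/-- The chain is `V(α) ≳ S(α)/α ≳ Σ(α)/α ≳ α^{-1/a}/α`. -/
theorem eventually_weightVar_ge (ha : 1 < a) (hcmin : 0 < cmin) (hs : Summable lam)
    (hlam0 : 0 < lam 0) (hdecay : ∀ k : ℕ, cmin * ((k : ℝ) + 1) ^ (-a) ≤ lam k)
    (hvar : VarianceLowerBound A lam q α) (hmem : ∀ m, α m ∈ A) (hpos : ∀ m, 0 < α m)
    (hα : Tendsto α atTop (𝓝 0)) :
    ∃ c > 0, ∀ᶠ m in atTop,
      c * α m ^ (-(1 + 1 / a)) ≤ weightVar lam (filterWeight lam q α) m := by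
  obtain ⟨S, hS, c₀, hc₀, hV⟩ := hvar
  obtain ⟨c₁, hc₁, hlow⟩ := hS.lower
  have hα' : Tendsto α atTop (𝓝[A] 0) :=
    tendsto_nhdsWithin_iff.2 ⟨hα, Eventually.of_forall hmem⟩
  refine ⟨c₀ * (c₁ * (cmin ^ (1 / a) / 2)), by positivity, ?_⟩
  filter_upwards [hα'.eventually hlow, hα.eventually (ge_mem_nhds hcmin),
    hα.eventually (ge_mem_nhds hlam0)] with m h1 h2 h3
  refine le_trans ?_ (hV m h3)
  have hp := hpos m
  have h4 := countFn_ge ha hcmin hs hdecay hp h2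
  have hxx : α m ^ (-(1 + 1 / a)) = α m ^ (-(1 / a)) / α m := by
    rw [neg_add, Real.rpow_add hp, Real.rpow_neg_one]; field_simp
  calc c₀ * (c₁ * (cmin ^ (1 / a) / 2)) * α m ^ (-(1 + 1 / a))
      = c₀ * (c₁ * (cmin ^ (1 / a) / 2 * α m ^ (-(1 / a))) / α m) := by rw [hxx]; ring
    _ ≤ c₀ * (c₁ * countFn lam (α m) / α m) := by gcongr
    _ ≤ _ := by gcongr

theorem worstMse_solitEst_le_mildRate (hξ : IsWhiteNoise P ξ)
    (he : IsEigensystem T e lam) (hlam : lam 0 ≤ Real.exp (-1)) (ha : 1 < a) (hcmin : 0 < cmin)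
    (hdecay : ∀ k : ℕ, cmin * ((k : ℝ) + 1) ^ (-a) ≤ lam k ∧ lam k ≤ cmax * ((k : ℝ) + 1) ^ (-a))
    (hq : IsOrderedFilter A ‖normalOp T‖ q) (hθ₁ : 1 < θ₁)
    (hα : IsCandidateSeq A lam q θ₁ θ₂ α) (hvar : VarianceLowerBound A lam q α)
    {β γ : ℝ} (hβ : 0 < β) (hγ : 0 < γ) (hντ : 0 < ν ∨ (ν = 0 ∧ 0 < τ)) (hρ : 0 < ρ)
    (hqual : IsQualification A ‖normalOp T‖ q (indexFn ν τ)) :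
    ∃ R > 0, ∀ᶠ σ in 𝓝[>] (0 : ℝ),
      worstMse P T ξ σ (solitEst P T e lam q α ξ β γ σ) (sourceSet e lam (indexFn ν τ) ρ)
        ≤ ENNReal.ofReal (R * mildRate a ν τ σ) := by
  have ha0 : 0 < a := by linarith
  have hν : 0 ≤ ν := by rcases hντ with h | h <;> linarith [h]
  have hs : Summable lam := summable_of_le_rpow ha he.pos fun k => (hdecay k).2
  obtain ⟨C, hC, h⟩ := exists_isWeightSystem he hs hq hα
  have hVpos := hα.weightVar_pos hθ₁ h
  set V := weightVar lam (filterWeight lam q α) with hV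
  have hVθ : ∀ m, θ₁ * V m ≤ V (m + 1) := fun m =>
    (le_div_iff₀ (hVpos m)).1 (hα.ratio_lower m)
  have hVθ₂ : ∀ m, V (m + 1) ≤ θ₂ * V m := fun m =>
    (div_le_iff₀ (hVpos m)).1 (hα.ratio_upper m)
  have hθ₂ : 0 < θ₂ := by
    have := (hα.ratio_lower 0).trans (hα.ratio_upper 0)
    linarith
  have hVt : Tendsto V atTop atTop := IsWeightSystem.tendsto_var hθ₁ hVθ (hVpos 0)
  have hαt := h.tendsto_par hVt
  set p := 1 + 1 / a with hp
  have hp1 : 1 < p := by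
    have : 0 < 1 / a := by positivity
    linarith
  obtain ⟨cL, hcL, hlow⟩ := eventually_weightVar_ge ha hcmin hs (he.pos 0)
    (fun k => (hdecay k).1) hvar hα.mem h.par_pos hαt
  obtain ⟨D, hD, hupp⟩ := h.exists_var_le ha fun k => (hdecay k).2
  obtain ⟨K, hK0, hK⟩ := h.exists_log_mul_le hp1 hcL (hVpos 0) hlow
  obtain ⟨H, hH, horacle⟩ := mse_solitEst_le hξ he h hC (hVpos 0) hK0 hK hθ₁ hVθ hβ hγ
  obtain ⟨D₂, hD₂, hmax⟩ := exists_maxIndex_le hθ₁ hVθ (hVpos 0)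
  obtain ⟨Mφ, hMφ, hφ⟩ := exists_indexFn_sq_bounds ha hν τ
  obtain ⟨Cq, hCq⟩ := hqual
  set κ := (θ₁ - 1) ^ 2 / (2 * θ₁ * (θ₁ + 1)) with hκ
  have hκ0 : 0 < κ := by
    have : 0 < θ₁ - 1 := by linarith
    positivity
  set E := Cq ^ 2 * ρ ^ 2 * Mφ with hE
  have hE0 : 0 ≤ E := by positivity
  -- Shrinking the parameter below `δ x` inflates the variance by `δ^{-p}` while the bias bound `E
  -- r` stays fixed, so the oracle condition holds even for `ν = 0`. The `+ 1` guards against `E =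
  -- 0`.
  set δ := min 1 ((β ^ 2 * κ * cL / (E + 1)) ^ (1 / p)) with hδ
  have hδ0 : 0 < δ := by positivity
  have hδ1 : δ ≤ 1 := min_le_left _ _
  have hδE : E ≤ β ^ 2 * κ * (cL * δ ^ (-p)) := by
    have h1 : ((β ^ 2 * κ * cL / (E + 1)) ^ (1 / p)) ^ (-p) ≤ δ ^ (-p) :=
      Real.rpow_le_rpow_of_nonpos hδ0 (min_le_right _ _) (by linarith)
    rw [← Real.rpow_mul (by positivity), show 1 / p * -p = -1 by field_simp, Real.rpow_neg_one,
      inv_div, div_le_iff₀ (by positivity)] at h1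
    linarith
  set c₁ := δ * (θ₂ * D / cL) ^ (-(1 / p)) with hc₁
  have hc₁0 : 0 < c₁ := by positivity
  obtain ⟨m₀, hm₀⟩ := eventually_atTop.1 (hlow.and (hαt.eventually (ge_mem_nhds one_pos)))
  have hαm₀ := h.par_pos m₀
  refine ⟨H * (θ₂ * D * δ ^ (-p) + D₂ ^ 2), by positivity, ?_⟩
  filter_upwards [hφ c₁ hc₁0 δ hδ0, eventually_idealPar_le ha hν τ (half_pos hαm₀),
    eventually_idealPar_le ha hν τ (Real.exp_pos (-1)),
    eventually_mildRate_le ha hντ (c := 1 / (2 * (θ₂ * D * δ ^ (-p)))) (by positivity),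
    eventually_sq_mul_log_sq_le ha hν τ, eventually_le_neg_log_sq 1, self_mem_nhdsWithin]
    with σ hσφ hI1 hI2 hr1 hlogr hL1 hσ
  have hσ : 0 < σ := hσ
  have hL : 0 < -Real.log (σ ^ 2) := by linarith
  have hI := idealPar_pos (a := a) (ν := ν) (τ := τ) hσ hL
  have hr := mildRate_pos (a := a) (ν := ν) (τ := τ) hσ hL
  have hrate : σ ^ 2 * idealPar a ν τ σ ^ (-p) = mildRate a ν τ σ :=
    sq_mul_idealPar_rpow ha hν hσ hL
  set x := idealPar a ν τ σ with hx
  set r := mildRate a ν τ σ with hrdef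
  have hexists : ∃ m, α m ≤ δ * x := (hαt.eventually (ge_mem_nhds (by positivity))).exists
  classical
  set M := Nat.find hexists with hM
  have hMle : α M ≤ δ * x := Nat.find_spec hexists
  have hδx : δ * x ≤ x := mul_le_of_le_one_left hI.le hδ1
  -- So the predecessor of `M` is still in the range where the variance bounds hold.
  have hMm₀ : m₀ < M := by
    by_contra! hcon
    have := hα.anti.antitone hcon
    linarith
  obtain ⟨j, hj⟩ : ∃ j, M = j + 1 := Nat.exists_eq_succ_of_ne_zero (by omega)
  have hjlt : δ * x < α j := lt_of_not_ge (Nat.find_min hexists (by omega))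
  have hMpos := h.par_pos M
  have hyp : (δ * x) ^ (-p) = δ ^ (-p) * x ^ (-p) := Real.mul_rpow hδ0.le hI.le
  -- The candidate before `M` lies above `δ x`, and its variance is at most a factor `θ₂` away.
  have hVM : V M ≤ θ₂ * (D * (δ ^ (-p) * x ^ (-p))) := by
    rw [hj]
    refine (hVθ₂ j).trans (mul_le_mul_of_nonneg_left ?_ hθ₂.le)
    refine (hupp j (hm₀ j (by omega)).2).trans (mul_le_mul_of_nonneg_left ?_ hD.le)
    rw [← hyp]
    exact Real.rpow_le_rpow_of_nonpos (by positivity) hjlt.le (by linarith)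
  have hVM' := (hm₀ M hMm₀.le).1
  have hvM : σ ^ 2 * V M ≤ θ₂ * D * δ ^ (-p) * r := by
    rw [← hrate]
    have := mul_le_mul_of_nonneg_left hVM (sq_nonneg σ)
    linarith
  have hvM' : cL * δ ^ (-p) * r ≤ σ ^ 2 * V M := by
    have h1 : (δ * x) ^ (-p) ≤ α M ^ (-p) :=
      Real.rpow_le_rpow_of_nonpos hMpos hMle (by linarith)
    rw [hyp] at h1
    calc cL * δ ^ (-p) * r = σ ^ 2 * (cL * (δ ^ (-p) * x ^ (-p))) := by rw [← hrate]; ring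
      _ ≤ σ ^ 2 * (cL * α M ^ (-p)) := by gcongr
      _ ≤ _ := by gcongr
  -- Consecutive parameters have no prescribed ratio. That `α M` does not drop far below `x` follows
  -- from the variances: a smaller parameter would have variance above `hVM`. This dictates `c₁`.
  have hMge : c₁ * x ≤ α M := by
    by_contra! hcon
    have h1 : (c₁ * x) ^ (-p) < α M ^ (-p) :=
      Real.rpow_lt_rpow_of_neg hMpos hcon (by linarith)
    have h2 : (c₁ * x) ^ (-p) = θ₂ * D / cL * (δ ^ (-p) * x ^ (-p)) := by
      rw [hc₁, Real.mul_rpow (by positivity) hI.le, Real.mul_rpow hδ0.le (by positivity),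
        ← Real.rpow_mul (by positivity), show -(1 / p) * -p = 1 by field_simp, Real.rpow_one]
      ring
    rw [h2] at h1
    have h3 : cL * (θ₂ * D / cL * (δ ^ (-p) * x ^ (-p))) < cL * α M ^ (-p) := by gcongr
    have h4 : cL * (θ₂ * D / cL * (δ ^ (-p) * x ^ (-p)))
        = θ₂ * (D * (δ ^ (-p) * x ^ (-p))) := by field_simp
    linarith
  have hφM : indexFn ν τ (α M) ^ 2 ≤ Mφ * r := by
    refine (hσφ (α M) hMge hMle).1.trans ?_
    have : δ ^ (2 * ν) ≤ 1 := Real.rpow_le_one hδ0.le hδ1 (by positivity)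
    calc Mφ * δ ^ (2 * ν) * r ≤ Mφ * 1 * r := by gcongr
      _ = _ := by ring
  have hMexp : α M ≤ Real.exp (-1) := hMle.trans (hδx.trans hI2)
  have hφpos := indexFn_pos (ν := ν) (τ := τ) hMpos hMexp
  have hMmax : M ≤ maxIndex lam q α σ := by
    refine le_maxIndex h hVt hσ (lt_of_le_of_lt hvM ?_)
    have h1 : 0 < θ₂ * D * δ ^ (-p) := by positivity
    calc θ₂ * D * δ ^ (-p) * r ≤ θ₂ * D * δ ^ (-p) * (1 / (2 * (θ₂ * D * δ ^ (-p)))) := by gcongr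
      _ = 1 / 2 := by field_simp
      _ < 1 := by norm_num
  have hN : σ ^ 2 * (maxIndex lam q α σ : ℝ) ^ 2 ≤ D₂ ^ 2 * r := by
    calc σ ^ 2 * (maxIndex lam q α σ : ℝ) ^ 2 ≤ σ ^ 2 * (D₂ * -Real.log (σ ^ 2)) ^ 2 := by
          gcongr
          exact hmax σ hσ hL1
      _ = D₂ ^ 2 * (σ ^ 2 * (-Real.log (σ ^ 2)) ^ 2) := by ring
      _ ≤ _ := by gcongr
  refine iSup₂_le fun f hf => ?_
  have hbias : ‖biasVec e lam q α f M‖ ^ 2 ≤ β ^ 2 * κ * (σ ^ 2 * V M) := by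
    have h1 := norm_biasVec_le_of_mem_sourceSet h (m := M) (B := |Cq| * indexFn ν τ (α M))
      (fun k => (indexFn_pos (he.pos k) ((he.anti (Nat.zero_le k)).trans hlam)).le)
      (by positivity) (fun k => (hCq _ (hα.mem M) hMexp _ ⟨(he.pos k).le, he.le_norm k⟩).trans
        (mul_le_mul_of_nonneg_right (le_abs_self _) hφpos.le)) hf
    calc ‖biasVec e lam q α f M‖ ^ 2 ≤ (|Cq| * indexFn ν τ (α M) * ρ) ^ 2 := by gcongr
      _ = Cq ^ 2 * ρ ^ 2 * indexFn ν τ (α M) ^ 2 := by rw [mul_pow, mul_pow, sq_abs]; ring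
      _ ≤ Cq ^ 2 * ρ ^ 2 * (Mφ * r) := by gcongr
      _ = E * r := by rw [hE]; ring
      _ ≤ β ^ 2 * κ * (cL * δ ^ (-p)) * r := by gcongr
      _ = β ^ 2 * κ * (cL * δ ^ (-p) * r) := by ring
      _ ≤ _ := by gcongr
  refine (horacle σ hσ f M hMmax hbias).trans (ENNReal.ofReal_le_ofReal ?_)
  rw [mul_assoc]
  refine mul_le_mul_of_nonneg_left ?_ hH.le
  linarith

end Upper

end SOLIT

theorem mainTheorem1
    {X Y Ω : Type*}
    [NormedAddCommGroup X] [InnerProductSpace ℝ X] [CompleteSpace X]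
    [MeasurableSpace X] [BorelSpace X]
    [NormedAddCommGroup Y] [InnerProductSpace ℝ Y] [CompleteSpace Y]
    [MeasurableSpace Ω] (P : Measure Ω) [IsProbabilityMeasure P]
    -- the white noise model
    (T : X →L[ℝ] Y) (ξ : Y → Ω → ℝ) (hξ : SOLIT.IsWhiteNoise P ξ)
    (e : HilbertBasis ℕ ℝ X) (lam : ℕ → ℝ) (he : SOLIT.IsEigensystem T e lam)
    (hlam : lam 0 ≤ Real.exp (-1))
    -- polynomial decay of the eigenvalues
    (a cmin cmax : ℝ) (ha : 1 < a) (hcmin : 0 < cmin)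
    (hdecay : ∀ k : ℕ, cmin * ((k : ℝ) + 1) ^ (-a) ≤ lam k ∧ lam k ≤ cmax * ((k : ℝ) + 1) ^ (-a))
    -- the ordered filter, the candidates and the parameters of the selection rule
    (A : Set ℝ) (q : ℝ → ℝ → ℝ) (hq : SOLIT.IsOrderedFilter A ‖SOLIT.normalOp T‖ q)
    (θ₁ θ₂ : ℝ) (hθ₁ : 1 < θ₁) (α : ℕ → ℝ) (hα : SOLIT.IsCandidateSeq A lam q θ₁ θ₂ α)
    (hvar : SOLIT.VarianceLowerBound A lam q α)
    (β γ : ℝ) (hβ : 0 < β) (hγ : 0 < γ) :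
    -- the selected estimator is a measurable function of the data
    (∀ σ : ℝ, 0 < σ → Measurable (SOLIT.solitEst P T e lam q α ξ β γ σ)) ∧
    -- and it attains the minimax rate, whatever the smoothness is
    ∀ ν τ ρ : ℝ, (0 < ν ∨ (ν = 0 ∧ 0 < τ)) → 0 < ρ →
      SOLIT.IsQualification A ‖SOLIT.normalOp T‖ q (SOLIT.indexFn ν τ) →
      ∃ c C : ℝ, 0 < c ∧ 0 < C ∧ ∀ᶠ σ in 𝓝[>] (0 : ℝ),
        SOLIT.worstMse P T ξ σ (SOLIT.solitEst P T e lam q α ξ β γ σ)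
            (SOLIT.sourceSet e lam (SOLIT.indexFn ν τ) ρ)
          ≤ ENNReal.ofReal (C * SOLIT.mildRate a ν τ σ) ∧
        ENNReal.ofReal (c * SOLIT.mildRate a ν τ σ)
          ≤ SOLIT.minimaxRisk P T ξ σ (SOLIT.sourceSet e lam (SOLIT.indexFn ν τ) ρ) := by
  refine ⟨fun σ _ => SOLIT.measurable_solitEst P T ξ e lam q α β γ σ, fun ν τ ρ hντ hρ hqual => ?_⟩
  have hν : 0 ≤ ν := by rcases hντ with h | h <;> linarith [h]
  obtain ⟨c, hc, hlow⟩ := SOLIT.minimaxRisk_ge_mildRate hξ he hlam ha hcmin hdecay hν τ hρ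
  obtain ⟨C, hC, hupp⟩ := SOLIT.worstMse_solitEst_le_mildRate hξ he hlam ha hcmin hdecay hq hθ₁ hα
    hvar hβ hγ hντ hρ hqual
  exact ⟨c, C, hc, hC, hupp.and hlow⟩
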